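/- Let $\mathbb F$ be a field of characteristic zero, $H$ a finite-dimensional semisimple Hopf algebra over $\mathbb F$ with antipode $S$ and dual Hopf algebra $H^*$, and let $\ell\in H$, $\eta\in H^*$ be the Haar integrals, i.e. $h\ell=\ell h=\epsilon(h)\ell$ for all $h$, $\epsilon(\ell)=1$, and likewise for $\eta$. Let $\{x_i\}$ be a basis of $H$ and $\{\alpha^i\}$ the dual basis. *Algebras.* The Heisenberg double $\mathcal H(H)$ is $H\otimes H^*$ with $(h\otimes\alpha)(h'\otimes\alpha')=\langle\alpha_{(1)},h'_{(2)}\rangle\,hh'_{(1)}\otimes\alpha_{(2)}\alpha'$. The dual $D(H)^*$ of the Drinfeld double is $H\otimes H^*$ with $(y\otimes\gamma)\cdot'(z\otimes\delta)=zy\otimes\gamma\delta$, comultiplication $y\otimes\gamma\mapsto\sum_{i,j}(y_{(1)}\otimes\alpha^i\gamma_{(1)}\alpha^j)\otimes(S(x_j)y_{(2)}x_i\otimes\gamma_{(2)})$, counit $\epsilon\otimes\epsilon$ and antipode $S_D(y\otimes\gamma)=\sum_{i,j}x_iS^{-1}(y)x_j\otimes S(\alpha^j)S(\gamma)\alpha^i$.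 Put $\phi:\mathcal H(H)\to\mathrm{End}_{\mathbb F}(H)$, $\phi(y\otimes\alpha)h=\langle\alpha,h_{(2)}\rangle\,yh_{(1)}$, and $\rho=\phi^{\otimes E}:\mathcal H(H)^{\otimes E}\to\mathrm{End}_{\mathbb F}(H^{\otimes E})$. For a finite set $E$ write $(a)_e$ for the pure tensor with entry $a$ at $e\in E$ and $1$ elsewhere. *Graphs.* Let $\Gamma$ be a finite directed graph with vertex set $V$, edge set $E$ and a linear ordering (counterclockwise from the cilium) of the edge ends at each vertex. A path turns maximally right at a vertex if the starting end of the edge on which it leaves comes directly after the end through which it arrives, in the induced cyclic ordering. A ciliated face is a closed path $e_1^{\epsilon_1}\circ\dots\circ e_n^{\epsilon_n}$, $n\ge 1$ (with $e_n^{\epsilon_n}$ traversed first), that turns maximally right at every vertex, including the starting vertex, and traverses each edge at most once in each direction; the set $F$ of faces consists of the ciliated faces up to cyclic permutation. A face contains the cilium at $v$ if it leaves $v$ through the lowest edge end at $v$. Assume that $\Gamma$ is regular: it has no loops or multiple edges, each face traverses each edge at most once, and each face contains exactly one cilium. Let $f(v)$ be the ciliated face that starts and ends at the cilium at $v$, i.e.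 that leaves $v$ first through its lowest edge end (the trivial path if $v$ is isolated). *Kitaev's Hamiltonian.* For $L^h_+k=hk$, $L^h_-k=kh$, $T^\alpha_+k=\langle\alpha,k_{(2)}\rangle k_{(1)}$, $T^\alpha_-k=\langle\alpha,k_{(1)}\rangle k_{(2)}$, let $L^h_{e\pm},T^\alpha_{e\pm}$ denote these operators acting on the copy of $H$ at $e$ in $H^{\otimes E}$. If $e_1,\dots,e_n$ are the edges at $v$ in their order and $e_i^{\epsilon_i}$ is incoming, then $A_v^h=L_{e_1\epsilon_1}^{S^{\tau_1}(h_{(1)})}\circ\dots\circ L_{e_n\epsilon_n}^{S^{\tau_n}(h_{(n)})}$ with $\tau_i=\frac12(1-\epsilon_i)$; for a ciliated face $f=e_1^{\epsilon_1}\circ\dots\circ e_n^{\epsilon_n}$, $B_f^\alpha=T_{e_1\epsilon_1}^{S^{\tau_1}(\alpha_{(1)})}\circ\dots\circ T_{e_n\epsilon_n}^{S^{\tau_n}(\alpha_{(n)})}$. Kitaev's Hamiltonian is $H_K=\prod_{v\in V}A_v^\ell\circ\prod_{f\in F}B_f^\eta$, and the protected space is $\mathcal L=H_K(H^{\otimes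 E})$. *Holonomies.* The thickening of $\Gamma$ has four edges $r(e),l(e),r(\bar e),l(\bar e)$ for each $e\in E$. Put $\mathrm{Hol}_{r(e)}(y\otimes\gamma)=\epsilon(y)(1\otimes\gamma)_e$, $\mathrm{Hol}_{r(\bar e)}(y\otimes\gamma)=\epsilon(\gamma)(y\otimes1)_e$, $\mathrm{Hol}_{l(e)}=S_D\circ\mathrm{Hol}_{r(e)}\circ S_D$, $\mathrm{Hol}_{l(\bar e)}=S_D\circ\mathrm{Hol}_{r(\bar e)}\circ S_D$ (the outer $S_D$ acting on the copy of $H\otimes H^*$ at $e$), $\mathrm{Hol}_{x^{-1}}=\mathrm{Hol}_x\circ S_D$, and extend to words by convolution, $\mathrm{Hol}_{p\circ q}(c)=\mathrm{Hol}_p(c_{(1)})\cdot'\mathrm{Hol}_q(c_{(2)})$, with the comultiplication of $D(H)^*$ and the multiplication of $D(H)^{*\otimes E}$ (the empty word has holonomy $c\mapsto\epsilon(c)1$). Values are regarded as elements of $\mathcal H(H)^{\otimes E}$, the same vector space. With $r(e^{-1})=l(e)^{-1}$ and $r(\bar e^{\,-1})=l(\bar e)^{-1}$, let $p_v=r(\bar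 e_1^{\epsilon_1})\circ\dots\circ r(\bar e_n^{\epsilon_n})$ for the edges at $v$ as above and $p_f=r(e_1^{\epsilon_1})\circ\dots\circ r(e_n^{\epsilon_n})$ for $f=e_1^{\epsilon_1}\circ\dots\circ e_n^{\epsilon_n}$. *Gauge transformations.* For $\delta\in H^*$, $z\in H$, $v\in V$, $X\in\mathcal H(H)^{\otimes E}$ let $$X\lhd(\delta\otimes z)_v=\mathrm{Hol}_{p_v}(S(z_{(2)})\otimes1)\,\mathrm{Hol}_{p_{f(v)}}(1\otimes S(\delta_{(1)}))\,X\,\mathrm{Hol}_{p_{f(v)}}(1\otimes\delta_{(2)})\,\mathrm{Hol}_{p_v}(z_{(1)}\otimes1),$$ let $Q_{inv}$ be the composite over all $v\in V$ of the maps $X\mapsto X\lhd(\eta\otimes\ell)_v$, and $\mathcal H(H)^{\otimes E}_{inv}$ its image. Put $G_v=\mathrm{Hol}_{p_v}(\ell\otimes1)\cdot\mathrm{Hol}_{p_{f(v)}}(1\otimes\eta)$, $Q_v(X)=X\cdot G_v$ and $Q_{flat}=\prod_{v\in V}Q_v$. Then: 1. $\mathcal H(H)^{\otimes E}_{inv}$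 is a subalgebra of $\mathcal H(H)^{\otimes E}$ and equals $\{X: X\lhd(\delta\otimes z)_v=\epsilon(\delta)\epsilon(z)X\ \forall v,\delta,z\}$. The $G_v$ are commuting idempotents in its centre. 2. The maps $Q_v$ are commuting projectors, and $Q_v(X\lhd(\eta\otimes\ell)_v)=G_v\cdot X\cdot G_v$ for all $X\in\mathcal H(H)^{\otimes E}$. 3. $Q_{flat}$ is the map $X\mapsto X\cdot\prod_{v}G_v$ (for any order of the factors) and is a projector. On $\mathcal H(H)^{\otimes E}_{inv}$ it is multiplicative, and it projects $\mathcal H(H)^{\otimes E}_{inv}$ onto $\mathcal H(H)^{\otimes E}_{flat}=Q_{flat}(\mathcal H(H)^{\otimes E}_{inv})\subset \mathcal H(H)^{\otimes E}_{inv}$, which is closed under addition, scalars and products and has unit $Q_{flat}(1)$. 4. $H_K$ does not depend on the order of the vertices and faces or on the ciliated faces representing the faces, it is a projector, and $H_K=\rho(Q_{flat}(1))$. 5. There is a unital algebra homomorphism $\rho_{pr}:\mathcal H(H)^{\otimes E}_{inv}\to\mathrm{End}_{\mathbb F}(\mathcal L)$ with $$\rho_{pr}(X)=\rho(X)|_{\mathcal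 L}=H_K\circ\rho(X)|_{\mathcal L}\quad\text{and}\quad\rho_{pr}(X)=\rho_{pr}(Q_{flat}(X))\qquad\text{for all }X\in\mathcal H(H)^{\otimes E}_{inv}.$$ -/

import Mathlib

open scoped TensorProduct

namespace Kitaev

noncomputable section

/-! ## Hopf algebras: duals, Haar integrals, the Heisenberg double, the dual Drinfeld double -/

section HopfAlgebra

variable (F H : Type*) [Field F] [Ring H] [HopfAlgebra F H]

/-- The dual Hopf algebra `H*` as an algebra, with the convolution product
`⟨αβ, h⟩ = ⟨α, h₍₁₎⟩⟨β, h₍₂₎⟩` and unit `ε`. -/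
abbrev DualHopf := WithConv (H →ₗ[F] F)

variable {F} in
/-- `ℓ` is a (normalised) Haar integral of an algebra `A` with counit `ε`:
`h ℓ = ℓ h = ε(h) ℓ` for all `h` and `ε(ℓ) = 1`. -/
def IsHaarIntegral {A : Type*} [Ring A] [Algebra F A] (ε : A →ₗ[F] F) (ℓ : A) : Prop :=
  (∀ h : A, h * ℓ = ε h • ℓ ∧ ℓ * h = ε h • ℓ) ∧ ε ℓ = 1

/-- The counit of `H*`: evaluation at `1`. -/
def dualCounit : DualHopf F H →ₗ[F] F where
  toFun α := α.ofConv 1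
  map_add' _ _ := rfl
  map_smul' _ _ := rfl

/-- The antipode of `H*`: `α ↦ α ∘ S`. -/
def dualAntipode : DualHopf F H →ₗ[F] DualHopf F H where
  toFun α := WithConv.toConv (α.ofConv ∘ₗ HopfAlgebra.antipode F)
  map_add' _ _ := rfl
  map_smul' _ _ := rfl

/-- The inverse `S⁻¹` of the antipode of `H`, as the inverse in the algebra of endomorphisms
(the antipode of a finite-dimensional Hopf algebra is bijective). -/
def antipodeInv : H →ₗ[F] H :=
  Ring.inverse (HopfAlgebra.antipode F (A := H) : Module.End F H)

/-- The comultiplication of `H*` for finite-dimensional `H`, dual to the multiplication: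
`⟨α₍₁₎, h⟩⟨α₍₂₎, k⟩ = ⟨α, hk⟩`. -/
def dualComul [FiniteDimensional F H] : DualHopf F H →ₗ[F] DualHopf F H ⊗[F] DualHopf F H :=
  TensorProduct.map (WithConv.linearEquiv F (H →ₗ[F] F)).symm.toLinearMap
      (WithConv.linearEquiv F (H →ₗ[F] F)).symm.toLinearMap ∘ₗ
    (TensorProduct.dualDistribEquiv F H H).symm.toLinearMap ∘ₗ
    (LinearMap.mul' F H).dualMap ∘ₗ
    (WithConv.linearEquiv F (H →ₗ[F] F)).toLinearMap

/-- The right regular action of `H` on `H*`: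
`α ◁ h = ⟨α₍₁₎, h⟩ α₍₂₎`, that is `(α ◁ h)(k) = α(hk)`. -/
def rightRegular : DualHopf F H →ₗ[F] H →ₗ[F] DualHopf F H :=
  LinearMap.mk₂ F (fun α h => WithConv.toConv (α.ofConv ∘ₗ LinearMap.mulLeft F h))
    (fun _ _ _ => rfl) (fun _ _ _ => rfl)
    (fun α h h' => by ext k; simp [add_mul])
    (fun c α h => by ext k; simp)

/-- The underlying vector space `H ⊗ H*` of the Heisenberg double `𝓗(H)`. -/
def HeisenbergDouble := H ⊗[F] DualHopf F H

/-- The multiplication of the Heisenberg double, the right smash product `H # H*` for the right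
regular action: `(h ⊗ α)(h' ⊗ α') = ⟨α₍₁₎, h'₍₂₎⟩ h h'₍₁₎ ⊗ α₍₂₎ α' = h h'₍₁₎ ⊗ (α ◁ h'₍₂₎) α'`. -/
def heisenbergMul :
    H ⊗[F] DualHopf F H →ₗ[F] H ⊗[F] DualHopf F H →ₗ[F] H ⊗[F] DualHopf F H :=
  TensorProduct.lift (LinearMap.mk₂ F
    (fun h α => TensorProduct.lift (LinearMap.mk₂ F
      (fun h' α' => TensorProduct.map (LinearMap.mulLeft F h)
        (LinearMap.mulRight F α' ∘ₗ rightRegular F H α) (Coalgebra.comul (R := F) h'))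
      (fun _ _ _ => by simp)
      (fun _ _ _ => by simp)
      (fun h' α' β' => by
        rw [← LinearMap.add_apply, ← TensorProduct.map_add_right, ← LinearMap.add_comp]
        congr 3; ext; simp [mul_add])
      (fun c h' α' => by
        rw [← LinearMap.smul_apply, ← TensorProduct.map_smul_right, ← LinearMap.smul_comp]
        congr 3; exact LinearMap.ext fun x => mul_smul_comm c x α')))
    (fun h k α => by
      ext h' α'
      simp only [TensorProduct.AlgebraTensorModule.curry_apply, TensorProduct.curry_apply,
        LinearMap.coe_restrictScalars, TensorProduct.lift.tmul, LinearMap.mk₂_apply,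
        LinearMap.add_apply]
      rw [← LinearMap.add_apply, ← TensorProduct.map_add_left]
      congr 2; ext; simp [add_mul])
    (fun c h α => by
      ext h' α'
      simp only [TensorProduct.AlgebraTensorModule.curry_apply, TensorProduct.curry_apply,
        LinearMap.coe_restrictScalars, TensorProduct.lift.tmul, LinearMap.mk₂_apply,
        LinearMap.smul_apply]
      rw [← LinearMap.smul_apply, ← TensorProduct.map_smul_left]
      congr 2; ext; simp)
    (fun h α β => by
      ext h' α'
      simp only [TensorProduct.AlgebraTensorModule.curry_apply, TensorProduct.curry_apply,
        LinearMap.coe_restrictScalars, TensorProduct.lift.tmul, LinearMap.mk₂_apply,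
        LinearMap.add_apply, map_add]
      rw [← LinearMap.add_apply, ← TensorProduct.map_add_right, ← LinearMap.comp_add])
    (fun c h α => by
      ext h' α'
      simp only [TensorProduct.AlgebraTensorModule.curry_apply, TensorProduct.curry_apply,
        LinearMap.coe_restrictScalars, TensorProduct.lift.tmul, LinearMap.mk₂_apply,
        LinearMap.smul_apply, map_smul]
      rw [LinearMap.comp_smul, TensorProduct.map_smul_right, LinearMap.smul_apply]))

theorem heisenbergMul_tmul (h h' : H) (α α' : DualHopf F H) :
    heisenbergMul F H (h ⊗ₜ α) (h' ⊗ₜ α') =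
      TensorProduct.map (LinearMap.mulLeft F h)
        (LinearMap.mulRight F α' ∘ₗ rightRegular F H α) (Coalgebra.comul (R := F) h') := rfl

theorem rightRegular_mul (α β : DualHopf F H) (h : H) :
    rightRegular F H (α * β) h =
      LinearMap.mul' F (DualHopf F H) (TensorProduct.map (rightRegular F H α) (rightRegular F H β)
        (Coalgebra.comul (R := F) h)) := by
  refine WithConv.ext (LinearMap.ext fun k => ?_)
  let r := Coalgebra.Repr.arbitrary F h
  let q := Coalgebra.Repr.arbitrary F k
  change (α * β) (h * k) = _
  rw [LinearMap.convMul_apply, Bialgebra.comul_mul, ← r.eq, ← q.eq]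
  simp only [map_sum, Finset.sum_mul_sum, Algebra.TensorProduct.tmul_mul_tmul,
    TensorProduct.map_tmul, LinearMap.mul'_apply, WithConv.ofConv_sum, LinearMap.sum_apply]
  refine Finset.sum_congr rfl fun i _ => ?_
  rw [q.convMul_apply]
  rfl

theorem rightRegular_rightRegular (α : DualHopf F H) (h k : H) :
    rightRegular F H (rightRegular F H α h) k = rightRegular F H α (h * k) := by
  refine WithConv.ext (LinearMap.ext fun x => ?_)
  change α.ofConv (h * (k * x)) = α.ofConv (h * k * x)
  rw [mul_assoc]

theorem rightRegular_one (α : DualHopf F H) : rightRegular F H α 1 = α := by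
  refine WithConv.ext (LinearMap.ext fun x => ?_)
  change α.ofConv (1 * x) = α.ofConv x
  rw [one_mul]

theorem one_rightRegular (h : H) :
    rightRegular F H 1 h = Coalgebra.counit (R := F) h • (1 : DualHopf F H) := by
  refine WithConv.ext (LinearMap.ext fun x => ?_)
  change Coalgebra.counit (R := F) (h * x) =
    Coalgebra.counit (R := F) h • Coalgebra.counit (R := F) x
  rw [Bialgebra.counit_mul, smul_eq_mul]

theorem heisenbergMul_repr {ι : Type*} (h h' : H) (α α' : DualHopf F H)
    (r : Coalgebra.Repr F h' ι) :
    heisenbergMul F H (h ⊗ₜ α) (h' ⊗ₜ α') =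
      ∑ i ∈ r.index, (h * r.left i) ⊗ₜ[F] (rightRegular F H α (r.right i) * α') := by
  rw [heisenbergMul_tmul, ← r.eq, map_sum]
  rfl

theorem heisenbergMul_assoc (x y z : H ⊗[F] DualHopf F H) :
    heisenbergMul F H (heisenbergMul F H x y) z = heisenbergMul F H x (heisenbergMul F H y z) := by
  induction x with
  | zero => simp
  | add x x' hx hx' => simp only [map_add, LinearMap.add_apply, hx, hx']
  | tmul h α =>
  induction y with
  | zero => simp
  | add y y' hy hy' => simp only [map_add, LinearMap.add_apply, hy, hy']
  | tmul h' α' =>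
  induction z with
  | zero => simp
  | add z z' hz hz' => simp only [map_add, hz, hz']
  | tmul h'' α'' =>
  let r := Coalgebra.Repr.arbitrary F h'
  let q := Coalgebra.Repr.arbitrary F h''
  let a₁ := fun j => Coalgebra.Repr.arbitrary F (q.left j)
  let a₂ := fun j => Coalgebra.Repr.arbitrary F (q.right j)
  have key := fun i => congrArg
    (LinearMap.lTensor H (LinearMap.mul' F (DualHopf F H)) ∘ₗ
      TensorProduct.map (LinearMap.mulLeft F (h * r.left i))
        (TensorProduct.map (rightRegular F H (rightRegular F H α (r.right i)))
          (LinearMap.mulRight F α'' ∘ₗ rightRegular F H α')))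
    (Coalgebra.sum_tmul_tmul_eq q a₁ a₂)
  simp only [map_sum, LinearMap.comp_apply, LinearMap.lTensor_tmul, LinearMap.mul'_apply,
    TensorProduct.map_tmul, LinearMap.mulLeft_apply, LinearMap.mulRight_apply] at key
  have hL : heisenbergMul F H (heisenbergMul F H (h ⊗ₜ α) (h' ⊗ₜ α')) (h'' ⊗ₜ α'') =
      ∑ i ∈ r.index, ∑ j ∈ q.index, ∑ k ∈ (a₂ j).index, (h * r.left i * q.left j) ⊗ₜ[F]
        (rightRegular F H (rightRegular F H α (r.right i)) ((a₂ j).left k) *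
          (rightRegular F H α' ((a₂ j).right k) * α'')) := by
    rw [heisenbergMul_repr F H h h' α α' r, map_sum, LinearMap.sum_apply]
    refine Finset.sum_congr rfl fun i _ => ?_
    rw [heisenbergMul_repr F H _ _ _ _ q]
    refine Finset.sum_congr rfl fun j _ => ?_
    rw [rightRegular_mul, ← (a₂ j).eq]
    simp only [map_sum, TensorProduct.map_tmul, LinearMap.mul'_apply, Finset.sum_mul,
      TensorProduct.tmul_sum, mul_assoc]
  have hR : heisenbergMul F H (h ⊗ₜ α) (heisenbergMul F H (h' ⊗ₜ α') (h'' ⊗ₜ α'')) =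
      ∑ i ∈ r.index, ∑ j ∈ q.index, ∑ k ∈ (a₁ j).index, (h * r.left i * (a₁ j).left k) ⊗ₜ[F]
        (rightRegular F H (rightRegular F H α (r.right i)) ((a₁ j).right k) *
          (rightRegular F H α' (q.right j) * α'')) := by
    rw [heisenbergMul_repr F H h' h'' α' α'' q, map_sum, Finset.sum_comm]
    refine Finset.sum_congr rfl fun j _ => ?_
    rw [heisenbergMul_tmul, Bialgebra.comul_mul, ← r.eq, ← (a₁ j).eq]
    simp only [Finset.sum_mul_sum, Algebra.TensorProduct.tmul_mul_tmul, map_sum,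
      TensorProduct.map_tmul, LinearMap.mulLeft_apply, LinearMap.comp_apply,
      LinearMap.mulRight_apply, rightRegular_rightRegular, mul_assoc]
  rw [hL, hR]
  exact Finset.sum_congr rfl fun i _ => (key i).symm

theorem heisenbergMul_one_left (x : H ⊗[F] DualHopf F H) :
    heisenbergMul F H (1 ⊗ₜ 1) x = x := by
  induction x with
  | zero => simp
  | add x x' hx hx' => simp only [map_add, hx, hx']
  | tmul h α =>
  let r := Coalgebra.Repr.arbitrary F h
  have hr := congrArg (TensorProduct.map (LinearMap.id : H →ₗ[F] H)
    (LinearMap.toSpanSingleton F (DualHopf F H) α)) (Coalgebra.sum_tmul_counit_eq r)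
  simp only [map_sum, TensorProduct.map_tmul, LinearMap.toSpanSingleton_apply, one_smul,
    LinearMap.id_apply] at hr
  rw [heisenbergMul_repr F H _ _ _ _ r, ← hr]
  exact Finset.sum_congr rfl fun i _ => by
    rw [one_mul, one_rightRegular, smul_mul_assoc, one_mul]

theorem heisenbergMul_one_right (x : H ⊗[F] DualHopf F H) :
    heisenbergMul F H x (1 ⊗ₜ 1) = x := by
  induction x with
  | zero => simp
  | add x x' hx hx' => simp only [map_add, LinearMap.add_apply, hx, hx']
  | tmul h α =>
  rw [heisenbergMul_tmul, Bialgebra.comul_one, Algebra.TensorProduct.one_def]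
  simp [rightRegular_one]

instance : Ring (HeisenbergDouble F H) :=
  { (inferInstanceAs (AddCommGroup (H ⊗[F] DualHopf F H)) :
      AddCommGroup (HeisenbergDouble F H)) with
    mul := fun x y => heisenbergMul F H x y
    one := ((1 : H) ⊗ₜ[F] (1 : DualHopf F H) : H ⊗[F] DualHopf F H)
    left_distrib := fun x y z => (heisenbergMul F H x).map_add y z
    right_distrib := fun x y z => (heisenbergMul F H).map_add₂ x y z
    zero_mul := fun x => (heisenbergMul F H).map_zero₂ x
    mul_zero := fun x => (heisenbergMul F H x).map_zero
    mul_assoc := heisenbergMul_assoc F H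
    one_mul := heisenbergMul_one_left F H
    mul_one := heisenbergMul_one_right F H }

instance : Algebra F (HeisenbergDouble F H) :=
  letI : Module F (HeisenbergDouble F H) := inferInstanceAs (Module F (H ⊗[F] DualHopf F H))
  Algebra.ofModule (fun c x y => (heisenbergMul F H).map_smul₂ c x y)
    (fun c x y => (heisenbergMul F H x).map_smul c y)

/-- The identity map from the vector space `H ⊗ H*` to the algebra `𝓗(H)`. -/
def toHeisenberg : H ⊗[F] DualHopf F H ≃ₗ[F] HeisenbergDouble F H where
  toFun x := x
  invFun x := x
  map_add' _ _ := rfl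
  map_smul' _ _ := rfl
  left_inv _ := rfl
  right_inv _ := rfl

theorem toHeisenberg_mul (x y : H ⊗[F] DualHopf F H) :
    toHeisenberg F H x * toHeisenberg F H y = toHeisenberg F H (heisenbergMul F H x y) := rfl

theorem toHeisenberg_one : toHeisenberg F H (1 ⊗ₜ 1) = 1 := rfl

/-- The algebra `D(H)*` dual to the Drinfeld double: the vector space `H ⊗ H*` with the
multiplication `(y ⊗ γ)(z ⊗ δ) = zy ⊗ γδ`, that is, the algebra `Hᵒᵖ ⊗ H*`. -/
def DrinfeldDual := Hᵐᵒᵖ ⊗[F] DualHopf F H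

instance : Ring (DrinfeldDual F H) := inferInstanceAs (Ring (Hᵐᵒᵖ ⊗[F] DualHopf F H))

instance : Algebra F (DrinfeldDual F H) := inferInstanceAs (Algebra F (Hᵐᵒᵖ ⊗[F] DualHopf F H))

/-- The identity map `y ⊗ γ ↦ y ⊗ γ` from the vector space `H ⊗ H*` to the algebra `D(H)*`. -/
def toDrinfeldDual : H ⊗[F] DualHopf F H ≃ₗ[F] DrinfeldDual F H :=
  (TensorProduct.congr (MulOpposite.opLinearEquiv F) (LinearEquiv.refl F (DualHopf F H)) :
    H ⊗[F] DualHopf F H ≃ₗ[F] Hᵐᵒᵖ ⊗[F] DualHopf F H)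

theorem toDrinfeldDual_mul (y z : H) (γ δ : DualHopf F H) :
    toDrinfeldDual F H (y ⊗ₜ γ) * toDrinfeldDual F H (z ⊗ₜ δ) =
      toDrinfeldDual F H ((z * y) ⊗ₜ (γ * δ)) :=
  Algebra.TensorProduct.tmul_mul_tmul (MulOpposite.op y) (MulOpposite.op z) γ δ

/-- The counit of `D(H)*`: `y ⊗ γ ↦ ε(y) ε(γ)`. -/
def drinfeldCounit : H ⊗[F] DualHopf F H →ₗ[F] F :=
  LinearMap.mul' F F ∘ₗ TensorProduct.map Coalgebra.counit (dualCounit F H)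

variable [FiniteDimensional F H]

/-- A basis `{xᵢ}` of `H`. -/
abbrev stdBasis : Module.Basis (Fin (Module.finrank F H)) F H := Module.finBasis F H

/-- The dual basis `{αⁱ}` of `H*`. -/
def dualBasis (i : Fin (Module.finrank F H)) : DualHopf F H :=
  WithConv.toConv ((stdBasis F H).coord i)

/-- The comultiplication of `D(H)*`:
`y ⊗ γ ↦ ∑ᵢⱼ (y₍₁₎ ⊗ αⁱ γ₍₁₎ αʲ) ⊗ (S(xⱼ) y₍₂₎ xᵢ ⊗ γ₍₂₎)`. -/
def drinfeldComul :
    H ⊗[F] DualHopf F H →ₗ[F] (H ⊗[F] DualHopf F H) ⊗[F] (H ⊗[F] DualHopf F H) :=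
  (∑ i, ∑ j, TensorProduct.map
      (TensorProduct.map LinearMap.id
        (LinearMap.mulLeft F (dualBasis F H i) ∘ₗ LinearMap.mulRight F (dualBasis F H j)))
      (TensorProduct.map
        (LinearMap.mulLeft F (HopfAlgebra.antipode F (stdBasis F H j)) ∘ₗ
          LinearMap.mulRight F (stdBasis F H i)) LinearMap.id)) ∘ₗ
    (TensorProduct.tensorTensorTensorComm F H H (DualHopf F H) (DualHopf F H)).toLinearMap ∘ₗ
    TensorProduct.map Coalgebra.comul (dualComul F H)

/-- The antipode `S_D` of `D(H)*`:
`y ⊗ γ ↦ ∑ᵢⱼ xᵢ S⁻¹(y) xⱼ ⊗ S(αʲ) S(γ) αⁱ`. -/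
def drinfeldAntipode : H ⊗[F] DualHopf F H →ₗ[F] H ⊗[F] DualHopf F H :=
  ∑ i, ∑ j, TensorProduct.map
    (LinearMap.mulLeft F (stdBasis F H i) ∘ₗ LinearMap.mulRight F (stdBasis F H j) ∘ₗ
      antipodeInv F H)
    (LinearMap.mulLeft F (dualAntipode F H (dualBasis F H j)) ∘ₗ
      LinearMap.mulRight F (dualBasis F H i) ∘ₗ dualAntipode F H)

end HopfAlgebra

/-- The iterated convolution product `f₁ • … • fₙ : C → A` of linear maps from a space `C` with
comultiplication `Δ` and counit `ε` to an algebra `A`, where `f • g = m ∘ (f ⊗ g) ∘ Δ`: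
`c ↦ f₁(c₍₁₎) ⋯ fₙ(c₍ₙ₎)`. The empty product is the unit `c ↦ ε(c) 1`. -/
def iteratedConv {F C A : Type*} [Field F] [AddCommGroup C] [Module F C] [Ring A] [Algebra F A]
    (Δ : C →ₗ[F] C ⊗[F] C) (ε : C →ₗ[F] F) : List (C →ₗ[F] A) → (C →ₗ[F] A)
  | [] => Algebra.linearMap F A ∘ₗ ε
  | f :: l => LinearMap.mul' F A ∘ₗ TensorProduct.map f (iteratedConv Δ ε l) ∘ₗ Δ

/-! ## Ciliated ribbon graphs

Oriented edges `e^{±1}` are pairs in `E × Bool`: `(e, true)` is `e` and `(e, false)` is `e⁻¹`.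
The same pairs encode edge ends: `(e, true)` is the target end and `(e, false)` the starting end
of `e`. Thus `(e, ε)` is the edge end through which the oriented edge `e^ε` arrives. -/

/-- A ciliated ribbon graph: a finite directed graph with a linear ordering of the edge ends
incident at each vertex (counterclockwise, starting at the cilium), given as a list. -/
structure CiliatedRibbonGraph (V E : Type*) where
  /-- The starting vertex of an edge. -/
  st : E → V
  /-- The target vertex of an edge. -/
  ta : E → V
  /-- The linearly ordered list of edge ends incident at a vertex. -/
  ends : V → List (E × Bool)
  nodup_ends : ∀ v, (ends v).Nodup
  mem_ends : ∀ v e b, (e, b) ∈ ends v ↔ (if b then ta e else st e) = v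

/-- Reversal `e^ε ↦ e^{-ε}` of oriented edges. -/
def rev {E : Type*} (a : E × Bool) : E × Bool := (a.1, !a.2)

namespace CiliatedRibbonGraph

variable {V E : Type*} (Γ : CiliatedRibbonGraph V E)

/-- The target vertex of an oriented edge. -/
def tgt (a : E × Bool) : V := if a.2 then Γ.ta a.1 else Γ.st a.1

/-- The starting vertex of an oriented edge. -/
def src (a : E × Bool) : V := Γ.tgt (rev a)

theorem mem_ends_tgt (a : E × Bool) : a ∈ Γ.ends (Γ.tgt a) := (Γ.mem_ends _ a.1 a.2).2 rfl

/-- The oriented edge `a` starts at the cilium of its starting vertex `v`, i.e. its starting end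
is the edge end of lowest order at `v`. For a path that turns maximally right at `v`, this means
that the path passes through the cilium of `v` when it leaves `v` along `a`. -/
def StartsAtCilium (a : E × Bool) : Prop := (Γ.ends (Γ.src a)).head? = some (rev a)

variable [DecidableEq E]

/-- The oriented edge on which a path continues when it arrives along `a` and turns maximally
right: the starting end of this edge comes directly after the target end of `a` in the cyclic
ordering of the edge ends at the target vertex of `a`. -/
def rightTurn (a : E × Bool) : E × Bool :=
  rev ((Γ.ends (Γ.tgt a)).next a (Γ.mem_ends_tgt a))

/-- A word `e₁^{ε₁} ∘ ⋯ ∘ eₙ^{εₙ}` up to cyclic permutations (`eₙ^{εₙ}` is traversed first), given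
as a cycle, is a face if it is non-empty, traverses each edge at most once in each direction, and
is a closed path that turns maximally right at each vertex. -/
def IsFace (c : Cycle (E × Bool)) : Prop :=
  c ≠ Cycle.nil ∧ c.Nodup ∧ c.Chain fun a b => a = Γ.rightTurn b

/-- A ciliated face: a word `e₁^{ε₁} ∘ ⋯ ∘ eₙ^{εₙ}`, given as the list of its letters from left to
right, that is a closed path which turns maximally right at each vertex, including the starting
vertex, and traverses each edge at most once in each direction. -/
def IsCiliatedFace (l : List (E × Bool)) : Prop := Γ.IsFace (l : Cycle (E × Bool))

/-- The set of faces. -/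
abbrev Face := {c : Cycle (E × Bool) // Γ.IsFace c}

instance [Fintype E] : Fintype Γ.Face :=
  Fintype.ofInjective
    (fun f => (⟨f.1, f.2.2.1⟩ : {s : Cycle (E × Bool) // s.Nodup}))
    (fun _ _ h => Subtype.ext (by simpa using h))

/-- A ciliated ribbon graph is regular if it has no loops or multiple edges, each face traverses
each edge at most once, and each face contains exactly one cilium. -/
structure IsRegular : Prop where
  no_loops : ∀ e, Γ.st e ≠ Γ.ta e
  no_multiple_edges : Function.Injective fun e => s(Γ.st e, Γ.ta e)
  edge_at_most_once : ∀ (f : Γ.Face) (e : E), ¬ ((e, true) ∈ f.1 ∧ (e, false) ∈ f.1)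
  one_cilium : ∀ f : Γ.Face, ∃! a, a ∈ f.1 ∧ Γ.StartsAtCilium a

/-- The oriented edges, in the order of traversal, of the closed path that starts with `a` and
turns maximally right at each vertex. -/
def rightPath (a : E × Bool) : List (E × Bool) :=
  (List.range (Function.minimalPeriod Γ.rightTurn a)).map fun n => Γ.rightTurn^[n] a

/-- The ciliated face `f(v)` that starts and ends at the cilium at `v`, as a word (the edge
traversed first is the last letter): it leaves `v` through the edge end of lowest order and turns
maximally right at each vertex. (It is the trivial path if `v` is an isolated vertex.) -/
def siteFace (v : V) : List (E × Bool) :=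
  match (Γ.ends v).head? with
  | none => []
  | some d => (Γ.rightPath (rev d)).reverse

theorem rightTurn_injective : Function.Injective Γ.rightTurn := by
  intro a b h
  have hrev : Function.Injective (rev : E × Bool → E × Bool) := by
    rintro ⟨e, s⟩ ⟨e', s'⟩ h
    simpa [rev] using h
  have h' := hrev h
  have ha := List.next_mem _ a (Γ.mem_ends_tgt a)
  have hb := List.next_mem _ b (Γ.mem_ends_tgt b)
  rw [← h', ← Prod.mk.eta (p := (Γ.ends (Γ.tgt a)).next a _), Γ.mem_ends] at hb
  rw [← Prod.mk.eta (p := (Γ.ends (Γ.tgt a)).next a _), Γ.mem_ends] at ha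
  have hv : Γ.tgt a = Γ.tgt b := ha.symm.trans hb
  have hmem : b ∈ Γ.ends (Γ.tgt a) := hv ▸ Γ.mem_ends_tgt b
  have h'' : (Γ.ends (Γ.tgt a)).next a (Γ.mem_ends_tgt a) = (Γ.ends (Γ.tgt a)).next b hmem := by
    rw [h']; congr 1; rw [hv]
  rw [← List.prev_next _ (Γ.nodup_ends _) a (Γ.mem_ends_tgt a),
    ← List.prev_next _ (Γ.nodup_ends _) b hmem]
  congr 1

theorem chain_reverse {α : Type*} (r : α → α → Prop) (l : List α) :
    Cycle.Chain r (l.reverse : Cycle α) ↔ Cycle.Chain (fun a b => r b a) (l : Cycle α) := by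
  cases l with
  | nil => simp
  | cons a l =>
    rw [List.reverse_cons, ← Cycle.coe_cons_eq_coe_append, Cycle.chain_coe_cons,
      Cycle.chain_coe_cons, ← List.isChain_reverse]
    simp

/-- At a vertex that is not isolated, `siteFace v` is a ciliated face. -/
theorem isCiliatedFace_siteFace [Finite E] (v : V) (hv : Γ.ends v ≠ []) :
    Γ.IsCiliatedFace (Γ.siteFace v) := by
  obtain ⟨d, l, hd⟩ := List.exists_cons_of_ne_nil hv
  have hx : rev d ∈ Function.periodicPts Γ.rightTurn :=
    Γ.rightTurn_injective.mem_periodicPts _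
  have hs : Γ.siteFace v = (Γ.rightPath (rev d)).reverse := by
    simp [siteFace, hd]
  have ho : (Γ.rightPath (rev d) : Cycle (E × Bool)) =
    Function.periodicOrbit Γ.rightTurn (rev d) := rfl
  have hn : Function.periodicOrbit Γ.rightTurn (rev d) ≠ Cycle.nil := fun h =>
    Function.periodicOrbit_eq_nil_iff_not_periodic_pt.1 h hx
  unfold IsCiliatedFace IsFace
  rw [hs]
  refine ⟨?_, ?_, ?_⟩
  · rw [← ho] at hn
    simpa using hn
  · have := Function.nodup_periodicOrbit (f := Γ.rightTurn) (x := rev d)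
    rw [← ho] at this
    simpa using this
  · rw [chain_reverse, ho, Function.periodicOrbit_chain' _ hx]
    exact fun n => Function.iterate_succ_apply' _ _ _

end CiliatedRibbonGraph

/-! ## The thickened graph and holonomies -/

/-- The edges of the thickening of `Γ`: for each edge `e` of `Γ` the edges `r(e)`, `l(e)` parallel
to `e` on its right and left, and the edges `r(ē)`, `l(ē)` transversal to `e` at its target end and
starting end. -/
inductive ThickEdge (E : Type*) where
  | r (e : E)
  | l (e : E)
  | rBar (e : E)
  | lBar (e : E)

/-- A word `x₁^{ε₁} ∘ ⋯ ∘ xₙ^{εₙ}` in the edges of the thickening, given as the list of its letters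
from left to right. Paths in the thickening are described by such words. -/
abbrev ThickWord (E : Type*) := List (ThickEdge E × Bool)

/-- `r(e^ε)`, where `r(e⁻¹) = l(e)⁻¹`. -/
def thickR {E : Type*} (a : E × Bool) : ThickEdge E × Bool :=
  if a.2 then (.r a.1, true) else (.l a.1, false)

/-- `r(ē^ε)`, where `r(ē⁻¹) = l(ē)⁻¹`. -/
def thickRBar {E : Type*} (a : E × Bool) : ThickEdge E × Bool :=
  if a.2 then (.rBar a.1, true) else (.lBar a.1, false)

/-- The vertex loop `p_v = r(ē₁^{ε₁}) ∘ ⋯ ∘ r(ēₙ^{εₙ})`, where `e₁, …, eₙ` are the edges incident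
at `v`, in the order at `v` and such that `eᵢ^{εᵢ}` is incoming. -/
def CiliatedRibbonGraph.vertexLoop {V E : Type*} (Γ : CiliatedRibbonGraph V E) (v : V) :
    ThickWord E :=
  (Γ.ends v).map thickRBar

/-- The face loop `p_f = r(e₁^{ε₁}) ∘ ⋯ ∘ r(eₙ^{εₙ})` of a ciliated face
`f = e₁^{ε₁} ∘ ⋯ ∘ eₙ^{εₙ}`. -/
def faceLoop {E : Type*} (f : List (E × Bool)) : ThickWord E := f.map thickR

section Holonomy

variable (F H E : Type*) [Field F] [Ring H] [HopfAlgebra F H]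

/-- The algebra `D(H)*^{⊗E}`. -/
abbrev DrinfeldDualTensor := ⨂[F] _ : E, DrinfeldDual F H

/-- The algebra `𝓗(H)^{⊗E}`. -/
abbrev HeisenbergTensor := ⨂[F] _ : E, HeisenbergDouble F H

/-- The extended space `H^{⊗E}`. -/
abbrev ExtendedSpace := ⨂[F] _ : E, H

variable {E} [DecidableEq E]

/-- The map `y ⊗ γ ↦ (y ⊗ γ)_e`. -/
def atEdge (e : E) : H ⊗[F] DualHopf F H →ₗ[F] DrinfeldDualTensor F H E :=
  (PiTensorProduct.singleAlgHom (R := F) (A := fun _ : E => DrinfeldDual F H) e).toLinearMap ∘ₗ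
    (toDrinfeldDual F H).toLinearMap

/-- The map `y ⊗ γ ↦ ε(y) 1 ⊗ γ`. -/
def projDual : H ⊗[F] DualHopf F H →ₗ[F] H ⊗[F] DualHopf F H :=
  TensorProduct.map (Algebra.linearMap F H ∘ₗ Coalgebra.counit) LinearMap.id

/-- The map `y ⊗ γ ↦ ε(γ) y ⊗ 1`. -/
def projPrimal : H ⊗[F] DualHopf F H →ₗ[F] H ⊗[F] DualHopf F H :=
  TensorProduct.map LinearMap.id (Algebra.linearMap F (DualHopf F H) ∘ₗ dualCounit F H)

variable [FiniteDimensional F H]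

/-- The holonomies of the edges of the thickening:
`Hol_{r(e)}(y ⊗ γ) = ε(y) (1 ⊗ γ)_e`, `Hol_{r(ē)}(y ⊗ γ) = ε(γ) (y ⊗ 1)_e`,
`Hol_{l(e)} = S_D ∘ Hol_{r(e)} ∘ S_D` and `Hol_{l(ē)} = S_D ∘ Hol_{r(ē)} ∘ S_D`. -/
def holEdge : ThickEdge E → H ⊗[F] DualHopf F H →ₗ[F] DrinfeldDualTensor F H E
  | .r e => atEdge F H e ∘ₗ projDual F H
  | .l e => atEdge F H e ∘ₗ drinfeldAntipode F H ∘ₗ projDual F H ∘ₗ drinfeldAntipode F H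
  | .rBar e => atEdge F H e ∘ₗ projPrimal F H
  | .lBar e => atEdge F H e ∘ₗ drinfeldAntipode F H ∘ₗ projPrimal F H ∘ₗ drinfeldAntipode F H

/-- The holonomy of a signed edge of the thickening, with `Hol_{x⁻¹} = Hol_x ∘ S_D`. -/
def holLetter (x : ThickEdge E × Bool) : H ⊗[F] DualHopf F H →ₗ[F] DrinfeldDualTensor F H E :=
  if x.2 then holEdge F H x.1 else holEdge F H x.1 ∘ₗ drinfeldAntipode F H

/-- The holonomy functor, evaluated on the path given by a word: the convolution product of the
holonomies of the letters, for the comultiplication of `D(H)*` and the multiplication of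
`D(H)*^{⊗E}`. -/
def holDrinfeld (p : ThickWord E) : H ⊗[F] DualHopf F H →ₗ[F] DrinfeldDualTensor F H E :=
  iteratedConv (drinfeldComul F H) (drinfeldCounit F H) (p.map (holLetter F H))

/-- The identity map from `D(H)*^{⊗E}` to `𝓗(H)^{⊗E}`, both of which are the vector space
`(H ⊗ H*)^{⊗E}`. -/
def toHeisenbergTensor : DrinfeldDualTensor F H E →ₗ[F] HeisenbergTensor F H E :=
  PiTensorProduct.map fun _ =>
    (toHeisenberg F H).toLinearMap ∘ₗ (toDrinfeldDual F H).symm.toLinearMap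

/-- The holonomy of a path, `y ⊗ γ ↦ Hol_p(y ⊗ γ)`, with values regarded as elements of
`𝓗(H)^{⊗E}`. -/
def hol (p : ThickWord E) : H ⊗[F] DualHopf F H →ₗ[F] HeisenbergTensor F H E :=
  toHeisenbergTensor F H ∘ₗ holDrinfeld F H p

/-- The linear map `y ↦ Hol_p(y ⊗ 1)`. -/
def holPrimal (p : ThickWord E) : H →ₗ[F] HeisenbergTensor F H E :=
  hol F H p ∘ₗ (TensorProduct.mk F H (DualHopf F H)).flip 1

/-- The linear map `γ ↦ Hol_p(1 ⊗ γ)`. -/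
def holDual (p : ThickWord E) : DualHopf F H →ₗ[F] HeisenbergTensor F H E :=
  hol F H p ∘ₗ TensorProduct.mk F H (DualHopf F H) 1

end Holonomy

/-! ## Triangle, vertex and face operators, the Hamiltonian and the protected space -/

section Triangle

variable (F H : Type*) [Field F] [Ring H] [HopfAlgebra F H]

/-- `L₊^h k = h k`. -/
def Lpos : H →ₗ[F] Module.End F H := LinearMap.mul F H

/-- `L₋^h k = k h`. -/
def Lneg : H →ₗ[F] Module.End F H := (LinearMap.mul F H).flip

/-- `T₊^α k = ⟨α, k₍₂₎⟩ k₍₁₎`. -/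
def Tpos : DualHopf F H →ₗ[F] Module.End F H where
  toFun α := (TensorProduct.rid F H).toLinearMap ∘ₗ LinearMap.lTensor H α.ofConv ∘ₗ Coalgebra.comul
  map_add' α β := by
    rw [WithConv.ofConv_add, LinearMap.lTensor_add, LinearMap.add_comp, LinearMap.comp_add]
  map_smul' c α := by
    rw [WithConv.ofConv_smul, LinearMap.lTensor_smul, LinearMap.smul_comp, LinearMap.comp_smul]
    rfl

/-- `T₋^α k = ⟨α, k₍₁₎⟩ k₍₂₎`. -/
def Tneg : DualHopf F H →ₗ[F] Module.End F H where
  toFun α := (TensorProduct.lid F H).toLinearMap ∘ₗ LinearMap.rTensor H α.ofConv ∘ₗ Coalgebra.comul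
  map_add' α β := by
    rw [WithConv.ofConv_add, LinearMap.rTensor_add, LinearMap.add_comp, LinearMap.comp_add]
  map_smul' c α := by
    rw [WithConv.ofConv_smul, LinearMap.rTensor_smul, LinearMap.smul_comp, LinearMap.comp_smul]
    rfl

/-- The action `φ : 𝓗(H) → End(H)`, `φ(y ⊗ α) h = (L₊^y ∘ T₊^α) h = ⟨α, h₍₂₎⟩ y h₍₁₎`. -/
def heisenbergAction : HeisenbergDouble F H →ₗ[F] Module.End F H :=
  TensorProduct.lift ((LinearMap.mul F (Module.End F H)).compl₁₂ (Lpos F H) (Tpos F H)) ∘ₗ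
    (toHeisenberg F H).symm.toLinearMap

/-- `ρ = φ^{⊗E} : 𝓗(H)^{⊗E} → End(H^{⊗E})`,
`ρ(⊗ₑ Xₑ)(⊗ₑ hₑ) = ⊗ₑ φ(Xₑ) hₑ`. -/
def rho (E : Type*) : HeisenbergTensor F H E →ₗ[F] Module.End F (ExtendedSpace F H E) :=
  PiTensorProduct.piTensorHomMap ∘ₗ PiTensorProduct.map fun _ => heisenbergAction F H

variable {E : Type*} [DecidableEq E]

/-- The operator on `H^{⊗E}` that acts as `T` on the copy of `H` at `e` and trivially on all
other copies. -/
def onEdge (e : E) : Module.End F H →ₗ[F] Module.End F (ExtendedSpace F H E) :=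
  (PiTensorProduct.mapMultilinear F (fun _ : E => H) (fun _ : E => H)).toLinearMap
    (fun _ => LinearMap.id) e

/-- `h ↦ L^{S^τ(h)}_{e ε}` with `τ = (1 - ε)/2`. -/
def vertexTerm (a : E × Bool) : H →ₗ[F] Module.End F (ExtendedSpace F H E) :=
  if a.2 then onEdge F H a.1 ∘ₗ Lpos F H
  else onEdge F H a.1 ∘ₗ Lneg F H ∘ₗ HopfAlgebra.antipode F

/-- `α ↦ T^{S^τ(α)}_{e ε}` with `τ = (1 - ε)/2`. -/
def faceTerm (a : E × Bool) : DualHopf F H →ₗ[F] Module.End F (ExtendedSpace F H E) :=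
  if a.2 then onEdge F H a.1 ∘ₗ Tpos F H
  else onEdge F H a.1 ∘ₗ Tneg F H ∘ₗ dualAntipode F H

/-- The face operator `B_f^α = T^{S^{τ₁}(α₍₁₎)}_{e₁ε₁} ∘ ⋯ ∘ T^{S^{τₙ}(α₍ₙ₎)}_{eₙεₙ}` of a ciliated
face `f = e₁^{ε₁} ∘ ⋯ ∘ eₙ^{εₙ}`. -/
def faceOp [FiniteDimensional F H] (f : List (E × Bool)) :
    DualHopf F H →ₗ[F] Module.End F (ExtendedSpace F H E) :=
  iteratedConv (dualComul F H) (dualCounit F H) (f.map (faceTerm F H))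

end Triangle

namespace CiliatedRibbonGraph

variable {F H V E : Type*} [Field F] [Ring H] [HopfAlgebra F H] [DecidableEq E]
  (Γ : CiliatedRibbonGraph V E)

/-- The vertex operator `A_v^h = L^{S^{τ₁}(h₍₁₎)}_{e₁ε₁} ∘ ⋯ ∘ L^{S^{τₙ}(h₍ₙ₎)}_{eₙεₙ}`, where
`e₁, …, eₙ` are the edges incident at `v` in the order at `v` and `eᵢ^{εᵢ}` is incoming. -/
def vertexOp (v : V) : H →ₗ[F] Module.End F (ExtendedSpace F H E) :=
  iteratedConv Coalgebra.comul Coalgebra.counit ((Γ.ends v).map (vertexTerm F H))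

variable [FiniteDimensional F H]

section Hamiltonian

variable [Fintype V] [Fintype E]

/-- Kitaev's Hamiltonian `H_K = ∏_v A_v^ℓ ∘ ∏_f B_f^η`, with the factors in some order and with
some ciliated face chosen to represent each face. -/
def hamiltonian (ℓ : H) (η : DualHopf F H) : Module.End F (ExtendedSpace F H E) :=
  ((Finset.univ : Finset V).toList.map fun v => Γ.vertexOp (F := F) v ℓ).prod *
    ((Finset.univ : Finset Γ.Face).toList.map fun f => faceOp F H (Quot.out f.1) η).prod

/-- The protected space, the image of the Hamiltonian. -/
def protectedSpace (ℓ : H) (η : DualHopf F H) : Submodule F (ExtendedSpace F H E) :=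
  LinearMap.range (Γ.hamiltonian ℓ η)

end Hamiltonian

/-! ### Gauge transformations and flatness -/

/-- The linear map `c ⊗ c' ↦ (X ↦ f(c) X g(c'))`. -/
def sandwich {C A : Type*} [AddCommGroup C] [Module F C] [Ring A] [Algebra F A]
    (f g : C →ₗ[F] A) : C ⊗[F] C →ₗ[F] Module.End F A :=
  TensorProduct.lift ((LinearMap.mul F (Module.End F A)).compl₁₂
    (LinearMap.mul F A ∘ₗ f) ((LinearMap.mul F A).flip ∘ₗ g))

/-- The action of gauge transformations at the vertex `v`: the operator
`X ↦ X ◁ (δ ⊗ z)_v = Hol_{p_v}(S(z₍₂₎) ⊗ 1) · Hol_{p_{f(v)}}(1 ⊗ S(δ₍₁₎)) · X ·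
  Hol_{p_{f(v)}}(1 ⊗ δ₍₂₎) · Hol_{p_v}(z₍₁₎ ⊗ 1)`. -/
def gaugeAction (v : V) (δ : DualHopf F H) (z : H) : Module.End F (HeisenbergTensor F H E) :=
  sandwich (holPrimal F H (Γ.vertexLoop v) ∘ₗ HopfAlgebra.antipode F)
      (holPrimal F H (Γ.vertexLoop v))
      (TensorProduct.comm F H H (Coalgebra.comul z)) *
    sandwich (holDual F H (faceLoop (Γ.siteFace v)) ∘ₗ dualAntipode F H)
      (holDual F H (faceLoop (Γ.siteFace v)))
      (dualComul F H δ)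

/-- `G_v = Hol_{p_v}(ℓ ⊗ 1) · Hol_{p_{f(v)}}(1 ⊗ η)`. -/
def siteElement (ℓ : H) (η : DualHopf F H) (v : V) : HeisenbergTensor F H E :=
  hol F H (Γ.vertexLoop v) (ℓ ⊗ₜ 1) * hol F H (faceLoop (Γ.siteFace v)) (1 ⊗ₜ η)

/-- `Q_v : X ↦ X · G_v`. -/
def siteProj (ℓ : H) (η : DualHopf F H) (v : V) : Module.End F (HeisenbergTensor F H E) :=
  LinearMap.mulRight F (Γ.siteElement ℓ η v)

variable [Fintype V]

/-- `Q_inv : X ↦ X ◁ (η ⊗ ℓ)^{⊗V}`, the composite over all vertices `v` of the operators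
`X ↦ X ◁ (η ⊗ ℓ)_v`. Its image is the gauge-invariant subalgebra. -/
def invProj (ℓ : H) (η : DualHopf F H) : Module.End F (HeisenbergTensor F H E) :=
  ((Finset.univ : Finset V).toList.map fun v => Γ.gaugeAction v η ℓ).prod

/-- `Q_flat = ∏_v Q_v`. -/
def flatProj (ℓ : H) (η : DualHopf F H) : Module.End F (HeisenbergTensor F H E) :=
  ((Finset.univ : Finset V).toList.map fun v => Γ.siteProj ℓ η v).prod

end CiliatedRibbonGraph
end
end Kitaev

/-!
# The ground state of the Kitaev model and the Heisenberg double

The Heisenberg double `𝓗(H)` acts faithfully on `H` by all endomorphisms (`heisenbergEquiv`), so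
that `ρ` is an algebra homomorphism and elements of `𝓗(H)^{⊗E}` supported at an edge are the same as
operators on the copy of `H` at this edge. A semisimple Hopf algebra in characteristic zero has an
involutive antipode (`antipode_antipode`, the theorem of Larson and Radford; here it only uses that
both Haar integrals exist), and its Haar integrals are cocommutative (`comm_comul_haar`,
`comm_comul_dual_haar`). With `S² = 1`, the holonomies of the edges of the thickening are the
preimages of Kitaev's triangle operators, and as a vertex or face loop of a regular graph meets each
edge at most once, the multiplications of `D(H)*^{⊗E}` and `𝓗(H)^{⊗E}` agree on its letters. Hence
the holonomies of the vertex and face loops define algebra homomorphisms `a_v : H → 𝓗(H)^{⊗E}` and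
`b_v : H* → 𝓗(H)^{⊗E}` with `ρ ∘ a_v = A_v` and `ρ ∘ b_v = B_{f(v)}` (`holPrimal_map_thickRBar`,
`holDual_faceLoop`, `rhoAlgHom_comp_vertex`, `rhoAlgHom_comp_face`).

The main point is the commutation of these operators (`exists_siteHoms`). The relations of the
triangle operators are equations in the convolution algebra `Hom(H, Hom(H*, A)) ≅ H* ⊗ H ⊗ A`, where
they involve the canonical element `J` of `H* ⊗ H`: a face edge passes a vertex edge at the cost of
inserting or removing `J` after its target end or before its starting end. Since a face turns
maximally right, these insertions cancel between consecutive edges, except where it passes the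
cilium (`path_mul_insertBefore`). As each face contains exactly one cilium, operators at different
vertices commute (`siteFace_commute_ends`), and those at the same vertex satisfy `b J a = a J b`
(`siteFace_mul_ends`), which is the commutation relation of the Drinfeld double (`IsDrinfeldPair`).

The rest is algebra. Gauge invariance means to commute with all `a_v(h)` and `b_v(α)`
(`adjointAction_eq_iff`), the averages over the Haar integrals project onto this common commutant
(`range_prod_adjointAction`), and `G_v = a_v(ℓ) b_v(η)` is the image of the Haar integral of the
Drinfeld double, hence a central idempotent of the commutant (`IsDrinfeldPair.haar_mul`). By
cocommutativity of `η`, the face operator `B_f^η` is invariant under cyclic permutations, and the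
faces correspond to the vertices that are not isolated, so that `H_K = ρ(∏_v G_v)`
(`hamiltonian_eq_rhoAlgHom`).
-/


namespace Kitaev

noncomputable section

set_option linter.unusedSectionVars false

open Coalgebra WithConv
open CiliatedRibbonGraph (sandwich)

/-! ### Convolution algebras -/

section Convolution

variable {F C A B : Type*} [Field F] [AddCommGroup C] [Module F C] [Coalgebra F C]
  [Ring A] [Algebra F A] [Ring B] [Algebra F B]

theorem toConv_iteratedConv (l : List (C →ₗ[F] A)) :
    toConv (iteratedConv comul counit l) = (l.map toConv).prod := by
  induction l with
  | nil => rfl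
  | cons f l ih => rw [List.map_cons, List.prod_cons, ← ih]; rfl

variable (F C) in
/-- The constant `a`, i.e. `c ↦ ε(c) a`, as an element of the convolution algebra. -/
def constConv : A →+* WithConv (C →ₗ[F] A) where
  toFun a := toConv ((counit (R := F) (A := C)).smulRight a)
  map_one' := by
    refine WithConv.ext (LinearMap.ext fun c => ?_)
    exact (Algebra.algebraMap_eq_smul_one _).symm
  map_mul' a b := by
    refine WithConv.ext (LinearMap.ext fun c => ?_)
    let r := Repr.arbitrary F c
    rw [r.convMul_apply]
    simp only [LinearMap.smulRight_apply, smul_mul_smul_comm]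
    rw [← Finset.sum_smul]
    congr 1
    have := congrArg (counit (R := F)) (sum_counit_smul r)
    simpa using this.symm
  map_zero' := by ext; simp
  map_add' a b := by ext; simp

theorem constConv_apply (a : A) (c : C) : constConv F C a c = counit (R := F) c • a := rfl

theorem sum_smul_counit {ι : Type*} {c : C} (r : Repr F c ι) :
    ∑ i ∈ r.index, counit (R := F) (r.right i) • r.left i = c := by
  have := congrArg (TensorProduct.rid F C) (sum_tmul_counit_eq r)
  rwa [map_sum, TensorProduct.rid_tmul, one_smul] at this

theorem mul_constConv_apply (f : WithConv (C →ₗ[F] A)) (a : A) (c : C) :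
    (f * constConv F C a) c = f c * a := by
  let r := Repr.arbitrary F c
  rw [r.convMul_apply]
  simp only [constConv_apply, mul_smul_comm, ← smul_mul_assoc, ← Finset.sum_mul, ← map_smul,
    ← map_sum]
  rw [sum_smul_counit]

theorem constConv_mul_apply (f : WithConv (C →ₗ[F] A)) (a : A) (c : C) :
    (constConv F C a * f) c = a * f c := by
  let r := Repr.arbitrary F c
  rw [r.convMul_apply]
  simp only [constConv_apply, smul_mul_assoc, ← mul_smul_comm, ← Finset.mul_sum, ← map_smul,
    ← map_sum]
  rw [sum_counit_smul]

variable (F C) in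
/-- Composition with an algebra homomorphism is a homomorphism of convolution algebras. -/
def mapConv (g : A →ₐ[F] B) : WithConv (C →ₗ[F] A) →+* WithConv (C →ₗ[F] B) where
  toFun f := toConv (g.toLinearMap ∘ₗ f.ofConv)
  map_one' := by ext; simp
  map_mul' f f' := WithConv.ext (LinearMap.algHom_comp_convMul_distrib g f f')
  map_zero' := by ext; simp
  map_add' f f' := by ext; simp

theorem mapConv_apply (g : A →ₐ[F] B) (f : WithConv (C →ₗ[F] A)) (c : C) :
    mapConv F C g f c = g (f c) := rfl

theorem mapConv_constConv (g : A →ₐ[F] B) (a : A) :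
    mapConv F C g (constConv F C a) = constConv F C (g a) := by
  refine WithConv.ext (LinearMap.ext fun c => ?_)
  exact map_smul g _ _

/-- An element which commutes with all values of `f` commutes with `f` in the convolution
algebra. -/
theorem commute_constConv {f : WithConv (C →ₗ[F] A)} {a : A} (h : ∀ c, Commute a (f c)) :
    Commute (constConv F C a) f :=
  WithConv.ext (LinearMap.ext fun c =>
    (constConv_mul_apply f a c).trans ((h c).eq.trans (mul_constConv_apply f a c).symm))

theorem commute_of_commute_constConv {f : WithConv (C →ₗ[F] A)} {a : A}
    (h : Commute (constConv F C a) f) (c : C) : Commute a (f c) := by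
  have := congrArg (fun g : WithConv (C →ₗ[F] A) => g c) h.eq
  rwa [constConv_mul_apply, mul_constConv_apply] at this

end Convolution

section HopfConvolution

variable {F C A : Type*} [Field F] [Ring C] [HopfAlgebra F C] [Ring A] [Algebra F A]

/-- An algebra homomorphism, as an element of the convolution algebra. -/
abbrev homConv (f : C →ₐ[F] A) : WithConv (C →ₗ[F] A) := toConv f.toLinearMap

/-- The convolution inverse `f ∘ S` of an algebra homomorphism `f`. -/
abbrev invConv (f : C →ₐ[F] A) : WithConv (C →ₗ[F] A) :=
  toConv (f.toLinearMap ∘ₗ HopfAlgebra.antipode F)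

theorem homConv_mul_invConv (f : C →ₐ[F] A) : homConv f * invConv f = 1 := by
  have := congrArg (mapConv F C f) (LinearMap.id_mul_antipode (R := F) (C := C))
  rwa [map_mul, map_one] at this

theorem invConv_mul_homConv (f : C →ₐ[F] A) : invConv f * homConv f = 1 := by
  have := congrArg (mapConv F C f) (LinearMap.antipode_mul_id (R := F) (C := C))
  rwa [map_mul, map_one] at this

/-- The convolution product of two algebra homomorphisms whose images commute. -/
def convHom (f g : C →ₐ[F] A) (h : ∀ c d, Commute (f c) (g d)) : C →ₐ[F] A :=
  (Algebra.TensorProduct.lift f g h).comp (Bialgebra.comulAlgHom F C)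

theorem convHom_toLinearMap (f g : C →ₐ[F] A) (h : ∀ c d, Commute (f c) (g d)) :
    homConv (convHom f g h) = homConv f * homConv g := by
  refine WithConv.ext (LinearMap.ext fun c => ?_)
  let r := Repr.arbitrary F c
  rw [r.convMul_apply]
  change Algebra.TensorProduct.lift f g h (comul (R := F) c) = _
  rw [← r.eq, map_sum]
  simp

/-- The antipode reverses the comultiplication. -/
theorem comul_antipode (c : C) :
    comul (R := F) (HopfAlgebra.antipode F c) =
      TensorProduct.map (HopfAlgebra.antipode F) (HopfAlgebra.antipode F)
        (TensorProduct.comm F C C (comul (R := F) c)) := by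
  let i₁ : C →ₐ[F] C ⊗[F] C := Algebra.TensorProduct.includeLeft
  let i₂ : C →ₐ[F] C ⊗[F] C := Algebra.TensorProduct.includeRight
  have hd : homConv (Bialgebra.comulAlgHom F C) = homConv i₁ * homConv i₂ := by
    refine WithConv.ext (LinearMap.ext fun c => ?_)
    let r := Repr.arbitrary F c
    rw [r.convMul_apply]
    change comul (R := F) c = _
    rw [← r.eq]
    simp [i₁, i₂]
  have h1 : (invConv i₂ * invConv i₁) * homConv (Bialgebra.comulAlgHom F C) = 1 := by
    rw [hd, mul_assoc, ← mul_assoc (invConv i₁), invConv_mul_homConv, one_mul,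
      invConv_mul_homConv]
  have h2 := left_inv_eq_right_inv h1 (homConv_mul_invConv (Bialgebra.comulAlgHom F C))
  have h3 := congrArg (fun g : WithConv (C →ₗ[F] C ⊗[F] C) => g c) h2
  let r := Repr.arbitrary F c
  rw [r.convMul_apply] at h3
  change _ = comul (R := F) (HopfAlgebra.antipode F c) at h3
  rw [← h3, ← r.eq]
  simp [i₁, i₂]

end HopfConvolution

/-! ### The dual Hopf algebra -/

section Dual

variable {F H : Type*} [Field F] [Ring H] [HopfAlgebra F H] [FiniteDimensional F H]

variable (F H) in
/-- `H* ⊗ H*` as the dual space of `H ⊗ H`. -/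
def dualPairing : DualHopf F H ⊗[F] DualHopf F H ≃ₗ[F] Module.Dual F (H ⊗[F] H) :=
  TensorProduct.congr (WithConv.linearEquiv F (H →ₗ[F] F)) (WithConv.linearEquiv F (H →ₗ[F] F)) ≪≫ₗ
    TensorProduct.dualDistribEquiv F H H

theorem dualPairing_tmul (α β : DualHopf F H) (h k : H) :
    dualPairing F H (α ⊗ₜ β) (h ⊗ₜ k) = α h * β k := rfl

theorem dualPairing_dualComul (α : DualHopf F H) (h k : H) :
    dualPairing F H (dualComul F H α) (h ⊗ₜ k) = α (h * k) := by
  have : dualPairing F H (dualComul F H α) = α.ofConv ∘ₗ LinearMap.mul' F H := by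
    exact (LinearEquiv.eq_symm_apply _).1 rfl
  rw [this]
  rfl

instance : CoalgebraStruct F (DualHopf F H) where
  comul := dualComul F H
  counit := dualCounit F H

theorem comul_dual (α : DualHopf F H) : comul (R := F) α = dualComul F H α := rfl

theorem counit_dual (α : DualHopf F H) : counit (R := F) α = α 1 := rfl

theorem sum_repr_dual {ι : Type*} {α : DualHopf F H} (r : Repr F α ι) (h k : H) :
    ∑ i ∈ r.index, r.left i h * r.right i k = α (h * k) := by
  have := congrArg (fun x => dualPairing F H x (h ⊗ₜ k)) r.eq
  simp only [map_sum, LinearMap.sum_apply, dualPairing_tmul] at this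
  exact this.trans (dualPairing_dualComul α h k)

theorem dual_coassoc (α : DualHopf F H) :
    TensorProduct.assoc F _ _ _ (comul.rTensor (DualHopf F H) (comul (R := F) α)) =
      comul.lTensor (DualHopf F H) (comul (R := F) α) := by
  let E : DualHopf F H ⊗[F] (DualHopf F H ⊗[F] DualHopf F H) ≃ₗ[F]
      Module.Dual F (H ⊗[F] (H ⊗[F] H)) :=
    TensorProduct.congr (WithConv.linearEquiv F (H →ₗ[F] F)) (dualPairing F H) ≪≫ₗ
    TensorProduct.dualDistribEquiv F H (H ⊗[F] H)
  have hE : ∀ (β : DualHopf F H) (x : DualHopf F H ⊗[F] DualHopf F H) (h k l : H),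
      E (β ⊗ₜ x) (h ⊗ₜ (k ⊗ₜ l)) = β h * dualPairing F H x (k ⊗ₜ l) := fun _ _ _ _ _ => rfl
  have hE' : ∀ (β : DualHopf F H) (x : DualHopf F H ⊗[F] DualHopf F H) (h k l : H),
      E (TensorProduct.assoc F _ _ _ (x ⊗ₜ β)) (h ⊗ₜ (k ⊗ₜ l)) =
        dualPairing F H x (h ⊗ₜ k) * β l := by
    intro β x h k l
    induction x with
    | zero => simp
    | add x y hx hy => simp only [TensorProduct.add_tmul, map_add, LinearMap.add_apply, hx, hy,
        add_mul]
    | tmul γ δ => rw [TensorProduct.assoc_tmul, hE, dualPairing_tmul, dualPairing_tmul, mul_assoc]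
  refine E.injective (TensorProduct.ext (LinearMap.ext fun h => TensorProduct.ext
    (LinearMap.ext fun k => LinearMap.ext fun l => ?_)))
  let r := Repr.arbitrary F α
  change E _ (h ⊗ₜ (k ⊗ₜ l)) = E _ (h ⊗ₜ (k ⊗ₜ l))
  rw [← r.eq]
  simp only [map_sum, LinearMap.sum_apply, LinearMap.rTensor_tmul, LinearMap.lTensor_tmul, hE, hE',
    comul_dual, dualPairing_dualComul]
  rw [sum_repr_dual r h (k * l), sum_repr_dual r (h * k) l, mul_assoc]

instance : Coalgebra F (DualHopf F H) where
  coassoc := LinearMap.ext dual_coassoc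
  rTensor_counit_comp_comul := by
    refine LinearMap.ext fun α => (TensorProduct.lid F _).injective (WithConv.ext
      (LinearMap.ext fun k => ?_))
    let r := Repr.arbitrary F α
    have := sum_repr_dual r 1 k
    simpa [← r.eq, counit_dual] using this
  lTensor_counit_comp_comul := by
    refine LinearMap.ext fun α => (TensorProduct.rid F _).injective (WithConv.ext
      (LinearMap.ext fun k => ?_))
    let r := Repr.arbitrary F α
    have := sum_repr_dual r k 1
    simpa [← r.eq, counit_dual, mul_comm] using this

omit [FiniteDimensional F H] in
theorem dual_ext {α β : DualHopf F H} (h : ∀ k, α k = β k) : α = β :=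
  WithConv.ext (LinearMap.ext h)

theorem dual_comul_mul (α β : DualHopf F H) :
    comul (R := F) (α * β) = comul (R := F) α * comul (R := F) β := by
  refine (dualPairing F H).injective (TensorProduct.ext (LinearMap.ext fun h =>
    LinearMap.ext fun k => ?_))
  change dualPairing F H _ (h ⊗ₜ k) = dualPairing F H _ (h ⊗ₜ k)
  let r := Repr.arbitrary F α
  let q := Repr.arbitrary F β
  let s := Repr.arbitrary F h
  let t := Repr.arbitrary F k
  have hm : (α * β) (h * k) = ∑ i ∈ s.index, ∑ j ∈ t.index,
      α (s.left i * t.left j) * β (s.right i * t.right j) := by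
    rw [LinearMap.convMul_apply, Bialgebra.comul_mul, ← s.eq, ← t.eq]
    simp [Finset.sum_mul_sum]
  have hc : comul (R := F) α * comul (R := F) β = ∑ i ∈ r.index, ∑ j ∈ q.index,
      (r.left i * q.left j) ⊗ₜ[F] (r.right i * q.right j) := by
    rw [← r.eq, ← q.eq]
    exact (Finset.sum_mul_sum r.index q.index
      (fun i => (r.left i ⊗ₜ[F] r.right i : DualHopf F H ⊗[F] DualHopf F H))
      (fun j => q.left j ⊗ₜ[F] q.right j)).trans (Finset.sum_congr rfl fun i _ =>
        Finset.sum_congr rfl fun j _ => Algebra.TensorProduct.tmul_mul_tmul _ _ _ _)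
  rw [comul_dual (α * β), dualPairing_dualComul, hm, hc]
  simp only [map_sum, LinearMap.sum_apply, dualPairing_tmul,
    s.convMul_apply, t.convMul_apply, ← sum_repr_dual r, ← sum_repr_dual q, Finset.sum_mul_sum]
  -- both sides are fourfold sums, in different orders of summation
  simp only [← Finset.sum_product']
  refine Finset.sum_bij' (fun x _ => (x.2.2.1, x.2.2.2, x.1, x.2.1))
    (fun x _ => (x.2.2.1, x.2.2.2, x.1, x.2.1)) ?_ ?_ ?_ ?_ ?_ <;>
  simp +contextual [mul_mul_mul_comm]

instance : Bialgebra F (DualHopf F H) where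
  counit_one := by
    change counit (R := F) (1 : H) = 1
    exact Bialgebra.counit_one
  mul_compr₂_counit := by
    ext α β
    change (α * β) 1 = α 1 * β 1
    rw [LinearMap.convMul_apply, Bialgebra.comul_one, Algebra.TensorProduct.one_def]
    simp
  comul_one := by
    refine (dualPairing F H).injective (TensorProduct.ext (LinearMap.ext fun h =>
      LinearMap.ext fun k => ?_))
    change dualPairing F H (dualComul F H 1) (h ⊗ₜ k) = dualPairing F H (1 ⊗ₜ 1) (h ⊗ₜ k)
    rw [dualPairing_dualComul, dualPairing_tmul]
    exact Bialgebra.counit_mul h k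
  mul_compr₂_comul := by
    ext α β : 2
    exact dual_comul_mul α β

instance : HopfAlgebra F (DualHopf F H) where
  antipode := dualAntipode F H
  mul_antipode_rTensor_comul := by
    refine LinearMap.ext fun α => dual_ext fun k => ?_
    let r := Repr.arbitrary F α
    let s := Repr.arbitrary F k
    have h1 : ∀ i, (dualAntipode F H (r.left i) * r.right i) k =
        ∑ j ∈ s.index, r.left i (HopfAlgebra.antipode F (s.left j)) * r.right i (s.right j) :=
      fun i => s.convMul_apply _ _
    have h2 : LinearMap.mul' F (DualHopf F H) ((dualAntipode F H).rTensor _ (comul (R := F) α)) =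
        ∑ i ∈ r.index, dualAntipode F H (r.left i) * r.right i := by
      rw [← r.eq, map_sum, map_sum]; rfl
    change (LinearMap.mul' F (DualHopf F H)
      ((dualAntipode F H).rTensor _ (comul (R := F) α))) k = α 1 • counit (R := F) k
    rw [h2]
    simp only [ofConv_sum, LinearMap.sum_apply, h1]
    rw [Finset.sum_comm]
    simp only [sum_repr_dual r]
    rw [← map_sum, HopfAlgebra.sum_antipode_mul_eq_smul, map_smul, smul_eq_mul, smul_eq_mul,
      mul_comm]
  mul_antipode_lTensor_comul := by
    refine LinearMap.ext fun α => dual_ext fun k => ?_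
    let r := Repr.arbitrary F α
    let s := Repr.arbitrary F k
    have h1 : ∀ i, (r.left i * dualAntipode F H (r.right i)) k =
        ∑ j ∈ s.index, r.left i (s.left j) * r.right i (HopfAlgebra.antipode F (s.right j)) :=
      fun i => s.convMul_apply _ _
    have h2 : LinearMap.mul' F (DualHopf F H) ((dualAntipode F H).lTensor _ (comul (R := F) α)) =
        ∑ i ∈ r.index, r.left i * dualAntipode F H (r.right i) := by
      rw [← r.eq, map_sum, map_sum]; rfl
    change (LinearMap.mul' F (DualHopf F H)
      ((dualAntipode F H).lTensor _ (comul (R := F) α))) k = α 1 • counit (R := F) k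
    rw [h2]
    simp only [ofConv_sum, LinearMap.sum_apply, h1]
    rw [Finset.sum_comm]
    simp only [sum_repr_dual r]
    rw [← map_sum, HopfAlgebra.sum_mul_antipode_eq_smul, map_smul, smul_eq_mul, smul_eq_mul,
      mul_comm]

theorem antipode_dual (α : DualHopf F H) (k : H) :
    HopfAlgebra.antipode F α k = α (HopfAlgebra.antipode F k) := rfl

end Dual

/-! ### Haar integrals -/

section Casimir

variable {F C : Type*} [Field F] [Ring C] [HopfAlgebra F C] {ℓ : C}

theorem homConv_comul : homConv (Bialgebra.comulAlgHom F C) =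
    homConv (Algebra.TensorProduct.includeLeft : C →ₐ[F] C ⊗[F] C) *
      homConv (Algebra.TensorProduct.includeRight : C →ₐ[F] C ⊗[F] C) := by
  refine WithConv.ext (LinearMap.ext fun c => ?_)
  let r := Repr.arbitrary F c
  rw [r.convMul_apply]
  change comul (R := F) c = _
  rw [← r.eq]
  simp

theorem antipode_tmul_one_mul_comul (hℓ : IsHaarIntegral (F := F) counit ℓ) (h : C) :
    (HopfAlgebra.antipode F h ⊗ₜ[F] 1) * comul (R := F) ℓ = (1 ⊗ₜ[F] h) * comul (R := F) ℓ := by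
  have h1 : homConv (Bialgebra.comulAlgHom F C) * constConv F C (comul (R := F) ℓ) =
      constConv F C (comul (R := F) ℓ) := by
    refine WithConv.ext (LinearMap.ext fun c => (mul_constConv_apply _ _ c).trans ?_)
    change comul (R := F) c * comul (R := F) ℓ = counit (R := F) c • comul (R := F) ℓ
    rw [← Bialgebra.comul_mul, (hℓ.1 c).1, map_smul]
  rw [homConv_comul] at h1
  have h2 := congrArg
    (invConv (Algebra.TensorProduct.includeLeft : C →ₐ[F] C ⊗[F] C) * ·) h1
  simp only [← mul_assoc, invConv_mul_homConv, one_mul] at h2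
  have h3 := congrArg (fun g : WithConv (C →ₗ[F] C ⊗[F] C) => g h) h2
  rw [mul_constConv_apply, mul_constConv_apply] at h3
  exact h3.symm

theorem comul_mul_one_tmul_antipode (hℓ : IsHaarIntegral (F := F) counit ℓ) (h : C) :
    comul (R := F) ℓ * (1 ⊗ₜ[F] HopfAlgebra.antipode F h) = comul (R := F) ℓ * (h ⊗ₜ[F] 1) := by
  have h1 : constConv F C (comul (R := F) ℓ) * homConv (Bialgebra.comulAlgHom F C) =
      constConv F C (comul (R := F) ℓ) := by
    refine WithConv.ext (LinearMap.ext fun c => (constConv_mul_apply _ _ c).trans ?_)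
    change comul (R := F) ℓ * comul (R := F) c = counit (R := F) c • comul (R := F) ℓ
    rw [← Bialgebra.comul_mul, (hℓ.1 c).2, map_smul]
  rw [homConv_comul] at h1
  have h2 := congrArg
    (· * invConv (Algebra.TensorProduct.includeRight : C →ₐ[F] C ⊗[F] C)) h1
  simp only [mul_assoc, homConv_mul_invConv, mul_one] at h2
  have h3 := congrArg (fun g : WithConv (C →ₗ[F] C ⊗[F] C) => g h) h2
  rw [constConv_mul_apply, constConv_mul_apply] at h3
  exact h3.symm

end Casimir

/-! ### The square of the antipode -/

section Involutive

variable {F H : Type*} [Field F] [Ring H] [HopfAlgebra F H] [FiniteDimensional F H]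
  {ℓ : H} {η : DualHopf F H}

local notation "S" => HopfAlgebra.antipode F (A := H)

omit [FiniteDimensional F H] in
theorem eq_of_forall_dual {x y : H} (h : ∀ α : DualHopf F H, α x = α y) : x = y := by
  rw [← sub_eq_zero, ← Module.forall_dual_apply_eq_zero_iff F]
  intro f
  rw [map_sub, sub_eq_zero]
  exact h (toConv f)

theorem sum_basis_tmul_rTensor {ι : Type*} [Fintype ι] (B : Module.Basis ι F H) (x : H ⊗[F] H) :
    ∑ i, B i ⊗ₜ[F] TensorProduct.lid F H ((B.coord i).rTensor H x) = x := by
  induction x with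
  | zero => simp
  | add x y hx hy => simp only [map_add, TensorProduct.tmul_add, Finset.sum_add_distrib, hx, hy]
  | tmul x y =>
    simp only [LinearMap.rTensor_tmul, TensorProduct.lid_tmul, ← TensorProduct.smul_tmul,
      ← TensorProduct.sum_tmul]
    congr 1
    exact B.sum_repr x

theorem haar_sum_right (hη : IsHaarIntegral (dualCounit F H) η) {ι : Type*} {h : H}
    (r : Repr F h ι) : ∑ i ∈ r.index, η (r.right i) • r.left i = η h • (1 : H) := by
  refine eq_of_forall_dual (F := F) fun α => ?_
  have := congrArg (fun β : DualHopf F H => β h) (hη.1 α).1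
  rw [r.convMul_apply, show dualCounit F H α = α 1 from rfl] at this
  simpa [mul_comm] using this

theorem haar_sum_left (hη : IsHaarIntegral (dualCounit F H) η) {ι : Type*} {h : H}
    (r : Repr F h ι) : ∑ i ∈ r.index, η (r.left i) • r.right i = η h • (1 : H) := by
  refine eq_of_forall_dual (F := F) fun α => ?_
  have := congrArg (fun β : DualHopf F H => β h) (hη.1 α).2
  rw [r.convMul_apply, show dualCounit F H α = α 1 from rfl] at this
  simpa [mul_comm] using this

/-- `b₍₁₎ η(a b₍₂₎) = S(a₍₁₎) η(a₍₂₎ b)`. -/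
theorem haar_strong_invariance (hη : IsHaarIntegral (dualCounit F H) η) {ι κ : Type*} {a b : H}
    (q : Repr F a ι) (r : Repr F b κ) :
    ∑ j ∈ r.index, η (a * r.right j) • r.left j =
      ∑ i ∈ q.index, η (q.right i * b) • S (q.left i) := by
  let P : WithConv (H →ₗ[F] H) :=
    toConv (∑ j ∈ r.index, (η.ofConv ∘ₗ LinearMap.mulRight F (r.right j)).smulRight (r.left j))
  let D : WithConv (H →ₗ[F] H) := toConv ((η.ofConv ∘ₗ LinearMap.mulRight F b).smulRight 1)
  have h1 : toConv LinearMap.id * P = D := by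
    refine WithConv.ext (LinearMap.ext fun x => ?_)
    let s := Repr.arbitrary F x
    rw [s.convMul_apply]
    have := haar_sum_right hη (s.mul r)
    rw [Coalgebra.Repr.mul_index, Finset.sum_product] at this
    simpa [P, D, Finset.mul_sum] using this
  have h2 : P = toConv S * D := by
    rw [← h1, ← mul_assoc, LinearMap.antipode_mul_id, one_mul]
  have h3 := congrArg (fun g : WithConv (H →ₗ[F] H) => g a) h2
  rw [q.convMul_apply] at h3
  simpa [P, D] using h3

/-- The Haar integral of `H*` is a nondegenerate form on `H`. -/
theorem haar_nondegenerate (hη : IsHaarIntegral (dualCounit F H) η) {b : H}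
    (hb : ∀ a, η (a * b) = 0) : b = 0 := by
  -- the radical is a left ideal and a left coideal, and does not contain `1`
  have hco : ∀ b : H, (∀ a, η (a * b) = 0) → ∃ r : Repr F b (Fin (Module.finrank F H)),
      (∀ i a, η (a * r.right i) = 0) := by
    intro b hb
    let B := Module.finBasis F H
    let z := fun i => TensorProduct.lid F H ((B.coord i).rTensor H (comul (R := F) b))
    have hz := sum_basis_tmul_rTensor B
    refine ⟨⟨Finset.univ, B, z, hz _⟩, fun i a => ?_⟩
    let r : Repr F b _ := ⟨Finset.univ, B, z, hz _⟩
    have := haar_strong_invariance hη (Repr.arbitrary F a) r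
    simp only [hb, zero_smul, Finset.sum_const_zero] at this
    exact Fintype.linearIndependent_iff.1 B.linearIndependent _ this i
  have hε : ∀ b : H, (∀ a, η (a * b) = 0) → counit (R := F) b = 0 := by
    intro b hb
    obtain ⟨r, hr⟩ := hco b hb
    have h1 := congrArg η (HopfAlgebra.sum_antipode_mul_eq_smul r)
    rw [map_sum, map_smul] at h1
    simp only [hr, Finset.sum_const_zero] at h1
    have h2 : η (1 : H) = 1 := hη.2
    rw [h2] at h1
    simpa using h1.symm
  obtain ⟨r, hr⟩ := hco b hb
  rw [← sum_smul_counit r]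
  exact Finset.sum_eq_zero fun i _ => by rw [hε _ (hr i), zero_smul]

/-- The isomorphism `b ↦ η(- b)`. -/
def haarEquiv (hη : IsHaarIntegral (dualCounit F H) η) : H ≃ₗ[F] (H →ₗ[F] F) :=
  LinearEquiv.ofInjectiveOfFinrankEq ((LinearMap.mul F H).flip.compr₂ η.ofConv)
    ((injective_iff_map_eq_zero _).2 fun _ hb => haar_nondegenerate hη fun a =>
      congrArg (fun f : H →ₗ[F] F => f a) hb) (Subspace.dual_finrank_eq (K := F) (V := H)).symm

theorem haarEquiv_apply (hη : IsHaarIntegral (dualCounit F H) η) (a b : H) :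
    haarEquiv hη b a = η (a * b) := rfl

theorem haar_pairing_ne_zero (hℓ : IsHaarIntegral (F := F) counit ℓ)
    (hη : IsHaarIntegral (dualCounit F H) η) : η ℓ ≠ 0 := by
  intro h0
  obtain ⟨b, hb⟩ := (haarEquiv hη).surjective (counit (R := F) (A := H))
  have h1 := haarEquiv_apply hη ℓ b
  rw [hb, hℓ.2, (hℓ.1 b).2, map_smul, h0, smul_zero] at h1
  exact one_ne_zero h1

/-- `η(S(h) ℓ₍₁₎) ℓ₍₂₎ = η(ℓ) h`. -/
theorem haar_fourier_left (hℓ : IsHaarIntegral (F := F) counit ℓ)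
    (hη : IsHaarIntegral (dualCounit F H) η) {ι : Type*} (r : Repr F ℓ ι) (h : H) :
    ∑ i ∈ r.index, η (S h * r.left i) • r.right i = η ℓ • h := by
  have h1 := congrArg ((TensorProduct.lid F H).toLinearMap ∘ₗ η.ofConv.rTensor H)
    (antipode_tmul_one_mul_comul hℓ h)
  rw [← r.eq] at h1
  simp only [Finset.mul_sum, Algebra.TensorProduct.tmul_mul_tmul, map_sum, one_mul,
    LinearMap.comp_apply, LinearMap.rTensor_tmul, LinearEquiv.coe_coe, TensorProduct.lid_tmul,
    ← mul_smul_comm] at h1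
  rw [h1, ← Finset.mul_sum, haar_sum_left hη, mul_smul_comm, mul_one]

/-- `ℓ₍₁₎ η(ℓ₍₂₎ S(h)) = η(ℓ) h`. -/
theorem haar_fourier_right (hℓ : IsHaarIntegral (F := F) counit ℓ)
    (hη : IsHaarIntegral (dualCounit F H) η) {ι : Type*} (r : Repr F ℓ ι) (h : H) :
    ∑ i ∈ r.index, η (r.right i * S h) • r.left i = η ℓ • h := by
  have h1 := congrArg ((TensorProduct.rid F H).toLinearMap ∘ₗ η.ofConv.lTensor H)
    (comul_mul_one_tmul_antipode hℓ h)
  rw [← r.eq] at h1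
  simp only [Finset.sum_mul, Algebra.TensorProduct.tmul_mul_tmul, map_sum, mul_one,
    LinearMap.comp_apply, LinearMap.lTensor_tmul, LinearEquiv.coe_coe, TensorProduct.rid_tmul,
    ← smul_mul_assoc] at h1
  rw [h1, ← Finset.sum_mul, haar_sum_right hη, smul_mul_assoc, one_mul]

/-- Both sides, multiplied by `η(ℓ)`, are the value of `η ⊗ η` on `S(b) ℓ₍₁₎ ⊗ ℓ₍₂₎ S(a)`. -/
theorem haar_mul_antipode (hℓ : IsHaarIntegral (F := F) counit ℓ)
    (hη : IsHaarIntegral (dualCounit F H) η) (a b : H) : η (b * S a) = η (S b * a) := by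
  let r := Repr.arbitrary F ℓ
  have hc := haar_pairing_ne_zero hℓ hη
  have h1 := congrArg (fun x => η (x * S a)) (haar_fourier_left hℓ hη r b)
  have h2 := congrArg (fun x => η (S b * x)) (haar_fourier_right hℓ hη r a)
  simp only [Finset.sum_mul, Finset.mul_sum, map_sum, smul_mul_assoc, mul_smul_comm, map_smul,
    smul_eq_mul] at h1 h2
  refine mul_left_cancel₀ hc (h1.symm.trans (Eq.trans ?_ h2))
  exact Finset.sum_congr rfl fun i _ => mul_comm _ _

theorem haar_antipode (hℓ : IsHaarIntegral (F := F) counit ℓ)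
    (hη : IsHaarIntegral (dualCounit F H) η) (a : H) : η (S a) = η a := by
  simpa using haar_mul_antipode hℓ hη a 1

theorem haar_mul_antipode_sq (hℓ : IsHaarIntegral (F := F) counit ℓ)
    (hη : IsHaarIntegral (dualCounit F H) η) (a b : H) : η (b * S (S a)) = η (a * b) := by
  rw [haar_mul_antipode hℓ hη, ← HopfAlgebra.antipode_mul_antidistrib, haar_antipode hℓ hη]

theorem haar_antipode_sq_mul (hℓ : IsHaarIntegral (F := F) counit ℓ)
    (hη : IsHaarIntegral (dualCounit F H) η) (a b : H) : η (S (S a) * b) = η (b * a) := by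
  rw [← haar_mul_antipode hℓ hη, ← HopfAlgebra.antipode_mul_antidistrib, haar_antipode hℓ hη]

/-- Since both integrals are two-sided, the fourth power of the antipode is the identity. -/
theorem antipode_four (hℓ : IsHaarIntegral (F := F) counit ℓ)
    (hη : IsHaarIntegral (dualCounit F H) η) (a : H) : S (S (S (S a))) = a := by
  have h1 : ∀ b, η (b * (S (S (S (S a))) - a)) = 0 := fun b => by
    rw [mul_sub, map_sub, haar_mul_antipode_sq hℓ hη, haar_antipode_sq_mul hℓ hη, sub_self]
  exact sub_eq_zero.1 (haar_nondegenerate hη h1)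

/-- Radford's trace formula. -/
theorem trace_eq_haar (hℓ : IsHaarIntegral (F := F) counit ℓ)
    (hη : IsHaarIntegral (dualCounit F H) η) {ι : Type*} (r : Repr F ℓ ι) (T : H →ₗ[F] H) :
    η ℓ * LinearMap.trace F H T = ∑ i ∈ r.index, η (S (T (r.right i)) * r.left i) := by
  have h1 : η ℓ • T = ∑ i ∈ r.index,
      (η.ofConv ∘ₗ LinearMap.mulRight F (r.left i) ∘ₗ S).smulRight (T (r.right i)) := by
    refine LinearMap.ext fun a => ?_
    have := congrArg T (haar_fourier_left hℓ hη r a)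
    simpa using this.symm
  rw [← smul_eq_mul, ← map_smul, h1, map_sum]
  simp [LinearMap.trace_smulRight]

theorem Tpos_repr {ι : Type*} {h : H} (r : Repr F h ι) (α : DualHopf F H) :
    Tpos F H α h = ∑ i ∈ r.index, α (r.right i) • r.left i := by
  change TensorProduct.rid F H (LinearMap.lTensor H α.ofConv (comul (R := F) h)) = _
  rw [← r.eq]
  simp

theorem Tpos_mul (α β : DualHopf F H) : Tpos F H (α * β) = Tpos F H α * Tpos F H β := by
  refine LinearMap.ext fun h => ?_
  let r := Repr.arbitrary F h
  let a₁ := fun j => Repr.arbitrary F (r.left j)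
  let a₂ := fun j => Repr.arbitrary F (r.right j)
  have key := congrArg ((TensorProduct.rid F H).toLinearMap ∘ₗ LinearMap.lTensor H
    (LinearMap.mul' F F ∘ₗ TensorProduct.map α.ofConv β.ofConv))
    (Coalgebra.sum_tmul_tmul_eq r a₁ a₂)
  simp only [map_sum, LinearMap.comp_apply, LinearMap.lTensor_tmul, TensorProduct.map_tmul,
    LinearMap.mul'_apply, LinearEquiv.coe_coe, TensorProduct.rid_tmul] at key
  rw [Module.End.mul_apply, Tpos_repr r, Tpos_repr r, map_sum]
  simp only [(a₂ _).convMul_apply, Finset.sum_smul, map_smul, Tpos_repr (a₁ _), Finset.smul_sum,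
    smul_smul]
  rw [← key]
  simp only [mul_comm]

variable (F H) in
/-- The character of the left regular representation. -/
def regularCharacter : DualHopf F H := toConv (LinearMap.trace F H ∘ₗ LinearMap.mul F H)

theorem regularCharacter_apply (h : H) :
    regularCharacter F H h = LinearMap.trace F H (LinearMap.mulLeft F h) := rfl

variable (F H) in
/-- The map `x ⊗ y ↦ x₍₁₎ ⊗ x₍₂₎ y`. -/
def galoisMap : (H ⊗[F] H) →ₗ[F] (H ⊗[F] H) :=
  TensorProduct.lift ((LinearMap.mul F (H ⊗[F] H)).compl₁₂
      (comul (R := F) (A := H)) (TensorProduct.mk F H H 1))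

theorem galoisMap_tmul (x y : H) :
    galoisMap F H (x ⊗ₜ y) = comul (R := F) x * (1 ⊗ₜ[F] y) := rfl

theorem galoisMap_surjective : Function.Surjective (galoisMap F H) := by
  rw [← LinearMap.range_eq_top, eq_top_iff]
  intro z _
  induction z with
  | zero => exact zero_mem _
  | add x y hx hy => exact add_mem (hx trivial) (hy trivial)
  | tmul x y =>
    let r := Repr.arbitrary F x
    have h1 : homConv (Bialgebra.comulAlgHom F H) *
        invConv (Algebra.TensorProduct.includeRight : H →ₐ[F] H ⊗[F] H) =
        homConv (Algebra.TensorProduct.includeLeft : H →ₐ[F] H ⊗[F] H) := by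
      rw [homConv_comul, mul_assoc, homConv_mul_invConv, mul_one]
    have h2 := congrArg (fun g : WithConv (H →ₗ[F] H ⊗[F] H) => g x * (1 ⊗ₜ[F] y)) h1
    refine ⟨∑ i ∈ r.index, r.left i ⊗ₜ (S (r.right i) * y), ?_⟩
    simp only [r.convMul_apply, Finset.sum_mul, mul_assoc] at h2
    simp only [map_sum, galoisMap_tmul]
    convert! h2 using 2
    · change _ = comul (R := F) _ * ((1 ⊗ₜ[F] S _) * _)
      rw [Algebra.TensorProduct.tmul_mul_tmul, one_mul]
    · change _ = (x ⊗ₜ[F] 1) * _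
      rw [Algebra.TensorProduct.tmul_mul_tmul, one_mul, mul_one]

variable (F H) in
/-- The isomorphism `x ⊗ y ↦ x₍₁₎ ⊗ x₍₂₎ y`. It intertwines the action of `H` on the first factor
with the diagonal action. -/
def galoisEquiv : (H ⊗[F] H) ≃ₗ[F] (H ⊗[F] H) :=
  LinearEquiv.ofBijective (galoisMap F H)
    ⟨LinearMap.injective_iff_surjective.2 galoisMap_surjective, galoisMap_surjective⟩

/-- The tensor square of the regular representation is a multiple of the regular
representation. -/
theorem regularCharacter_mul_self :
    regularCharacter F H * regularCharacter F H =
      (Module.finrank F H : F) • regularCharacter F H := by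
  refine dual_ext fun h => ?_
  let r := Repr.arbitrary F h
  have h1 : ∑ i ∈ r.index, TensorProduct.map (LinearMap.mulLeft F (r.left i))
      (LinearMap.mulLeft F (r.right i)) = (galoisEquiv F H).conj
        (TensorProduct.map (LinearMap.mulLeft F h) LinearMap.id) := by
    refine LinearMap.ext fun z => ?_
    obtain ⟨w, rfl⟩ := (galoisEquiv F H).surjective z
    rw [LinearEquiv.conj_apply_apply, LinearEquiv.symm_apply_apply]
    have h2 : ∀ z : H ⊗[F] H, (∑ i ∈ r.index, TensorProduct.map (LinearMap.mulLeft F (r.left i))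
        (LinearMap.mulLeft F (r.right i))) z = comul (R := F) h * z := by
      intro z
      rw [← r.eq, Finset.sum_mul, LinearMap.sum_apply]
      refine Finset.sum_congr rfl fun i _ => ?_
      induction z with
      | zero => simp
      | add x y hx hy => rw [map_add, hx, hy, mul_add]
      | tmul x y => simp
    rw [h2]
    change comul (R := F) h * galoisMap F H w = galoisMap F H _
    induction w with
    | zero => simp
    | add x y hx hy => rw [map_add, mul_add, hx, hy, map_add, map_add]
    | tmul x y =>
      rw [galoisMap_tmul, TensorProduct.map_tmul, galoisMap_tmul, LinearMap.mulLeft_apply,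
        Bialgebra.comul_mul, mul_assoc, LinearMap.id_apply]
  have h3 := congrArg (LinearMap.trace F (H ⊗[F] H)) h1
  rw [LinearMap.trace_conj', LinearMap.trace_tensorProduct', LinearMap.trace_id, map_sum] at h3
  rw [r.convMul_apply]
  simp only [LinearMap.trace_tensorProduct'] at h3
  simp only [regularCharacter_apply, ofConv_smul, LinearMap.smul_apply, smul_eq_mul]
  rw [h3, mul_comm]

theorem regularCharacter_haar (hℓ : IsHaarIntegral (F := F) counit ℓ) :
    regularCharacter F H ℓ = 1 := by
  have : LinearMap.mulLeft F ℓ = (counit (R := F) (A := H)).smulRight ℓ :=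
    LinearMap.ext fun h => (hℓ.1 h).2
  rw [regularCharacter_apply, this, LinearMap.trace_smulRight, hℓ.2]

theorem trace_of_isIdempotentElem {e : Module.End F H} (he : IsIdempotentElem e) :
    LinearMap.trace F H e = (Module.finrank F (LinearMap.range e) : F) :=
  (LinearMap.IsIdempotentElem.isProj_range e he).trace

/-- The theorem of Larson and Radford: `S² = 1`. The eigenvalues of `S²` are `±1`, since `S⁴ = 1`.
The projection `e = n⁻¹ T₊^χ` for the regular character `χ` commutes with `S²`, and the trace
formula shows that `S²` and `n e S²` have the same non-zero trace. As the trace of `e S²` is an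
integer, this leaves only `S² = ±1`. -/
theorem antipode_antipode [CharZero F] (hℓ : IsHaarIntegral (F := F) counit ℓ)
    (hη : IsHaarIntegral (dualCounit F H) η) (a : H) : S (S a) = a := by
  have hc := haar_pairing_ne_zero hℓ hη
  set n := Module.finrank F H with hn
  let U : Module.End F H := S ∘ₗ S
  have hU : U * U = 1 := LinearMap.ext fun a => antipode_four hℓ hη a
  let P : Module.End F H := Tpos F H (regularCharacter F H)
  have hPP : P * P = (n : F) • P := by
    rw [← Tpos_mul, regularCharacter_mul_self, map_smul]
  have hnt : Nontrivial H := by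
    refine ⟨⟨1, 0, fun h => ?_⟩⟩
    have := congrArg (counit (R := F)) h
    simp at this
  have hn0 : (n : F) ≠ 0 := Nat.cast_ne_zero.2 (Module.finrank_pos).ne'
  have hχ : ∀ h, regularCharacter F H (U h) = regularCharacter F H h := by
    intro h
    have h1 : LinearMap.mulLeft F (U h) = U * LinearMap.mulLeft F h * U := by
      refine LinearMap.ext fun x => ?_
      change S (S h) * x = S (S (h * S (S x)))
      rw [HopfAlgebra.antipode_mul_antidistrib, HopfAlgebra.antipode_mul_antidistrib,
        antipode_four hℓ hη]
    rw [regularCharacter_apply, h1, LinearMap.trace_mul_comm, ← mul_assoc, hU, one_mul]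
    rfl
  have hUP : U * P = P * U := by
    refine LinearMap.ext fun h => ?_
    let r := Repr.arbitrary F h
    have h1 : ∑ i ∈ r.index, U (r.left i) ⊗ₜ[F] U (r.right i) = comul (R := F) (U h) := by
      change _ = comul (R := F) (S (S h))
      rw [comul_antipode, comul_antipode, ← r.eq]
      simp [U]
    let q : Repr F (U h) (H × H) := ⟨r.index, fun i => U (r.left i), fun i => U (r.right i), h1⟩
    change U (Tpos F H _ h) = Tpos F H _ (U h)
    rw [Tpos_repr r, Tpos_repr q, map_sum]
    exact Finset.sum_congr rfl fun i _ => by rw [map_smul, hχ]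
  have htU : η ℓ * LinearMap.trace F H U = 1 := by
    let r := Repr.arbitrary F ℓ
    rw [trace_eq_haar hℓ hη r]
    have h1 : ∀ i, S (U (r.right i)) * r.left i = S (S (S (S (r.left i) * r.right i))) := by
      intro i
      rw [HopfAlgebra.antipode_mul_antidistrib, HopfAlgebra.antipode_mul_antidistrib,
        HopfAlgebra.antipode_mul_antidistrib, antipode_four hℓ hη]
      rfl
    simp only [h1, ← map_sum]
    rw [HopfAlgebra.sum_antipode_mul_eq_smul, hℓ.2, one_smul]
    simp only [HopfAlgebra.antipode_one]
    exact hη.2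
  have htPU : η ℓ * LinearMap.trace F H (P * U) = 1 := by
    let r := Repr.arbitrary F ℓ
    let a₁ := fun j => Repr.arbitrary F (r.left j)
    let a₂ := fun j => Repr.arbitrary F (r.right j)
    let f : H ⊗[F] H →ₗ[F] F := η.ofConv ∘ₗ LinearMap.mul' F H ∘ₗ
      (TensorProduct.comm F H H).toLinearMap ∘ₗ TensorProduct.map LinearMap.id (S ∘ₗ U)
    have hf : ∀ x y, f (x ⊗ₜ y) = η (S (U y) * x) := fun _ _ => rfl
    have key := congrArg (LinearMap.mul' F F ∘ₗ
      TensorProduct.map f (regularCharacter F H).ofConv ∘ₗ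
        (TensorProduct.assoc F H H H).symm.toLinearMap) (Coalgebra.sum_tmul_tmul_eq r a₁ a₂)
    simp only [map_sum, LinearMap.comp_apply, LinearEquiv.coe_coe, TensorProduct.assoc_symm_tmul,
      TensorProduct.map_tmul, LinearMap.mul'_apply, hf] at key
    have h1 : ∀ x y, S (U y) * x = S (S (S (S x * y))) := by
      intro x y
      rw [HopfAlgebra.antipode_mul_antidistrib, HopfAlgebra.antipode_mul_antidistrib,
        HopfAlgebra.antipode_mul_antidistrib, antipode_four hℓ hη]
      rfl
    have h2 : ∀ i, ∑ j ∈ (a₁ i).index, η (S (U ((a₁ i).right j)) * (a₁ i).left j) =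
        counit (R := F) (r.left i) := by
      intro i
      simp only [h1, ← map_sum]
      rw [HopfAlgebra.sum_antipode_mul_eq_smul]
      simp only [map_smul, HopfAlgebra.antipode_one, smul_eq_mul]
      rw [show η (1 : H) = 1 from hη.2, mul_one]
    simp only [← Finset.sum_mul, h2] at key
    rw [← hUP, trace_eq_haar hℓ hη r, ← regularCharacter_haar hℓ]
    have h4 := congrArg (regularCharacter F H) (sum_counit_smul r)
    rw [map_sum] at h4
    simp only [map_smul, smul_eq_mul] at h4
    rw [← h4, key]
    refine Finset.sum_congr rfl fun i _ => ?_
    have h3 : (U * P) (r.right i) =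
        ∑ j ∈ (a₂ i).index, regularCharacter F H ((a₂ i).right j) • U ((a₂ i).left j) := by
      change U (Tpos F H _ _) = _
      rw [Tpos_repr (a₂ i), map_sum]
      simp only [map_smul]
    rw [h3]
    simp only [map_sum, map_smul, Finset.sum_mul, smul_mul_assoc, smul_eq_mul, mul_comm]
  -- `e` is idempotent and commutes with the involution `U`
  set e : Module.End F H := (n : F)⁻¹ • P with he
  have hee : IsIdempotentElem e := by
    change e * e = e
    rw [he, smul_mul_smul_comm, hPP, smul_smul, mul_assoc, inv_mul_cancel₀ hn0, mul_one]
  have hUe : U * e = e * U := by rw [he, mul_smul_comm, smul_mul_assoc, hUP]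
  have h2 : (2 : F) ≠ 0 := two_ne_zero
  have hid : ∀ σ : F, σ * σ = 1 →
      IsIdempotentElem ((2 : F)⁻¹ • ((1 : Module.End F H) + σ • U)) := by
    intro σ hσ
    change _ * _ = _
    have h3 : ((1 : Module.End F H) + σ • U) * ((1 : Module.End F H) + σ • U) =
        (2 : F) • ((1 : Module.End F H) + σ • U) := by
      rw [mul_add, mul_one, add_mul, one_mul, smul_mul_smul_comm, hU, hσ, one_smul]
      module
    rw [smul_mul_smul_comm, h3, smul_smul, mul_assoc, inv_mul_cancel₀ h2, mul_one]
  -- the projections on the eigenspaces of `U` for `1` and `-1`, with traces `x` and `y` below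
  set p := (2 : F)⁻¹ • ((1 : Module.End F H) + (1 : F) • U) with hp
  set q := (2 : F)⁻¹ • ((1 : Module.End F H) + (-1 : F) • U) with hq
  have hpi : IsIdempotentElem p := hid 1 (one_mul 1)
  have hqi : IsIdempotentElem q := hid (-1) (by norm_num)
  have hcomm : ∀ σ : F, Commute e ((2 : F)⁻¹ • ((1 : Module.End F H) + σ • U)) := fun σ =>
    ((Commute.one_right e).add_right ((show Commute e U from hUe.symm).smul_right σ)).smul_right _
  have hepi : IsIdempotentElem (e * p) := hee.mul_of_commute (hcomm 1) hpi
  have heqi : IsIdempotentElem (e * q) := hee.mul_of_commute (hcomm (-1)) hqi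
  have hpq : p - q = U := by
    have h3 : p - q = ((2 : F)⁻¹ * 2) • U := by rw [hp, hq]; module
    rw [h3, inv_mul_cancel₀ h2, one_smul]
  have hpq' : p + q = 1 := by
    have h3 : p + q = ((2 : F)⁻¹ * 2) • (1 : Module.End F H) := by rw [hp, hq]; module
    rw [h3, inv_mul_cancel₀ h2, one_smul]
  have t1 : LinearMap.trace F H U = LinearMap.trace F H p - LinearMap.trace F H q := by
    rw [← map_sub, hpq]
  have t2 : (n : F) = LinearMap.trace F H p + LinearMap.trace F H q := by
    rw [← map_add, hpq', LinearMap.trace_one]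
  have t3 : LinearMap.trace F H (e * U) =
      LinearMap.trace F H (e * p) - LinearMap.trace F H (e * q) := by
    rw [← map_sub, ← mul_sub, hpq]
  have t4 : (n : F) * LinearMap.trace F H (e * U) = LinearMap.trace F H U := by
    refine mul_left_cancel₀ hc ?_
    rw [htU, he, smul_mul_assoc, map_smul, smul_eq_mul, mul_inv_cancel_left₀ hn0, htPU]
  have t5 : LinearMap.trace F H U ≠ 0 := fun h => by simp [h] at htU
  rw [trace_of_isIdempotentElem hpi, trace_of_isIdempotentElem hqi] at t1 t2
  rw [trace_of_isIdempotentElem hepi, trace_of_isIdempotentElem heqi] at t3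
  rw [t1] at t4 t5
  rw [t3] at t4
  generalize hx : Module.finrank F (LinearMap.range p) = x at *
  generalize hy : Module.finrank F (LinearMap.range q) = y at *
  generalize Module.finrank F (LinearMap.range (e * p)) = x' at *
  generalize Module.finrank F (LinearMap.range (e * q)) = y' at *
  have u2 : n = x + y := by exact_mod_cast t2
  have u4 : (n : ℤ) * (x' - y') = x - y := by
    have : ((((n : ℤ) * (x' - y') : ℤ)) : F) = (((x : ℤ) - y : ℤ) : F) := by push_cast; exact t4
    exact_mod_cast this
  have u5 : (x : ℤ) - y ≠ 0 := by
    intro h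
    apply t5
    have : (((x : ℤ) - y : ℤ) : F) = 0 := by rw [h]; simp
    simpa using this
  -- `n = x + y` divides `x - y ≠ 0`, so `|x - y| ≥ x + y`
  have u6 : x = 0 ∨ y = 0 := by
    by_contra! h
    refine u5 (Int.eq_zero_of_abs_lt_dvd ⟨_, u4.symm⟩ ?_)
    rw [abs_lt]
    omega
  have key : U = 1 := by
    rcases u6 with h | h
    -- `U = -1` contradicts `U 1 = 1`
    · rw [h, Submodule.finrank_eq_zero, LinearMap.range_eq_bot] at hx
      rw [hx, zero_sub] at hpq
      rw [hx, zero_add] at hpq'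
      rw [hpq'] at hpq
      have h3 := congrArg (fun T : Module.End F H => counit (R := F) (T 1)) hpq
      simp [U] at h3
      norm_num at h3
    · rw [h, Submodule.finrank_eq_zero, LinearMap.range_eq_bot] at hy
      rw [← hpq, ← hpq', hy, sub_zero, add_zero]
  exact congrArg (fun T : Module.End F H => T a) key

end Involutive

/-! ### Cocommutativity of the Haar integrals -/

section HaarSymmetric

variable {F H : Type*} [Field F] [CharZero F] [Ring H] [HopfAlgebra F H] [FiniteDimensional F H]
  {ℓ : H} {η : DualHopf F H}

theorem haar_mul_comm (hℓ : IsHaarIntegral (F := F) counit ℓ)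
    (hη : IsHaarIntegral (dualCounit F H) η) (a b : H) : η (a * b) = η (b * a) := by
  rw [← haar_mul_antipode_sq hℓ hη, antipode_antipode hℓ hη]

/-- The Haar integral is cocommutative. -/
theorem comm_comul_haar (hℓ : IsHaarIntegral (F := F) counit ℓ)
    (hη : IsHaarIntegral (dualCounit F H) η) :
    TensorProduct.comm F H H (comul (R := F) ℓ) = comul (R := F) ℓ := by
  let r := Repr.arbitrary F ℓ
  have hc := haar_pairing_ne_zero hℓ hη
  have h1 : ∀ x : H, ∑ i ∈ r.index, η (x * r.left i) • r.right i =
      ∑ i ∈ r.index, η (x * r.right i) • r.left i := by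
    intro x
    have h2 := haar_fourier_left hℓ hη r (HopfAlgebra.antipode F x)
    have h3 := haar_fourier_right hℓ hη r (HopfAlgebra.antipode F x)
    simp only [antipode_antipode hℓ hη] at h2 h3
    rw [h2, ← h3]
    exact Finset.sum_congr rfl fun i _ => by rw [haar_mul_comm hℓ hη]
  -- test the first leg against the functionals `η(x -)`, which exhaust the dual space
  have h4 : ∀ f : H →ₗ[F] F, ∑ i ∈ r.index, f (r.left i) • r.right i =
      ∑ i ∈ r.index, f (r.right i) • r.left i := by
    intro f
    obtain ⟨x, rfl⟩ := (haarEquiv hη).surjective f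
    simp only [haarEquiv_apply, haar_mul_comm hℓ hη _ x]
    exact h1 x
  let b := Module.finBasis F H
  refine (sum_basis_tmul_rTensor b _).symm.trans (Eq.trans ?_ (sum_basis_tmul_rTensor b _))
  refine Finset.sum_congr rfl fun i _ => ?_
  congr 1
  rw [← r.eq]
  simp only [map_sum, TensorProduct.comm_tmul, LinearMap.rTensor_tmul, TensorProduct.lid_tmul]
  exact (h4 (b.coord i)).symm

/-- The Haar integral of the dual is cocommutative, since it is a trace on `H`. -/
theorem comm_comul_dual_haar (hℓ : IsHaarIntegral (F := F) counit ℓ)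
    (hη : IsHaarIntegral (dualCounit F H) η) :
    TensorProduct.comm F _ _ (comul (R := F) η) = comul (R := F) η := by
  have h1 : ∀ (z : DualHopf F H ⊗[F] DualHopf F H) (h k : H),
      dualPairing F H (TensorProduct.comm F _ _ z) (h ⊗ₜ k) = dualPairing F H z (k ⊗ₜ h) := by
    intro z h k
    induction z with
    | zero => simp
    | add x y hx hy => simp only [map_add, LinearMap.add_apply, hx, hy]
    | tmul α β => rw [TensorProduct.comm_tmul, dualPairing_tmul, dualPairing_tmul, mul_comm]
  refine (dualPairing F H).injective (TensorProduct.ext (LinearMap.ext fun h =>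
    LinearMap.ext fun k => ?_))
  change dualPairing F H _ (h ⊗ₜ k) = dualPairing F H _ (h ⊗ₜ k)
  rw [h1, comul_dual, dualPairing_dualComul, dualPairing_dualComul, haar_mul_comm hℓ hη]

theorem antipode_antipode_dual (hℓ : IsHaarIntegral (F := F) counit ℓ)
    (hη : IsHaarIntegral (dualCounit F H) η) (α : DualHopf F H) :
    HopfAlgebra.antipode F (HopfAlgebra.antipode F α) = α :=
  dual_ext fun k => by rw [antipode_dual, antipode_dual, antipode_antipode hℓ hη]

end HaarSymmetric

/-! ### Cocommutative elements and the adjoint action -/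

section Adjoint

variable {F C A : Type*} [Field F] [Ring C] [HopfAlgebra F C] [Ring A] [Algebra F A] {ℓ : C}

/-- The representation of `Δ(ℓ)` with the legs exchanged, for a cocommutative element `ℓ`. -/
def reprSwap {ι : Type*} (r : Repr F ℓ ι)
    (hℓ : TensorProduct.comm F C C (comul (R := F) ℓ) = comul (R := F) ℓ) : Repr F ℓ ι where
  index := r.index
  left := r.right
  right := r.left
  eq := by
    rw [← hℓ, ← r.eq]
    simp

/-- On a cocommutative element, the convolution product of two maps with commuting values does not
depend on the order of the factors. -/
theorem convMul_comm_apply {P Q : WithConv (C →ₗ[F] A)}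
    (hℓ : TensorProduct.comm F C C (comul (R := F) ℓ) = comul (R := F) ℓ)
    (h : ∀ a b, Commute (P a) (Q b)) : (P * Q) ℓ = (Q * P) ℓ := by
  let r := Repr.arbitrary F ℓ
  rw [(reprSwap r hℓ).convMul_apply, r.convMul_apply]
  exact Finset.sum_congr rfl fun i _ => (h _ _).eq

/-- The convolution product `c ↦ P(c₍₂₎) Q(c₍₁₎)` for the opposite comultiplication. -/
def opConv (P Q : WithConv (C →ₗ[F] A)) : WithConv (C →ₗ[F] A) :=
  toConv (LinearMap.mul' F A ∘ₗ TensorProduct.map P.ofConv Q.ofConv ∘ₗ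
    (TensorProduct.comm F C C).toLinearMap ∘ₗ comul)

theorem opConv_apply {ι : Type*} {c : C} (r : Repr F c ι) (P Q : WithConv (C →ₗ[F] A)) :
    opConv P Q c = ∑ i ∈ r.index, P (r.right i) * Q (r.left i) := by
  change LinearMap.mul' F A (TensorProduct.map P.ofConv Q.ofConv
    (TensorProduct.comm F C C (comul (R := F) c))) = _
  rw [← r.eq]
  simp

/-- On a cocommutative element, a factor whose values commute with those of its neighbours can be
moved out of the middle of a convolution product. -/
theorem convMul_convMul_apply {P Q Z : WithConv (C →ₗ[F] A)}
    (hℓ : TensorProduct.comm F C C (comul (R := F) ℓ) = comul (R := F) ℓ)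
    (h : ∀ a b, Commute (P a) (Z b)) : (P * Z * Q) ℓ = (Z * opConv P Q) ℓ := by
  let r := Repr.arbitrary F ℓ
  let a₁ := fun j => Repr.arbitrary F (r.left j)
  let a₂ := fun j => Repr.arbitrary F (r.right j)
  have key := congrArg (LinearMap.mul' F A ∘ₗ TensorProduct.map Z.ofConv (LinearMap.mul' F A ∘ₗ
    TensorProduct.map P.ofConv Q.ofConv ∘ₗ (TensorProduct.comm F C C).toLinearMap))
    (Coalgebra.sum_tmul_tmul_eq r a₁ a₂)
  simp only [map_sum, LinearMap.comp_apply, LinearEquiv.coe_coe, TensorProduct.comm_tmul,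
    TensorProduct.map_tmul, LinearMap.mul'_apply] at key
  rw [mul_assoc, (reprSwap r hℓ).convMul_apply, r.convMul_apply]
  simp only [opConv_apply (a₂ _), Finset.mul_sum]
  rw [← key]
  refine Finset.sum_congr rfl fun i _ => ?_
  change P (r.right i) * (Z * Q) (r.left i) = _
  rw [(a₁ i).convMul_apply, Finset.mul_sum]
  exact Finset.sum_congr rfl fun j _ => by rw [← mul_assoc, (h _ _).eq, mul_assoc]

local notation "S" => HopfAlgebra.antipode F (A := C)

theorem sum_antipode_right_mul_left (hS : ∀ a : C, S (S a) = a) {ι : Type*} {c : C}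
    (r : Repr F c ι) :
    ∑ i ∈ r.index, S (r.right i) * r.left i = counit (R := F) c • 1 := by
  have h1 := congrArg S (HopfAlgebra.sum_antipode_mul_eq_smul r)
  simpa [HopfAlgebra.antipode_mul_antidistrib, hS] using h1

theorem sum_right_mul_antipode_left (hS : ∀ a : C, S (S a) = a) {ι : Type*} {c : C}
    (r : Repr F c ι) :
    ∑ i ∈ r.index, r.right i * S (r.left i) = counit (R := F) c • 1 := by
  have h1 := congrArg S (HopfAlgebra.sum_mul_antipode_eq_smul r)
  simpa [HopfAlgebra.antipode_mul_antidistrib, hS] using h1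

theorem opConv_invConv_homConv (hS : ∀ a : C, S (S a) = a) (f : C →ₐ[F] A) :
    opConv (invConv f) (homConv f) = 1 := by
  refine WithConv.ext (LinearMap.ext fun c => ?_)
  let r := Repr.arbitrary F c
  have h1 := congrArg f (sum_antipode_right_mul_left hS r)
  rw [opConv_apply r, LinearMap.convOne_apply, Algebra.algebraMap_eq_smul_one]
  simpa using h1

theorem opConv_homConv_invConv (hS : ∀ a : C, S (S a) = a) (f : C →ₐ[F] A) :
    opConv (homConv f) (invConv f) = 1 := by
  refine WithConv.ext (LinearMap.ext fun c => ?_)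
  let r := Repr.arbitrary F c
  have h1 := congrArg f (sum_right_mul_antipode_left hS r)
  rw [opConv_apply r, LinearMap.convOne_apply, Algebra.algebraMap_eq_smul_one]
  simpa using h1

theorem sandwich_tmul {C : Type*} [AddCommGroup C] [Module F C] (f g : C →ₗ[F] A) (c d : C)
    (X : A) : sandwich f g (c ⊗ₜ d) X = f c * X * g d := (mul_assoc _ _ _).symm

theorem sandwich_comul (f : C →ₐ[F] A) (c : C) (X : A) :
    sandwich (f.toLinearMap ∘ₗ S) f.toLinearMap (comul c) X =
      (invConv f * constConv F C X * homConv f) c := by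
  let r := Repr.arbitrary F c
  rw [r.convMul_apply, ← r.eq, map_sum, LinearMap.sum_apply]
  simp only [sandwich_tmul, mul_constConv_apply]

theorem sandwich_comm_comul (hS : ∀ a : C, S (S a) = a) (f : C →ₐ[F] A) (c : C) (X : A) :
    sandwich (f.toLinearMap ∘ₗ S) f.toLinearMap (TensorProduct.comm F C C (comul c)) X =
      (homConv f * constConv F C X * invConv f) (S c) := by
  let r := Repr.arbitrary F c
  let q : Repr F (S c) (C × C) := ⟨r.index, fun i => S (r.right i), fun i => S (r.left i), by
    rw [comul_antipode, ← r.eq]; simp⟩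
  rw [q.convMul_apply, ← r.eq, map_sum, map_sum, LinearMap.sum_apply]
  simp only [sandwich_tmul, mul_constConv_apply, TensorProduct.comm_tmul, q, LinearMap.comp_apply,
    AlgHom.toLinearMap_apply, hS]

theorem commute_homConv_iff {f : C →ₐ[F] A} {X : A} :
    Commute (constConv F C X) (homConv f) ↔ ∀ c, Commute X (f c) :=
  ⟨fun h c => commute_of_commute_constConv h c, fun h => commute_constConv h⟩

/-- The invariants of the right adjoint action are the commutant. -/
theorem sandwich_comul_eq_iff (f : C →ₐ[F] A) (X : A) :
    (∀ c, sandwich (f.toLinearMap ∘ₗ S) f.toLinearMap (comul c) X = counit (R := F) c • X) ↔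
      ∀ c, Commute X (f c) := by
  rw [← commute_homConv_iff]
  simp only [sandwich_comul]
  constructor
  · intro h
    have h1 : invConv f * constConv F C X * homConv f = constConv F C X :=
      WithConv.ext (LinearMap.ext h)
    have h2 := congrArg (homConv f * ·) h1
    simp only [← mul_assoc, homConv_mul_invConv, one_mul] at h2
    exact h2
  · intro h c
    rw [mul_assoc, h.eq, ← mul_assoc, invConv_mul_homConv, one_mul, constConv_apply]

theorem sandwich_comm_comul_eq_iff (hS : ∀ a : C, S (S a) = a) (f : C →ₐ[F] A) (X : A) :
    (∀ c, sandwich (f.toLinearMap ∘ₗ S) f.toLinearMap (TensorProduct.comm F C C (comul c)) X =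
      counit (R := F) c • X) ↔ ∀ c, Commute X (f c) := by
  rw [← commute_homConv_iff]
  simp only [sandwich_comm_comul hS]
  constructor
  · intro h
    have h1 : homConv f * constConv F C X * invConv f = constConv F C X := by
      refine WithConv.ext (LinearMap.ext fun c => ?_)
      have := h (S c)
      rw [hS, HopfAlgebra.counit_antipode] at this
      exact this
    have h2 := congrArg (· * homConv f) h1
    simp only [mul_assoc, invConv_mul_homConv, mul_one] at h2
    exact h2.symm
  · intro h c
    rw [← h.eq, mul_assoc, homConv_mul_invConv, mul_one, constConv_apply,
      HopfAlgebra.counit_antipode]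

/-- Averaging with respect to the adjoint action of the Haar integral gives invariants. -/
theorem commute_sandwich_comul_haar (hS : ∀ a : C, S (S a) = a)
    (hℓ : IsHaarIntegral (F := F) counit ℓ) (f : C →ₐ[F] A) (X : A) (c : C) :
    Commute (sandwich (f.toLinearMap ∘ₗ S) f.toLinearMap (comul ℓ) X) (f c) := by
  have h1 := congrArg (fun z => sandwich (f.toLinearMap ∘ₗ S) f.toLinearMap z X)
    (comul_mul_one_tmul_antipode hℓ (S c))
  let r := Repr.arbitrary F ℓ
  rw [hS, ← r.eq] at h1
  rw [← r.eq]
  change _ * f c = f c * _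
  simp only [Finset.sum_mul, Algebra.TensorProduct.tmul_mul_tmul, map_sum, LinearMap.sum_apply,
    sandwich_tmul, mul_one, LinearMap.comp_apply, AlgHom.toLinearMap_apply, map_mul,
    HopfAlgebra.antipode_mul_antidistrib, hS, Finset.mul_sum, ← mul_assoc] at h1 ⊢
  exact h1

end Adjoint

/-! ### Convolution algebras with two legs -/

section Site

variable {F H A : Type*} [Field F] [Ring H] [HopfAlgebra F H]
  [FiniteDimensional F H] [Ring A] [Algebra F A]

variable (F H A) in
/-- The algebra `Hom(H*, A) ≅ H ⊗ A`. -/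
abbrev DualConv := WithConv (DualHopf F H →ₗ[F] A)

variable (F H A) in
/-- The algebra `Hom(H, Hom(H*, A)) ≅ H* ⊗ H ⊗ A`. -/
abbrev DoubleConv := WithConv (H →ₗ[F] DualConv F H A)

variable (F H A) in
/-- The embedding of `H` into `Hom(H*, A) ≅ H ⊗ A`. -/
def embPrimal : H →ₐ[F] DualConv F H A :=
  AlgHom.ofLinearMap
    { toFun := fun h => toConv ((LinearMap.toSpanSingleton F A 1) ∘ₗ LinearMap.applyₗ h ∘ₗ
        (WithConv.linearEquiv F (H →ₗ[F] F)).toLinearMap)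
      map_add' := fun h k => by ext; simp [add_smul]
      map_smul' := fun c h => by ext; simp [mul_smul] }
    (by
      refine WithConv.ext (LinearMap.ext fun α => ?_)
      exact (Algebra.algebraMap_eq_smul_one _).symm)
    (fun h k => by
      refine WithConv.ext (LinearMap.ext fun α => ?_)
      let r := Repr.arbitrary F α
      rw [r.convMul_apply]
      simp [smul_smul, ← Finset.sum_smul, mul_comm, sum_repr_dual r])

theorem embPrimal_apply (h : H) (α : DualHopf F H) : embPrimal F H A h α = α h • (1 : A) := rfl

variable (F H A) in
/-- The embedding of `A` into `Hom(H*, A) ≅ H ⊗ A`. -/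
def embConst : A →ₐ[F] DualConv F H A :=
  { constConv F (DualHopf F H) with
    commutes' := fun c => by
      refine WithConv.ext (LinearMap.ext fun α => ?_)
      change counit (R := F) α • algebraMap F A c = c • algebraMap F A (counit (R := F) α)
      rw [Algebra.algebraMap_eq_smul_one, Algebra.algebraMap_eq_smul_one, smul_comm] }

theorem embConst_mul_apply (a : A) (f : DualConv F H A) (α : DualHopf F H) :
    (embConst F H A a * f) α = a * f α := constConv_mul_apply f a α

theorem mul_embConst_apply (a : A) (f : DualConv F H A) (α : DualHopf F H) :
    (f * embConst F H A a) α = f α * a := mul_constConv_apply f a α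

theorem commute_embConst_embPrimal (a : A) (h : H) :
    Commute (embConst F H A a) (embPrimal F H A h) :=
  commute_constConv fun α => by rw [embPrimal_apply]; exact (Commute.one_right a).smul_right _

variable (F H A) in
/-- The canonical element of `H* ⊗ H ⊆ H* ⊗ H ⊗ A`. -/
abbrev canonicalElt : DoubleConv F H A := homConv (embPrimal F H A)

/-- The element of `H* ⊗ A ⊆ H* ⊗ H ⊗ A` given by a linear map `H → A`. -/
abbrev primalElt : WithConv (H →ₗ[F] A) →+* DoubleConv F H A := mapConv F H (embConst F H A)

/-- The element of `H ⊗ A ⊆ H* ⊗ H ⊗ A` given by a linear map `H* → A`. -/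
abbrev dualElt : DualConv F H A →+* DoubleConv F H A := constConv F H

end Site

/-! ### Representations of the Drinfeld double -/

section SiteRelation

variable {F H A : Type*} [Field F] [Ring H] [HopfAlgebra F H]
  [FiniteDimensional F H] [Ring A] [Algebra F A] {ℓ : H} {η : DualHopf F H}
  {a : H →ₐ[F] A} {b : DualHopf F H →ₐ[F] A}

local notation "S" => HopfAlgebra.antipode F (A := H)

/-- The maps `a` and `b` satisfy `b(α₍₁₎) ⟨α₍₂₎, h₍₁₎⟩ a(h₍₂₎) = a(h₍₁₎) ⟨α₍₁₎, h₍₂₎⟩ b(α₍₂₎)`, the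
commutation relation of `H` and `H*` in the Drinfeld double. -/
def IsDrinfeldPair (a : H →ₐ[F] A) (b : DualHopf F H →ₐ[F] A) : Prop :=
  dualElt (homConv b) * canonicalElt F H A * primalElt (homConv a) =
    primalElt (homConv a) * canonicalElt F H A * dualElt (homConv b)

/-- The action of gauge transformations associated with `a` and `b`. -/
def adjointAction (a : H →ₐ[F] A) (b : DualHopf F H →ₐ[F] A) (δ : DualHopf F H) (z : H) :
    Module.End F A :=
  sandwich (a.toLinearMap ∘ₗ S) a.toLinearMap (TensorProduct.comm F H H (comul z)) *
    sandwich (b.toLinearMap ∘ₗ HopfAlgebra.antipode F) b.toLinearMap (comul δ)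

variable [CharZero F]

/-- Conjugation by the canonical element is trivial on `η`, which is cocommutative. -/
theorem canonicalElt_conj_apply_haar (hℓ : IsHaarIntegral (F := F) counit ℓ)
    (hη : IsHaarIntegral (dualCounit F H) η) (f : DualConv F H A) (h : H) :
    (canonicalElt F H A * dualElt f * invConv (embPrimal F H A)) h η =
      counit (R := F) h • f η := by
  let r := Repr.arbitrary F h
  have h1 : ∀ i, (embPrimal F H A (r.left i) * f * embPrimal F H A (S (r.right i))) η =
      (embPrimal F H A (S (r.right i) * r.left i) * f) η := by
    intro i
    have h2 : (embPrimal F H A (r.left i) * f * embPrimal F H A (S (r.right i))) η =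
        (embPrimal F H A (S (r.right i)) * (embPrimal F H A (r.left i) * f)) η :=
      convMul_comm_apply (comm_comul_dual_haar hℓ hη) fun α β => by
        rw [embPrimal_apply]
        exact (Commute.one_right _).smul_right _
    rw [h2, map_mul]
    exact congrArg (fun g : DualConv F H A => g η) (mul_assoc _ _ _).symm
  rw [r.convMul_apply]
  simp only [mul_constConv_apply, ofConv_sum, LinearMap.sum_apply]
  change ∑ i ∈ r.index, (embPrimal F H A (r.left i) * f * embPrimal F H A (S (r.right i))) η = _
  have h3 : (∑ i ∈ r.index, embPrimal F H A (S (r.right i) * r.left i) * f) =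
      counit (R := F) h • f := by
    rw [← Finset.sum_mul, ← map_sum, sum_antipode_right_mul_left (antipode_antipode hℓ hη),
      map_smul, map_one, smul_mul_assoc, one_mul]
  have h4 := congrArg (fun g : DualConv F H A => g η) h3
  simp only [ofConv_sum, LinearMap.sum_apply] at h4
  rw [Finset.sum_congr rfl fun i _ => h1 i, h4]
  rfl

/-- The integrals of `H` and `H*` commute, since their commutation relation only involves a
conjugation by the canonical element, which is trivial on cocommutative elements. -/
theorem IsDrinfeldPair.commute_haar (hD : IsDrinfeldPair a b)
    (hℓ : IsHaarIntegral (F := F) counit ℓ) (hη : IsHaarIntegral (dualCounit F H) η) :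
    Commute (b η) (a ℓ) := by
  have hS := antipode_antipode hℓ hη
  have h1 : dualElt (homConv b) * (canonicalElt F H A * primalElt (homConv a) *
      invConv (embPrimal F H A)) = primalElt (homConv a) *
      (canonicalElt F H A * dualElt (homConv b) * invConv (embPrimal F H A)) := by
    have := congrArg (· * invConv (embPrimal F H A)) hD
    simpa only [mul_assoc] using this
  have h2 := congrArg (fun g : DoubleConv F H A => g ℓ η) h1
  let r := Repr.arbitrary F ℓ
  simp only [constConv_mul_apply] at h2
  rw [convMul_convMul_apply (comm_comul_haar hℓ hη)
      (fun x y => (commute_embConst_embPrimal (a y) x).symm),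
    opConv_homConv_invConv hS, mul_one, r.convMul_apply] at h2
  simp only [mapConv_apply, mul_embConst_apply, ofConv_sum, LinearMap.sum_apply,
    embConst_mul_apply, canonicalElt_conj_apply_haar hℓ hη] at h2
  refine h2.trans ?_
  have h3 := congrArg a (sum_smul_counit r)
  rw [map_sum] at h3
  change _ = a ℓ * b η
  rw [← h3, Finset.sum_mul]
  refine Finset.sum_congr rfl fun i _ => ?_
  rw [map_smul, smul_mul_assoc, mul_smul_comm]
  rfl

/-- Averaging over `H` preserves the commutant of `H*`. -/
theorem IsDrinfeldPair.commute_average (hD : IsDrinfeldPair a b)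
    (hℓ : IsHaarIntegral (F := F) counit ℓ) (hη : IsHaarIntegral (dualCounit F H) η) {X : A}
    (hX : ∀ α, Commute X (b α)) (α : DualHopf F H) :
    Commute ((invConv a * constConv F H X * homConv a) ℓ) (b α) := by
  have hS := antipode_antipode hℓ hη
  set Z := invConv a * constConv F H X * homConv a with hZ
  set B : DoubleConv F H A := dualElt (homConv b)
  set L : DoubleConv F H A := primalElt (homConv a)
  set L' : DoubleConv F H A := primalElt (invConv a)
  set J : DoubleConv F H A := canonicalElt F H A
  set J' : DoubleConv F H A := invConv (embPrimal F H A)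
  set Y : DoubleConv F H A := primalElt (constConv F H X) with hY
  have hYc : Y = constConv F H (embConst F H A X) := mapConv_constConv _ _
  have hL : L * L' = 1 := by rw [← map_mul, homConv_mul_invConv, map_one]
  have hL' : L' * L = 1 := by rw [← map_mul, invConv_mul_homConv, map_one]
  have hJ' : J' * J = 1 := invConv_mul_homConv _
  have hD' : B * J * L = L * J * B := hD
  have hYB : Y * B = B * Y := by
    have : Commute (embConst F H A X) (homConv b) := commute_constConv hX
    rw [hYc, ← map_mul, this.eq, map_mul]
  have hYJ : Y * J = J * Y := by
    rw [hYc]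
    exact (commute_constConv fun c => commute_embConst_embPrimal X c).eq
  have h1 : B * L' = J' * L' * B * J := by
    calc B * L' = J' * J * B * L' := by rw [hJ', one_mul]
      _ = J' * (L' * L) * J * B * L' := by rw [hL', mul_one]
      _ = J' * L' * (L * J * B) * L' := by simp only [mul_assoc]
      _ = J' * L' * B * J * (L * L') := by rw [← hD']; simp only [mul_assoc]
      _ = _ := by rw [hL, mul_one]
  have hZ' : primalElt (F := F) (H := H) Z = L' * Y * L := by rw [hZ, map_mul, map_mul]
  have h2 : B * primalElt Z = J' * primalElt Z * J * B := by
    calc B * primalElt Z = (B * L') * Y * L := by rw [hZ']; simp only [mul_assoc]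
      _ = J' * L' * B * (J * Y) * L := by rw [h1]; simp only [mul_assoc]
      _ = J' * L' * (B * Y) * J * L := by rw [← hYJ]; simp only [mul_assoc]
      _ = J' * L' * Y * (B * J * L) := by rw [← hYB]; simp only [mul_assoc]
      _ = _ := by rw [hD', hZ']; simp only [mul_assoc]
  have h3 := congrArg (fun g : DoubleConv F H A => g ℓ) h2
  simp only [B, constConv_mul_apply, mul_constConv_apply] at h3
  rw [convMul_convMul_apply (comm_comul_haar hℓ hη)
      (fun x y => (commute_embConst_embPrimal (Z y) (S x)).symm),
    opConv_invConv_homConv hS, mul_one, mapConv_apply] at h3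
  exact commute_of_commute_constConv (f := homConv b) (show _ * _ = _ * _ from h3.symm) α

/-- Gauge invariant elements are those that commute with the images of `a` and `b`. -/
theorem adjointAction_eq_iff (hS : ∀ h, S (S h) = h) (X : A) :
    (∀ δ z, adjointAction a b δ z X = (dualCounit F H δ * counit (R := F) z) • X) ↔
      (∀ h, Commute X (a h)) ∧ ∀ α, Commute X (b α) := by
  constructor
  · intro h
    have h1 : ∀ Y, sandwich (b.toLinearMap ∘ₗ HopfAlgebra.antipode F) b.toLinearMap
        (comul (1 : DualHopf F H)) Y = Y := by
      intro Y
      rw [Bialgebra.comul_one, Algebra.TensorProduct.one_def, sandwich_tmul]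
      simp [HopfAlgebra.antipode_one]
    have h2 : ∀ Y, sandwich (a.toLinearMap ∘ₗ S) a.toLinearMap
        (TensorProduct.comm F H H (comul (1 : H))) Y = Y := by
      intro Y
      rw [Bialgebra.comul_one, Algebra.TensorProduct.one_def, TensorProduct.comm_tmul,
        sandwich_tmul]
      simp [HopfAlgebra.antipode_one]
    rw [← sandwich_comm_comul_eq_iff hS, ← sandwich_comul_eq_iff]
    constructor
    · intro z
      have h3 := h 1 z
      rw [adjointAction, Module.End.mul_apply, h1] at h3
      rw [h3, show dualCounit F H 1 = 1 from Bialgebra.counit_one (R := F) (A := DualHopf F H),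
        one_mul]
    · intro δ
      have h3 := h δ 1
      rw [adjointAction, Module.End.mul_apply, h2] at h3
      rw [h3, Bialgebra.counit_one, mul_one]
      rfl
  · rintro ⟨h1, h2⟩ δ z
    rw [← sandwich_comm_comul_eq_iff hS] at h1
    rw [← sandwich_comul_eq_iff] at h2
    rw [adjointAction, Module.End.mul_apply, h2, map_smul, h1, smul_smul]
    rfl

theorem IsDrinfeldPair.commute_adjointAction (hD : IsDrinfeldPair a b)
    (hℓ : IsHaarIntegral (F := F) counit ℓ) (hη : IsHaarIntegral (dualCounit F H) η) (X : A) :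
    (∀ h, Commute (adjointAction a b η ℓ X) (a h)) ∧
      ∀ α, Commute (adjointAction a b η ℓ X) (b α) := by
  have hS := antipode_antipode hℓ hη
  rw [adjointAction, Module.End.mul_apply, comm_comul_haar hℓ hη]
  refine ⟨commute_sandwich_comul_haar hS hℓ a _, fun α => ?_⟩
  rw [sandwich_comul]
  exact hD.commute_average hℓ hη
    (commute_sandwich_comul_haar (antipode_antipode_dual hℓ hη) hη b X) α

theorem sandwich_mem (K : Subalgebra F A) {C : Type*} [AddCommGroup C] [Module F C]
    {f g : C →ₗ[F] A} (hf : ∀ c, f c ∈ K) (hg : ∀ c, g c ∈ K) (t : C ⊗[F] C) {Y : A}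
    (hY : Y ∈ K) : sandwich f g t Y ∈ K := by
  induction t with
  | zero => simp
  | add x y hx hy => rw [map_add]; exact add_mem hx hy
  | tmul x y => rw [sandwich_tmul]; exact mul_mem (mul_mem (hf x) hY) (hg y)

/-- Gauge transformations preserve every subalgebra that contains the images of `a` and `b`. -/
theorem adjointAction_mem (K : Subalgebra F A) (ha : ∀ h, a h ∈ K) (hb : ∀ α, b α ∈ K)
    (δ : DualHopf F H) (z : H) {X : A} (hX : X ∈ K) : adjointAction a b δ z X ∈ K := by
  rw [adjointAction, Module.End.mul_apply]
  exact sandwich_mem K (fun c => ha _) (fun c => ha c) _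
    (sandwich_mem K (fun c => hb _) (fun c => hb c) _ hX)

/-- The element `a(ℓ) b(η)` is the image of the Haar integral of the Drinfeld double. -/
theorem IsDrinfeldPair.haar_mul (hD : IsDrinfeldPair a b)
    (hℓ : IsHaarIntegral (F := F) counit ℓ) (hη : IsHaarIntegral (dualCounit F H) η) :
    (∀ h, a h * (a ℓ * b η) = counit (R := F) h • (a ℓ * b η) ∧
      (a ℓ * b η) * a h = counit (R := F) h • (a ℓ * b η)) ∧
    (∀ α, b α * (a ℓ * b η) = dualCounit F H α • (a ℓ * b η) ∧
      (a ℓ * b η) * b α = dualCounit F H α • (a ℓ * b η)) := by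
  have hc := hD.commute_haar hℓ hη
  refine ⟨fun h => ⟨?_, ?_⟩, fun α => ⟨?_, ?_⟩⟩
  · rw [← mul_assoc, ← map_mul, (hℓ.1 h).1, map_smul, smul_mul_assoc]
  · rw [← hc.eq, mul_assoc, ← map_mul, (hℓ.1 h).2, map_smul, mul_smul_comm]
  · rw [← hc.eq, ← mul_assoc, ← map_mul, (hη.1 α).1, map_smul, smul_mul_assoc]
  · rw [mul_assoc, ← map_mul, (hη.1 α).2, map_smul, mul_smul_comm]

theorem IsDrinfeldPair.commute_haar_mul (hD : IsDrinfeldPair a b)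
    (hℓ : IsHaarIntegral (F := F) counit ℓ) (hη : IsHaarIntegral (dualCounit F H) η) :
    (∀ h, Commute (a ℓ * b η) (a h)) ∧ ∀ α, Commute (a ℓ * b η) (b α) := by
  have h := hD.haar_mul hℓ hη
  exact ⟨fun x => ((h.1 x).2.trans (h.1 x).1.symm), fun x => ((h.2 x).2.trans (h.2 x).1.symm)⟩

theorem IsDrinfeldPair.isIdempotentElem (hD : IsDrinfeldPair a b)
    (hℓ : IsHaarIntegral (F := F) counit ℓ) (hη : IsHaarIntegral (dualCounit F H) η) :
    IsIdempotentElem (a ℓ * b η) := by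
  have h := hD.haar_mul hℓ hη
  change (a ℓ * b η) * (a ℓ * b η) = _
  nth_rewrite 1 [mul_assoc]
  rw [(h.2 η).1, mul_smul_comm, (h.1 ℓ).1, hℓ.2, hη.2, one_smul, one_smul]

theorem IsDrinfeldPair.adjointAction_mul (hD : IsDrinfeldPair a b)
    (hℓ : IsHaarIntegral (F := F) counit ℓ) (hη : IsHaarIntegral (dualCounit F H) η) (X : A) :
    adjointAction a b η ℓ X * (a ℓ * b η) = (a ℓ * b η) * X * (a ℓ * b η) := by
  have h := hD.haar_mul hℓ hη
  have hSη : HopfAlgebra.antipode F η = η := dual_ext fun k => haar_antipode hℓ hη k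
  have hSℓ : S ℓ = ℓ := by
    have h1 := haar_nondegenerate hη (b := S ℓ - ℓ) fun x => by
      rw [mul_sub, map_sub, haar_mul_antipode hℓ hη, (hℓ.1 _).1, (hℓ.1 _).1,
        HopfAlgebra.counit_antipode, sub_self]
    exact sub_eq_zero.1 h1
  set G := a ℓ * b η with hG
  have h1 : ∀ Y, sandwich (a.toLinearMap ∘ₗ S) a.toLinearMap (comul ℓ) Y * G = a ℓ * (Y * G) := by
    intro Y
    let r := Repr.arbitrary F ℓ
    have h2 := congrArg (fun x => a (S x) * (Y * G)) (sum_smul_counit r)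
    simp only [hSℓ, map_sum, map_smul, Finset.sum_mul, smul_mul_assoc] at h2
    rw [← r.eq, map_sum, LinearMap.sum_apply, Finset.sum_mul, ← h2]
    refine Finset.sum_congr rfl fun i _ => ?_
    rw [sandwich_tmul, mul_assoc, AlgHom.toLinearMap_apply, (h.1 _).1, mul_smul_comm, mul_assoc]
    rfl
  have h2 : ∀ Y, sandwich (b.toLinearMap ∘ₗ HopfAlgebra.antipode F) b.toLinearMap (comul η) Y * G =
      b η * (Y * G) := by
    intro Y
    let r := Repr.arbitrary F η
    have h2 := congrArg (fun x => b (HopfAlgebra.antipode F x) * (Y * G)) (sum_smul_counit r)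
    simp only [hSη, map_sum, map_smul, Finset.sum_mul, smul_mul_assoc] at h2
    rw [← r.eq, map_sum, LinearMap.sum_apply, Finset.sum_mul, ← h2]
    refine Finset.sum_congr rfl fun i _ => ?_
    rw [sandwich_tmul, mul_assoc, AlgHom.toLinearMap_apply, (h.2 _).1, mul_smul_comm, mul_assoc]
    rfl
  rw [adjointAction, Module.End.mul_apply, comm_comul_haar hℓ hη, h1, h2, hG]
  simp only [mul_assoc]

end SiteRelation

/-! ### Triangle operators -/

section Triangle

variable {F H : Type*} [Field F] [Ring H] [HopfAlgebra F H] [FiniteDimensional F H]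

local notation "S" => HopfAlgebra.antipode F (A := H)

theorem Tneg_repr {ι : Type*} {h : H} (r : Repr F h ι) (α : DualHopf F H) :
    Tneg F H α h = ∑ i ∈ r.index, α (r.left i) • r.right i := by
  change TensorProduct.lid F H (LinearMap.rTensor H α.ofConv (comul (R := F) h)) = _
  rw [← r.eq]
  simp

theorem Tneg_mul (α β : DualHopf F H) : Tneg F H (α * β) = Tneg F H β * Tneg F H α := by
  refine LinearMap.ext fun h => ?_
  let r := Repr.arbitrary F h
  let a₁ := fun j => Repr.arbitrary F (r.left j)
  let a₂ := fun j => Repr.arbitrary F (r.right j)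
  have key := congrArg ((TensorProduct.lid F H).toLinearMap ∘ₗ TensorProduct.map α.ofConv
    ((TensorProduct.lid F H).toLinearMap ∘ₗ LinearMap.rTensor H β.ofConv))
    (Coalgebra.sum_tmul_tmul_eq r a₁ a₂)
  simp only [map_sum, LinearMap.comp_apply, LinearMap.rTensor_tmul, TensorProduct.map_tmul,
    LinearEquiv.coe_coe, TensorProduct.lid_tmul, smul_smul] at key
  rw [Module.End.mul_apply, Tneg_repr r, Tneg_repr r, map_sum]
  simp only [(a₁ _).convMul_apply, Finset.sum_smul, map_smul, Tneg_repr (a₂ _), Finset.smul_sum,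
    smul_smul]
  exact key

theorem Tneg_mul_Tpos (α β : DualHopf F H) :
    Tneg F H α * Tpos F H β = Tpos F H β * Tneg F H α := by
  refine LinearMap.ext fun h => ?_
  let r := Repr.arbitrary F h
  let a₁ := fun j => Repr.arbitrary F (r.left j)
  let a₂ := fun j => Repr.arbitrary F (r.right j)
  have key := congrArg ((TensorProduct.lid F H).toLinearMap ∘ₗ TensorProduct.map α.ofConv
    ((TensorProduct.rid F H).toLinearMap ∘ₗ LinearMap.lTensor H β.ofConv))
    (Coalgebra.sum_tmul_tmul_eq r a₁ a₂)
  simp only [map_sum, LinearMap.comp_apply, LinearMap.lTensor_tmul, TensorProduct.map_tmul,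
    LinearEquiv.coe_coe, TensorProduct.lid_tmul, TensorProduct.rid_tmul, smul_smul] at key
  rw [Module.End.mul_apply, Module.End.mul_apply, Tneg_repr r, Tpos_repr r, map_sum, map_sum]
  simp only [map_smul, Tneg_repr (a₁ _), Tpos_repr (a₂ _), Finset.smul_sum, smul_smul]
  rw [← key]
  simp only [mul_comm]

theorem Tpos_one : Tpos F H 1 = 1 := by
  refine LinearMap.ext fun h => ?_
  let r := Repr.arbitrary F h
  rw [Tpos_repr r]
  exact sum_smul_counit r

theorem Tneg_one : Tneg F H 1 = 1 := by
  refine LinearMap.ext fun h => ?_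
  let r := Repr.arbitrary F h
  rw [Tneg_repr r]
  exact sum_counit_smul r

variable (F H) in
/-- The homomorphisms `h ↦ L₊^h` and `h ↦ L₋^{S(h)}`. -/
def vertexHom (s : Bool) : H →ₐ[F] Module.End F H :=
  if s then AlgHom.ofLinearMap (Lpos F H) (LinearMap.ext fun k => one_mul k)
    (fun a b => LinearMap.ext fun k => mul_assoc a b k)
  else AlgHom.ofLinearMap (Lneg F H ∘ₗ S)
    (LinearMap.ext fun k => by
      change k * S 1 = k
      rw [HopfAlgebra.antipode_one, mul_one])
    (fun a b => LinearMap.ext fun k => by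
      change k * S (a * b) = k * S b * S a
      rw [HopfAlgebra.antipode_mul_antidistrib, mul_assoc])

theorem vertexHom_true (h k : H) : vertexHom F H true h k = h * k := rfl

theorem vertexHom_false (h k : H) : vertexHom F H false h k = k * S h := rfl

theorem commute_vertexHom (s : Bool) (g h : H) :
    Commute (vertexHom F H s g) (vertexHom F H (!s) h) := by
  refine LinearMap.ext fun k => ?_
  cases s
  · exact mul_assoc h k (S g)
  · exact (mul_assoc g k (S h)).symm

/-- The left regular action of `H` on `H*`: the functional `k ↦ α(k x)`. -/
def leftRegular (α : DualHopf F H) (x : H) : DualHopf F H :=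
  toConv (α.ofConv ∘ₗ LinearMap.mulRight F x)

variable (F H) in
/-- The homomorphisms `α ↦ T₊^α` and `α ↦ T₋^{S(α)}`. -/
def faceHom (s : Bool) : DualHopf F H →ₐ[F] Module.End F H :=
  if s then AlgHom.ofLinearMap (Tpos F H) Tpos_one Tpos_mul
  else AlgHom.ofLinearMap (Tneg F H ∘ₗ dualAntipode F H)
    (by
      rw [LinearMap.comp_apply, ← Tneg_one]
      exact congrArg (Tneg F H) (HopfAlgebra.antipode_one (R := F) (A := DualHopf F H)))
    (fun α β => by
      rw [LinearMap.comp_apply, LinearMap.comp_apply, LinearMap.comp_apply, ← Tneg_mul]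
      exact congrArg (Tneg F H) (HopfAlgebra.antipode_mul_antidistrib (R := F) α β))

theorem faceHom_true (α : DualHopf F H) : faceHom F H true α = Tpos F H α := rfl

theorem faceHom_false (α : DualHopf F H) :
    faceHom F H false α = Tneg F H (dualAntipode F H α) := rfl

theorem commute_faceHom (s : Bool) (α β : DualHopf F H) :
    Commute (faceHom F H s α) (faceHom F H (!s) β) := by
  cases s
  · exact Tneg_mul_Tpos _ _
  · exact (Tneg_mul_Tpos _ _).symm

/-- Straightening relation of the triangle operators `L₊, T₊` and of `L₋, T₋`. -/
theorem faceHom_mul_vertexHom (hS : ∀ h, S (S h) = h) (s : Bool) {ι : Type*} {h : H}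
    (r : Repr F h ι) (α : DualHopf F H) :
    faceHom F H s α * vertexHom F H s h =
      ∑ i ∈ r.index, vertexHom F H s (r.left i) *
        faceHom F H s (rightRegular F H α (r.right i)) := by
  refine LinearMap.ext fun k => ?_
  let t := Repr.arbitrary F k
  rw [LinearMap.sum_apply]
  cases s
  · let q : Repr F (S h) ι := ⟨r.index, fun i => S (r.right i), fun i => S (r.left i), by
      rw [comul_antipode, ← r.eq]; simp⟩
    rw [Module.End.mul_apply, vertexHom_false, faceHom_false, Tneg_repr (t.mul q),
      Coalgebra.Repr.mul_index, Finset.sum_product, Finset.sum_comm]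
    refine Finset.sum_congr rfl fun i _ => ?_
    rw [Module.End.mul_apply, faceHom_false, vertexHom_false, Tneg_repr t, Finset.sum_mul]
    refine Finset.sum_congr rfl fun j _ => ?_
    change α (S (t.left j * S (r.right i))) • (t.right j * S (r.left i)) =
      (α (r.right i * S (t.left j)) • t.right j) * S (r.left i)
    rw [HopfAlgebra.antipode_mul_antidistrib, hS, smul_mul_assoc]
  · rw [Module.End.mul_apply, vertexHom_true, faceHom_true, Tpos_repr (r.mul t),
      Coalgebra.Repr.mul_index, Finset.sum_product]
    refine Finset.sum_congr rfl fun i _ => ?_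
    rw [Module.End.mul_apply, faceHom_true, vertexHom_true, Tpos_repr t, Finset.mul_sum]
    refine Finset.sum_congr rfl fun j _ => ?_
    exact (mul_smul_comm _ _ _).symm

/-- `α(x S(h₍₂₎) h₍₁₎) g(h₍₃₎) = α(x) g(h)`. -/
theorem coassoc_cancel (hS : ∀ h, S (S h) = h) {ι κ : Type*} {h : H} (r : Repr F h ι)
    (a₂ : ∀ i, Repr F (r.right i) κ) (α : DualHopf F H) (g : H →ₗ[F] H) (x : H) :
    ∑ i ∈ r.index, ∑ j ∈ (a₂ i).index,
      α (x * (S ((a₂ i).left j) * r.left i)) • g ((a₂ i).right j) = α x • g h := by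
  let a₁ := fun j => Repr.arbitrary F (r.left j)
  let f : H ⊗[F] H →ₗ[F] F := α.ofConv ∘ₗ LinearMap.mulLeft F x ∘ₗ LinearMap.mul' F H ∘ₗ
      (TensorProduct.comm F H H).toLinearMap ∘ₗ TensorProduct.map LinearMap.id S
  have hf : ∀ y z, f (y ⊗ₜ z) = α (x * (S z * y)) := fun _ _ => rfl
  have key := congrArg ((TensorProduct.lid F H).toLinearMap ∘ₗ
      TensorProduct.map f g ∘ₗ
        (TensorProduct.assoc F H H H).symm.toLinearMap) (Coalgebra.sum_tmul_tmul_eq r a₁ a₂)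
  simp only [map_sum, LinearMap.comp_apply, LinearEquiv.coe_coe, TensorProduct.assoc_symm_tmul,
      TensorProduct.map_tmul, TensorProduct.lid_tmul, hf] at key
  rw [← key]
  have h1 : ∀ i, ∑ j ∈ (a₁ i).index, α (x * (S ((a₁ i).right j) * (a₁ i).left j)) =
      counit (R := F) (r.left i) * α x := by
    intro i
    rw [← map_sum, ← Finset.mul_sum, sum_antipode_right_mul_left hS, mul_smul_comm, mul_one,
      map_smul, smul_eq_mul]
  simp only [← Finset.sum_smul, h1]
  have h2 := congrArg g (sum_counit_smul r)
  simp only [map_sum, map_smul] at h2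
  rw [← h2, Finset.smul_sum]
  simp only [smul_smul, mul_comm]

/-- Straightening relation of the triangle operators `L₋, T₊` and of `L₊, T₋`. -/
theorem vertexHom_mul_faceHom (hS : ∀ h, S (S h) = h) (s : Bool) {ι : Type*} {h : H}
    (r : Repr F h ι) (α : DualHopf F H) :
    ∑ i ∈ r.index, faceHom F H s (leftRegular α (r.left i)) * vertexHom F H (!s) (r.right i) =
      vertexHom F H (!s) h * faceHom F H s α := by
  refine LinearMap.ext fun k => ?_
  let t := Repr.arbitrary F k
  let a₂ := fun j => Repr.arbitrary F (r.right j)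
  rw [LinearMap.sum_apply]
  cases s
  · rw [Bool.not_false]
    have h1 : ∀ i, (faceHom F H false (leftRegular α (r.left i)) *
        vertexHom F H true (r.right i)) k = ∑ l ∈ t.index, ∑ j ∈ (a₂ i).index,
          α (S (t.left l) * (S ((a₂ i).left j) * r.left i)) • ((a₂ i).right j * t.right l) := by
      intro i
      rw [Module.End.mul_apply, vertexHom_true, faceHom_false, Tneg_repr ((a₂ i).mul t),
        Coalgebra.Repr.mul_index, Finset.sum_product, Finset.sum_comm]
      refine Finset.sum_congr rfl fun l _ => Finset.sum_congr rfl fun j _ => ?_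
      change α (S ((a₂ i).left j * t.left l) * r.left i) • _ = _
      rw [HopfAlgebra.antipode_mul_antidistrib, mul_assoc]
      rfl
    simp only [h1]
    rw [Finset.sum_comm]
    have h2 := fun l => coassoc_cancel hS r a₂ α (LinearMap.mulRight F (t.right l)) (S (t.left l))
    simp only [LinearMap.mulRight_apply] at h2
    simp only [h2]
    rw [Module.End.mul_apply, vertexHom_true, faceHom_false, Tneg_repr t, Finset.mul_sum]
    refine Finset.sum_congr rfl fun l _ => ?_
    exact (mul_smul_comm _ _ _).symm
  · rw [Bool.not_true]
    have h1 : ∀ i, (faceHom F H true (leftRegular α (r.left i)) *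
        vertexHom F H false (r.right i)) k = ∑ l ∈ t.index, ∑ j ∈ (a₂ i).index,
          α (t.right l * (S ((a₂ i).left j) * r.left i)) • (t.left l * S ((a₂ i).right j)) := by
      intro i
      let q : Repr F (S (r.right i)) (H × H) :=
        ⟨(a₂ i).index, fun j => S ((a₂ i).right j), fun j => S ((a₂ i).left j), by
          rw [comul_antipode, ← (a₂ i).eq]; simp⟩
      rw [Module.End.mul_apply, vertexHom_false, faceHom_true, Tpos_repr (t.mul q),
        Coalgebra.Repr.mul_index, Finset.sum_product]
      refine Finset.sum_congr rfl fun l _ => Finset.sum_congr rfl fun j _ => ?_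
      change α (t.right l * S ((a₂ i).left j) * r.left i) • _ = _
      rw [mul_assoc]
      rfl
    simp only [h1]
    rw [Finset.sum_comm]
    have h2 := fun l => coassoc_cancel hS r a₂ α (LinearMap.mulLeft F (t.left l) ∘ₗ S) (t.right l)
    simp only [LinearMap.mulLeft_apply, LinearMap.comp_apply] at h2
    simp only [h2]
    rw [Module.End.mul_apply, vertexHom_false, faceHom_true, Tpos_repr t, Finset.sum_mul]
    refine Finset.sum_congr rfl fun l _ => ?_
    exact (smul_mul_assoc _ _ _).symm

end Triangle

/-! ### The relations in the convolution algebra -/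

section Relations

variable {F H A : Type*} [Field F] [Ring H] [HopfAlgebra F H]
  [FiniteDimensional F H] [Ring A] [Algebra F A] {a : H →ₐ[F] A} {b : DualHopf F H →ₐ[F] A}

theorem sum_left_smul_right {ι : Type*} {α : DualHopf F H} (q : Repr F α ι) (x : H) :
    ∑ i ∈ q.index, q.left i x • q.right i = rightRegular F H α x :=
  dual_ext fun k => by
    rw [ofConv_sum, LinearMap.sum_apply]
    exact sum_repr_dual q x k

theorem sum_right_smul_left {ι : Type*} {α : DualHopf F H} (q : Repr F α ι) (x : H) :
    ∑ i ∈ q.index, q.right i x • q.left i = leftRegular α x :=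
  dual_ext fun k => by
    rw [ofConv_sum, LinearMap.sum_apply]
    refine Eq.trans ?_ (sum_repr_dual q k x)
    exact Finset.sum_congr rfl fun i _ => mul_comm _ _

/-- The relation `b(α) a(x) = a(x₍₁₎) b(α ◁ x₍₂₎)` in terms of the canonical element. -/
theorem dualElt_mul_primalElt
    (h : ∀ (α : DualHopf F H) (x : H), b α * a x = ∑ i ∈ (Repr.arbitrary F x).index,
      a ((Repr.arbitrary F x).left i) * b (rightRegular F H α ((Repr.arbitrary F x).right i))) :
    dualElt (homConv b) * primalElt (homConv a) =
      primalElt (homConv a) * canonicalElt F H A * dualElt (homConv b) := by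
  refine WithConv.ext (LinearMap.ext fun x => WithConv.ext (LinearMap.ext fun α => ?_))
  let r := Repr.arbitrary F x
  let q := Repr.arbitrary F α
  have h1 : ∀ y, (embPrimal F H A y * homConv b) α = b (rightRegular F H α y) := by
    intro y
    rw [q.convMul_apply, ← sum_left_smul_right q, map_sum]
    simp only [embPrimal_apply, smul_one_mul, map_smul]
    rfl
  rw [constConv_mul_apply, mapConv_apply, mul_embConst_apply, mul_assoc, r.convMul_apply]
  simp only [mapConv_apply, mul_constConv_apply, ofConv_sum, LinearMap.sum_apply,
    embConst_mul_apply]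
  refine (h α x).trans (Finset.sum_congr rfl fun i _ => ?_)
  exact congrArg _ (h1 _).symm

/-- The relation `b(x₍₁₎ ▷ α) a(x₍₂₎) = a(x) b(α)` in terms of the canonical element. -/
theorem dualElt_mul_canonicalElt_mul_primalElt
    (h : ∀ (α : DualHopf F H) (x : H), ∑ i ∈ (Repr.arbitrary F x).index,
      b (leftRegular α ((Repr.arbitrary F x).left i)) * a ((Repr.arbitrary F x).right i) =
        a x * b α) :
    dualElt (homConv b) * canonicalElt F H A * primalElt (homConv a) =
      primalElt (homConv a) * dualElt (homConv b) := by
  refine WithConv.ext (LinearMap.ext fun x => WithConv.ext (LinearMap.ext fun α => ?_))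
  let r := Repr.arbitrary F x
  let q := Repr.arbitrary F α
  have h1 : ∀ y, (homConv b * embPrimal F H A y) α = b (leftRegular α y) := by
    intro y
    rw [q.convMul_apply, ← sum_right_smul_left q, map_sum]
    simp only [embPrimal_apply, mul_smul_one, map_smul]
    rfl
  rw [mul_constConv_apply, mapConv_apply, embConst_mul_apply, r.convMul_apply]
  simp only [mapConv_apply, constConv_mul_apply, ofConv_sum, LinearMap.sum_apply,
    mul_embConst_apply]
  refine Eq.trans (Finset.sum_congr rfl fun i _ => ?_) (h α x)
  exact congrArg (· * _) (h1 _)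

end Relations

/-! ### Faces and cilia -/

theorem rev_rev {E : Type*} (a : E × Bool) : rev (rev a) = a := by
  simp [rev]

theorem rev_injective {E : Type*} : Function.Injective (rev : E × Bool → E × Bool) :=
  Function.LeftInverse.injective rev_rev

/-- In a list without duplicates, the cyclic successor of an entry stands directly after it, or
the entry is the last one and its successor the first one. -/
theorem next_cases {α : Type*} [DecidableEq α] {l : List α} (hl : l.Nodup) {a : α} (ha : a ∈ l) :
    (l.head? ≠ some (l.next a ha) ∧ ∃ p q, l = p ++ a :: l.next a ha :: q) ∨
      (l.head? = some (l.next a ha) ∧ ∃ p, l = p ++ [a]) := by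
  obtain ⟨i, hi, rfl⟩ := List.getElem_of_mem ha
  rw [List.next_getElem l hl i hi]
  by_cases h : i + 1 < l.length
  · left
    have hm : (i + 1) % l.length = i + 1 := Nat.mod_eq_of_lt h
    simp only [hm]
    constructor
    · rw [List.head?_eq_getElem?, List.getElem?_eq_getElem (by omega)]
      intro h0
      have := (hl.getElem_inj_iff).1 (Option.some.inj h0)
      omega
    · exact ⟨l.take i, l.drop (i + 1 + 1), by simp⟩
  · right
    have hm : (i + 1) % l.length = 0 := by
      rw [show i + 1 = l.length by omega, Nat.mod_self]
    simp only [hm]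
    constructor
    · rw [List.head?_eq_getElem?, List.getElem?_eq_getElem (by omega)]
    · refine ⟨l.take i, ?_⟩
      have : l.drop (i + 1) = [] := List.drop_eq_nil_of_le (by omega)
      rw [← this]
      simp

namespace CiliatedRibbonGraph

variable {V E : Type*} [DecidableEq E] (Γ : CiliatedRibbonGraph V E)

theorem mem_ends_iff {v : V} {a : E × Bool} : a ∈ Γ.ends v ↔ Γ.tgt a = v := Γ.mem_ends v a.1 a.2

theorem isChain_iterate {α : Type*} (f : α → α) (l : List α) (a : α)
    (h : List.IsChain (fun x y => y = f x) (a :: l)) :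
    a :: l = (List.range (l.length + 1)).map fun n => f^[n] a := by
  induction l generalizing a with
  | nil => simp
  | cons b l ih =>
    rw [List.isChain_cons_cons] at h
    rw [List.length_cons, List.range_succ_eq_map, List.map_cons, List.map_map, ih b h.2, h.1]
    rfl

/-- A ciliated face is determined by its first edge. -/
theorem eq_rightPath {l : List (E × Bool)} (hl : Γ.IsCiliatedFace l) {a : E × Bool}
    (p : List (E × Bool)) (hp : l = p ++ [a]) : l = (Γ.rightPath a).reverse := by
  obtain ⟨-, hnd, hch⟩ := hl
  have hnd' : l.Nodup := hnd
  have h1 : (l.reverse : Cycle (E × Bool)).Chain fun x y => y = Γ.rightTurn x := by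
    rw [chain_reverse]
    exact hch
  have h2 : l.reverse = a :: p.reverse := by simp [hp]
  rw [h2, Cycle.chain_coe_cons] at h1
  have h3 := isChain_iterate _ _ _ h1
  rw [List.length_append, List.length_singleton, List.range_succ, List.map_append,
    ← List.cons_append] at h3
  obtain ⟨h4, h5⟩ := List.append_inj' h3 rfl
  have h6 : a = Γ.rightTurn^[p.reverse.length + 1] a := by simpa using h5
  have hper : Function.minimalPeriod Γ.rightTurn a = p.reverse.length + 1 := by
    refine le_antisymm (Function.IsPeriodicPt.minimalPeriod_le (Nat.succ_pos _) h6.symm) ?_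
    by_contra! hlt
    have h7 : (a :: p.reverse).Nodup := by
      rw [← h2]
      exact List.nodup_reverse.2 hnd'
    have hpos := Function.IsPeriodicPt.minimalPeriod_pos (Nat.succ_pos _) h6.symm
    rw [h4] at h7
    have h8 := List.inj_on_of_nodup_map h7 (List.mem_range.2 hlt)
      (List.mem_range.2 (Nat.succ_pos _)) (Function.iterate_minimalPeriod (f := Γ.rightTurn))
    omega
  rw [rightPath, hper, ← h4, ← h2, List.reverse_reverse]

/-- A face is determined by any oriented edge on it. -/
theorem face_eq_rightPath {c : Cycle (E × Bool)} (hc : Γ.IsFace c) {a : E × Bool} (ha : a ∈ c) :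
    c = ((Γ.rightPath a).reverse : List (E × Bool)) := by
  induction c using Quotient.inductionOn with
  | h l =>
  have ha' : a ∈ l := ha
  obtain ⟨p, q, rfl⟩ := List.append_of_mem ha'
  have h1 : ((p ++ a :: q : List (E × Bool)) : Cycle (E × Bool)) =
      ((q ++ p ++ [a] : List (E × Bool)) : Cycle (E × Bool)) := by
    rw [Cycle.coe_eq_coe]
    have := List.isRotated_append (l := p ++ [a]) (l' := q)
    simpa using this
  change ((p ++ a :: q : List (E × Bool)) : Cycle (E × Bool)) = _
  have h2 : Γ.IsCiliatedFace (q ++ p ++ [a]) := by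
    unfold IsCiliatedFace
    rw [← h1]
    exact hc
  rw [h1]
  exact congrArg _ (Γ.eq_rightPath h2 (q ++ p) rfl)

theorem siteFace_eq {v : V} {d : E × Bool} (h : (Γ.ends v).head? = some d) :
    Γ.siteFace v = (Γ.rightPath (rev d)).reverse := by
  simp [siteFace, h]

theorem siteFace_of_ends_eq_nil {v : V} (h : Γ.ends v = []) : Γ.siteFace v = [] := by
  simp [siteFace, h]

variable [Finite E]

theorem siteFace_eq_append {v : V} {d : E × Bool} (h : (Γ.ends v).head? = some d) :
    ∃ p, Γ.siteFace v = p ++ [rev d] := by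
  have hx : rev d ∈ Function.periodicPts Γ.rightTurn :=
    Γ.rightTurn_injective.mem_periodicPts _
  have hpos := Function.minimalPeriod_pos_of_mem_periodicPts hx
  rw [siteFace_eq Γ h, rightPath]
  obtain ⟨n, hn⟩ := Nat.exists_eq_succ_of_ne_zero hpos.ne'
  rw [hn, List.range_succ_eq_map, List.map_cons, List.reverse_cons]
  exact ⟨_, rfl⟩

theorem rev_mem_siteFace {v : V} {d : E × Bool} (h : (Γ.ends v).head? = some d) :
    rev d ∈ Γ.siteFace v := by
  obtain ⟨p, hp⟩ := Γ.siteFace_eq_append h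
  simp [hp]

theorem tgt_of_head? {v : V} {d : E × Bool} (h : (Γ.ends v).head? = some d) : Γ.tgt d = v :=
  Γ.mem_ends_iff.1 (List.mem_of_head? h)

theorem startsAtCilium_rev {v : V} {d : E × Bool} (h : (Γ.ends v).head? = some d) :
    Γ.StartsAtCilium (rev d) := by
  rw [StartsAtCilium, src, rev_rev, Γ.tgt_of_head? h, h]

theorem head?_of_mem_siteFace {v : V} {a : E × Bool} (ha : a ∈ Γ.siteFace v) :
    ∃ d, (Γ.ends v).head? = some d := by
  cases h : (Γ.ends v).head? with
  | none => simp [siteFace, h] at ha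
  | some d => exact ⟨d, rfl⟩

theorem isCiliatedFace_of_head? {v : V} {d : E × Bool} (h : (Γ.ends v).head? = some d) :
    Γ.IsCiliatedFace (Γ.siteFace v) :=
  Γ.isCiliatedFace_siteFace v fun h0 => by simp [h0] at h

theorem nodup_siteFace (v : V) : (Γ.siteFace v).Nodup := by
  cases h : (Γ.ends v).head? with
  | none => simp [siteFace, h]
  | some d => exact (Γ.isCiliatedFace_of_head? h).2.1

variable {Γ} (hΓ : Γ.IsRegular)
include hΓ

theorem IsRegular.nodup_fst_ends (v : V) : ((Γ.ends v).map Prod.fst).Nodup := by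
  refine List.Nodup.map_on ?_ (Γ.nodup_ends v)
  rintro ⟨e, s⟩ hs ⟨e', t⟩ ht rfl
  rw [mem_ends_iff] at hs ht
  have := hΓ.no_loops e
  cases s <;> cases t <;> simp_all [tgt]

theorem IsRegular.nodup_fst_siteFace (v : V) : ((Γ.siteFace v).map Prod.fst).Nodup := by
  refine List.Nodup.map_on ?_ (Γ.nodup_siteFace v)
  rintro ⟨e, s⟩ hs ⟨e', t⟩ ht rfl
  obtain ⟨d, hd⟩ := Γ.head?_of_mem_siteFace hs
  have := hΓ.edge_at_most_once ⟨_, Γ.isCiliatedFace_of_head? hd⟩ e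
  cases s <;> cases t <;> simp_all

/-- Distinct sites have disjoint faces. -/
theorem IsRegular.eq_of_mem_siteFace {v w : V} {a : E × Bool} (hv : a ∈ Γ.siteFace v)
    (hw : a ∈ Γ.siteFace w) : v = w := by
  obtain ⟨d, hd⟩ := Γ.head?_of_mem_siteFace hv
  obtain ⟨d', hd'⟩ := Γ.head?_of_mem_siteFace hw
  have h1 := Γ.face_eq_rightPath (Γ.isCiliatedFace_of_head? hd) (Cycle.mem_coe_iff.2 hv)
  have h2 := Γ.face_eq_rightPath (Γ.isCiliatedFace_of_head? hd') (Cycle.mem_coe_iff.2 hw)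
  have h3 : rev d' ∈ (Γ.siteFace v : Cycle (E × Bool)) := by
    rw [h1, ← h2]
    exact Cycle.mem_coe_iff.2 (Γ.rev_mem_siteFace hd')
  obtain ⟨x, -, hx⟩ := hΓ.one_cilium ⟨_, Γ.isCiliatedFace_of_head? hd⟩
  have h4 := hx (rev d) ⟨Cycle.mem_coe_iff.2 (Γ.rev_mem_siteFace hd), Γ.startsAtCilium_rev hd⟩
  have h5 := hx (rev d') ⟨h3, Γ.startsAtCilium_rev hd'⟩
  have h6 : d = d' := rev_injective (h4.trans h5.symm)
  rw [← Γ.tgt_of_head? hd, ← Γ.tgt_of_head? hd', h6]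

/-- Every face is the face of a site. -/
theorem IsRegular.exists_siteFace (f : Γ.Face) :
    ∃ v, Γ.ends v ≠ [] ∧ (Γ.siteFace v : Cycle (E × Bool)) = f.1 := by
  obtain ⟨a, ⟨ha, hs⟩, -⟩ := hΓ.one_cilium f
  refine ⟨Γ.src a, fun h => ?_, ?_⟩
  · rw [StartsAtCilium, h] at hs
    simp at hs
  · rw [Γ.face_eq_rightPath f.2 ha, Γ.siteFace_eq hs, rev_rev]

/-- The path `f(v)` does not pass a cilium except at its start. -/
theorem IsRegular.isChain_siteFace {v : V} {p : List (E × Bool)} {b : E × Bool}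
    (hp : Γ.siteFace v = p ++ [b]) (hd : (Γ.ends v).head? = some (rev b)) :
    List.IsChain (fun x y => x = Γ.rightTurn y ∧ ¬ Γ.StartsAtCilium x) (Γ.siteFace v) ∧
      ∀ a, (Γ.siteFace v).head? = some a → b = Γ.rightTurn a := by
  have hf := Γ.isCiliatedFace_of_head? hd
  have hne : Γ.siteFace v ≠ [] := by simp [hp]
  have hch := (Cycle.chain_ne_nil _ hne).1 hf.2.2
  have hlast : (Γ.siteFace v).getLast hne = b := by simp [hp]
  rw [hlast] at hch
  constructor
  · -- by regularity, the only letter that starts at a cilium is the last one, `b`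
    have hb : ∀ x ∈ p, ¬ Γ.StartsAtCilium x := by
      intro x hx hs
      obtain ⟨y, -, hy⟩ := hΓ.one_cilium ⟨_, hf⟩
      have h1 : x = y := hy x ⟨Cycle.mem_coe_iff.2 (by rw [hp]; simp [hx]), hs⟩
      have h2 : b = y := hy b ⟨Cycle.mem_coe_iff.2 (by rw [hp]; simp),
        by have := Γ.startsAtCilium_rev hd; rwa [rev_rev] at this⟩
      have h3 := Γ.nodup_siteFace v
      rw [hp, List.nodup_append] at h3
      exact h3.2.2 x hx b (by simp) (h1.trans h2.symm)
    have h1 := hch.tail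
    rw [List.tail_cons, hp] at h1
    rw [hp]
    clear hch hlast hp hf hne
    induction p with
    | nil => simp
    | cons x p ih =>
      rw [List.cons_append] at h1 ⊢
      have h2 := ih (fun y hy => hb y (List.mem_cons_of_mem _ hy)) h1.tail
      rcases p with _ | ⟨y, p⟩
      · simp only [List.nil_append, List.isChain_cons_cons] at h1 ⊢
        exact ⟨⟨h1.1, hb x (by simp)⟩, List.isChain_singleton _⟩
      · simp only [List.cons_append, List.isChain_cons_cons] at h1 h2 ⊢
        exact ⟨⟨h1.1, hb x (by simp)⟩, h2⟩
  · intro a ha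
    obtain ⟨q, hq⟩ : ∃ q, Γ.siteFace v = a :: q := by
      cases h : Γ.siteFace v with
      | nil => exact absurd h hne
      | cons x q => rw [h] at ha; exact ⟨q, by rw [Option.some.inj ha]⟩
    rw [hq, List.isChain_cons_cons] at hch
    exact hch.1

end CiliatedRibbonGraph

/-! ### Moving a vertex operator past a face path -/

section Path

variable {V E R : Type*} [DecidableEq E] [Ring R] (Γ : CiliatedRibbonGraph V E)
  (T L : E × Bool → R) (J : R)

/-- The product of the factors `L d` for the edge ends `d ∈ D`, with `J` inserted after the factor
of the edge end `a`. -/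
def insertAfter (D : List (E × Bool)) (a : E × Bool) : R :=
  (D.map fun d => L d * if d = a then J else 1).prod

/-- The product of the factors `L d` for the edge ends `d ∈ D`, with `J` inserted before the factor
of the edge end `b`. -/
def insertBefore (D : List (E × Bool)) (b : E × Bool) : R :=
  (D.map fun d => (if d = b then J else 1) * L d).prod

theorem insertAfter_of_notMem {D : List (E × Bool)} {a : E × Bool} (h : a ∉ D) :
    insertAfter L J D a = (D.map L).prod := by
  rw [insertAfter]
  congr 1
  refine List.map_congr_left fun d hd => ?_
  have hne : d ≠ a := fun h0 => h (h0 ▸ hd)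
  simp [hne]

theorem insertBefore_of_notMem {D : List (E × Bool)} {a : E × Bool} (h : a ∉ D) :
    insertBefore L J D a = (D.map L).prod := by
  rw [insertBefore]
  congr 1
  refine List.map_congr_left fun d hd => ?_
  have hne : d ≠ a := fun h0 => h (h0 ▸ hd)
  simp [hne]

theorem insertAfter_append (D D' : List (E × Bool)) (a : E × Bool) :
    insertAfter L J (D ++ D') a = insertAfter L J D a * insertAfter L J D' a := by
  simp [insertAfter]

theorem insertBefore_append (D D' : List (E × Bool)) (a : E × Bool) :
    insertBefore L J (D ++ D') a = insertBefore L J D a * insertBefore L J D' a := by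
  simp [insertBefore]

theorem insertAfter_eq_insertBefore {p q : List (E × Bool)} {a b : E × Bool}
    (h : (p ++ a :: b :: q).Nodup) :
    insertAfter L J (p ++ a :: b :: q) a = insertBefore L J (p ++ a :: b :: q) b := by
  have h1 : (p ++ [a] ++ b :: q).Nodup := by simpa using h
  have h2 : b ∉ p ++ [a] := fun hb => (List.nodup_append.1 h1).2.2 b hb b (by simp) rfl
  have h3 : a ∉ b :: q := fun ha => (List.nodup_append.1 h1).2.2 a (by simp) a ha rfl
  have h4 : a ∉ p := fun ha => (List.nodup_append.1 h).2.2 a ha a (by simp) rfl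
  have h5 : b ∉ q := (List.nodup_cons.1 (List.nodup_append.1 h1).2.1).1
  rw [show p ++ a :: b :: q = (p ++ [a]) ++ b :: q by simp, insertAfter_append,
    insertBefore_append, insertAfter_of_notMem L J h3, insertBefore_of_notMem L J h2,
    insertAfter_append, insertAfter_of_notMem L J h4,
    show b :: q = [b] ++ q from rfl, insertBefore_append, insertBefore_of_notMem L J h5]
  simp [insertAfter, insertBefore, mul_assoc]

variable (h₁ : ∀ d, T d * L d = L d * J * T d)
  (h₂ : ∀ d, T d * J * L (rev d) = L (rev d) * T d)
  (h₃ : ∀ d d', d.1 ≠ d'.1 → Commute (T d) (L d'))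
include h₁ h₂ h₃

/-- A single oriented edge `c` takes `J` from the front of its starting end to the back of its
target end. -/
theorem mul_insertBefore (D : List (E × Bool)) (c : E × Bool) :
    T c * insertBefore L J D (rev c) = insertAfter L J D c * T c := by
  induction D with
  | nil => simp [insertBefore, insertAfter]
  | cons d D ih =>
    have h : T c * ((if d = rev c then J else 1) * L d) = (L d * if d = c then J else 1) * T c := by
      have hne : rev c ≠ c := fun h => by
        have := congrArg Prod.snd h
        simp [rev] at this
      by_cases hd : d = rev c
      · subst hd
        rw [if_pos rfl, if_neg hne, ← mul_assoc, h₂, mul_one]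
      · by_cases hd' : d = c
        · subst hd'
          rw [if_neg hd, if_pos rfl, one_mul, h₁]
        · rw [if_neg hd, if_neg hd', one_mul, mul_one]
          refine h₃ c d fun h0 => ?_
          obtain ⟨e, s⟩ := c
          obtain ⟨e', t⟩ := d
          obtain rfl : e = e' := h0
          cases s <;> cases t <;> simp_all [rev]
    change T c * (((if d = rev c then J else 1) * L d) * insertBefore L J D (rev c)) =
      ((L d * if d = c then J else 1) * insertAfter L J D c) * T c
    rw [← mul_assoc, h, mul_assoc, ih]
    simp only [mul_assoc]

/-- At each vertex that a face path passes away from the cilium, the end on which it leaves comes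
directly after the end on which it arrives. Thus the insertions of `J` for consecutive edges of the
path match, and only those for the first and last edge remain. -/
theorem path_mul_insertBefore (u : V) (f : List (E × Bool)) {b : E × Bool}
    (hf : List.IsChain (fun x y => x = Γ.rightTurn y ∧ ¬ Γ.StartsAtCilium x) (f ++ [b]))
    {a : E × Bool} (ha : (f ++ [b]).head? = some a) :
    ((f ++ [b]).map T).prod * insertBefore L J (Γ.ends u) (rev b) =
      insertAfter L J (Γ.ends u) a * ((f ++ [b]).map T).prod := by
  induction f generalizing a with
  | nil =>
    obtain rfl : b = a := by simpa using ha
    simpa using mul_insertBefore T L J h₁ h₂ h₃ (Γ.ends u) b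
  | cons c f ih =>
    obtain rfl : c = a := by simpa using ha
    obtain ⟨c', g, hg⟩ : ∃ c' g, f ++ [b] = c' :: g := by
      cases h : f ++ [b] with
      | nil => simp at h
      | cons c' g => exact ⟨c', g, rfl⟩
    have h4 := ih hf.tail (a := c') (by rw [hg]; rfl)
    rw [List.cons_append] at hf ⊢
    rw [hg, List.isChain_cons_cons] at hf
    obtain ⟨⟨hc, hs⟩, -⟩ := hf
    have key : insertAfter L J (Γ.ends u) c' = insertBefore L J (Γ.ends u) (rev c) := by
      have hrc : rev c = (Γ.ends (Γ.tgt c')).next c' (Γ.mem_ends_tgt c') := by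
        rw [hc, CiliatedRibbonGraph.rightTurn, rev_rev]
      have htgt : Γ.tgt (rev c) = Γ.tgt c' := by
        rw [← Γ.mem_ends_iff, hrc]
        exact List.next_mem _ _ _
      by_cases hu : Γ.tgt c' = u
      · subst hu
        rcases next_cases (Γ.nodup_ends _) (Γ.mem_ends_tgt c') with ⟨-, p, q, h⟩ | ⟨h, -⟩
        · rw [← hrc] at h
          have h5 := Γ.nodup_ends (Γ.tgt c')
          rw [h] at h5 ⊢
          exact insertAfter_eq_insertBefore L J h5
        · rw [← hrc, ← htgt] at h
          exact absurd h hs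
      · rw [insertAfter_of_notMem, insertBefore_of_notMem]
        · rw [Γ.mem_ends_iff, htgt]; exact hu
        · rw [Γ.mem_ends_iff]; exact hu
    rw [List.map_cons, List.prod_cons, mul_assoc, h4, ← mul_assoc, key,
      mul_insertBefore T L J h₁ h₂ h₃, mul_assoc]

variable [Finite E] {Γ} (hΓ : Γ.IsRegular)
include hΓ

/-- A face path through the cilium at `v` passes the vertex operator at `v` up to moving `J` from
the front to the back. -/
theorem siteFace_mul_ends (v : V) :
    ((Γ.siteFace v).map T).prod * J * ((Γ.ends v).map L).prod =
      ((Γ.ends v).map L).prod * J * ((Γ.siteFace v).map T).prod := by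
  cases hd : (Γ.ends v).head? with
  | none =>
    have h : Γ.ends v = [] := by simpa using hd
    rw [Γ.siteFace_of_ends_eq_nil h, h]
    simp
  | some d =>
    obtain ⟨p, hp⟩ := Γ.siteFace_eq_append hd
    obtain ⟨hch, hhead⟩ := hΓ.isChain_siteFace hp (by rw [rev_rev]; exact hd)
    obtain ⟨a, ha⟩ : ∃ a, (p ++ [rev d]).head? = some a := by
      cases p with
      | nil => exact ⟨_, rfl⟩
      | cons x p => exact ⟨_, rfl⟩
    rw [hp] at hch hhead
    have h4 := path_mul_insertBefore Γ T L J h₁ h₂ h₃ v p hch ha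
    rw [← hp, rev_rev] at h4
    have hra := hhead a ha
    have hda : d = (Γ.ends (Γ.tgt a)).next a (Γ.mem_ends_tgt a) := by
      rw [← rev_rev d, hra, CiliatedRibbonGraph.rightTurn, rev_rev]
    have hta : Γ.tgt a = v := by
      rw [← Γ.tgt_of_head? hd, ← Γ.mem_ends_iff.1 (List.next_mem _ _ (Γ.mem_ends_tgt a)), ← hda]
    -- the face arrives at `v` through the last edge end and leaves through the first one
    have hbefore : insertBefore L J (Γ.ends v) d = J * ((Γ.ends v).map L).prod := by
      obtain ⟨q, hq⟩ : ∃ q, Γ.ends v = d :: q := by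
        cases h : Γ.ends v with
        | nil => simp [h] at hd
        | cons x q => rw [h] at hd; exact ⟨q, by rw [Option.some.inj hd]⟩
      have hnd := Γ.nodup_ends v
      rw [hq] at hnd ⊢
      rw [show d :: q = [d] ++ q from rfl, insertBefore_append,
        insertBefore_of_notMem L J (List.nodup_cons.1 hnd).1]
      simp [insertBefore, mul_assoc]
    have hafter : insertAfter L J (Γ.ends v) a = ((Γ.ends v).map L).prod * J := by
      have hlast : ∃ q, Γ.ends v = q ++ [a] := by
        subst hta
        rcases next_cases (Γ.nodup_ends _) (Γ.mem_ends_tgt a) with ⟨h, -⟩ | ⟨-, h⟩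
        · rw [← hda] at h
          exact absurd hd h
        · exact h
      obtain ⟨q, hq⟩ := hlast
      have hnd := Γ.nodup_ends v
      rw [hq] at hnd ⊢
      rw [insertAfter_append, insertAfter_of_notMem L J
        fun h => (List.nodup_append.1 hnd).2.2 a h a (by simp) rfl]
      simp [insertAfter, mul_assoc]
    rw [hbefore, hafter] at h4
    rw [mul_assoc, h4]

/-- A face path which does not pass the cilium at `u` commutes with the vertex operator at `u`. -/
theorem siteFace_commute_ends {u v : V} (huv : u ≠ v) :
    Commute ((Γ.siteFace v).map T).prod ((Γ.ends u).map L).prod := by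
  cases hd : (Γ.ends v).head? with
  | none =>
    have h : Γ.ends v = [] := by simpa using hd
    rw [Γ.siteFace_of_ends_eq_nil h]
    simp
  | some d =>
    obtain ⟨p, hp⟩ := Γ.siteFace_eq_append hd
    obtain ⟨hch, hhead⟩ := hΓ.isChain_siteFace hp (by rw [rev_rev]; exact hd)
    obtain ⟨a, ha⟩ : ∃ a, (p ++ [rev d]).head? = some a := by
      cases p with
      | nil => exact ⟨_, rfl⟩
      | cons x p => exact ⟨_, rfl⟩
    rw [hp] at hch hhead
    have h4 := path_mul_insertBefore Γ T L J h₁ h₂ h₃ u p hch ha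
    rw [← hp, rev_rev] at h4
    have hra := hhead a ha
    have hda : d = (Γ.ends (Γ.tgt a)).next a (Γ.mem_ends_tgt a) := by
      rw [← rev_rev d, hra, CiliatedRibbonGraph.rightTurn, rev_rev]
    have hta : Γ.tgt a = v := by
      rw [← Γ.tgt_of_head? hd, ← Γ.mem_ends_iff.1 (List.next_mem _ _ (Γ.mem_ends_tgt a)), ← hda]
    rw [insertBefore_of_notMem, insertAfter_of_notMem] at h4
    · exact h4
    · rw [Γ.mem_ends_iff, hta]; exact huv.symm
    · rw [Γ.mem_ends_iff, Γ.tgt_of_head? hd]; exact huv.symm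

end Path

/-! ### Convolution products of maps with commuting values -/

section ConvProducts

variable {F C A : Type*} [Field F] [Ring C] [HopfAlgebra F C] [Ring A] [Algebra F A]

theorem commute_list_prod_apply {l : List (WithConv (C →ₗ[F] A))} {X : A}
    (h : ∀ f ∈ l, ∀ c, Commute X (f c)) (c : C) : Commute X (l.prod c) :=
  commute_of_commute_constConv
    (Commute.list_prod_right _ _ fun f hf => commute_constConv (h f hf)) c

/-- The convolution product of algebra homomorphisms with pairwise commuting images is an algebra
homomorphism. -/
theorem exists_homConv_eq_prod {ι : Type*} (g : ι → C →ₐ[F] A) (l : List ι)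
    (hl : l.Pairwise fun i j => ∀ c d, Commute (g i c) (g j d)) :
    ∃ f : C →ₐ[F] A, homConv f = (l.map fun i => homConv (g i)).prod := by
  induction l with
  | nil => exact ⟨(Algebra.ofId F A).comp (Bialgebra.counitAlgHom F C), rfl⟩
  | cons i l ih =>
    rw [List.pairwise_cons] at hl
    obtain ⟨f, hf⟩ := ih hl.2
    have hc : ∀ c d, Commute (g i c) (f d) := fun c d => by
      have h1 := commute_list_prod_apply (l := l.map fun i => homConv (g i)) (X := g i c)
        (fun f hf => by
          obtain ⟨j, hj, rfl⟩ := List.mem_map.1 hf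
          exact hl.1 j hj c) d
      rw [← hf] at h1
      exact h1
    exact ⟨convHom (g i) f hc, by rw [convHom_toLinearMap, hf, List.map_cons, List.prod_cons]⟩

/-- On a cocommutative element, convolution products of maps with commuting values are invariant
under cyclic permutations of the factors. -/
theorem iteratedConv_apply_of_isRotated {l l' : List (C →ₗ[F] A)} {c : C}
    (hc : TensorProduct.comm F C C (comul (R := F) c) = comul (R := F) c)
    (hl : l.Pairwise fun f g => ∀ x y, Commute (f x) (g y)) (h : l.IsRotated l') :
    iteratedConv comul counit l c = iteratedConv comul counit l' c := by
  obtain ⟨n, rfl⟩ := h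
  change (toConv (iteratedConv comul counit l) : WithConv (C →ₗ[F] A)) c =
    (toConv (iteratedConv comul counit (l.rotate n)) : WithConv (C →ₗ[F] A)) c
  rw [toConv_iteratedConv, toConv_iteratedConv, List.rotate_eq_drop_append_take_mod]
  nth_rewrite 1 [← List.take_append_drop (n % l.length) l]
  rw [← List.take_append_drop (n % l.length) l, List.pairwise_append] at hl
  rw [List.map_append, List.map_append, List.prod_append, List.prod_append]
  refine convMul_comm_apply hc fun x y => commute_list_prod_apply (fun g hg y => ?_) y
  refine (commute_list_prod_apply (fun f hf x => ?_) x).symm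
  obtain ⟨f', hf', rfl⟩ := List.mem_map.1 hf
  obtain ⟨g', hg', rfl⟩ := List.mem_map.1 hg
  exact (hl.2.2 f' hf' g' hg' x y).symm

end ConvProducts

/-! ### Vertex and face algebras of a regular graph -/

section SiteHoms

variable {F H V E A : Type*} [Field F] [Ring H] [HopfAlgebra F H]
  [FiniteDimensional F H] [Ring A] [Algebra F A]

/-- The homomorphism `h ↦ L^{S^τ(h)}_{e ε}` at the oriented edge `e^ε`, transported to an algebra
`A` along representations `σ e : End(H) → A` for the edges `e`. -/
def edgeVertexHom (σ : E → Module.End F H →ₐ[F] A) (d : E × Bool) : H →ₐ[F] A :=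
  (σ d.1).comp (vertexHom F H d.2)

/-- The homomorphism `α ↦ T^{S^τ(α)}_{e ε}` at the oriented edge `e^ε`, transported to an algebra
`A` along representations `σ e : End(H) → A` for the edges `e`. -/
def edgeFaceHom (σ : E → Module.End F H →ₐ[F] A) (d : E × Bool) : DualHopf F H →ₐ[F] A :=
  (σ d.1).comp (faceHom F H d.2)

variable {σ : E → Module.End F H →ₐ[F] A}
  (hσ : ∀ e e', e ≠ e' → ∀ x y, Commute (σ e x) (σ e' y))
include hσ

theorem commute_edgeVertexHom {d d' : E × Bool} (hd : d ≠ d') (g h : H) :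
    Commute (edgeVertexHom σ d g) (edgeVertexHom σ d' h) := by
  obtain ⟨e, s⟩ := d
  obtain ⟨e', t⟩ := d'
  by_cases he : e = e'
  · subst he
    obtain rfl : t = !s := by cases s <;> cases t <;> simp_all
    exact (commute_vertexHom s g h).map (σ e)
  · exact hσ e e' he _ _

theorem commute_edgeFaceHom {d d' : E × Bool} (hd : d ≠ d') (α β : DualHopf F H) :
    Commute (edgeFaceHom σ d α) (edgeFaceHom σ d' β) := by
  obtain ⟨e, s⟩ := d
  obtain ⟨e', t⟩ := d'
  by_cases he : e = e'
  · subst he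
    obtain rfl : t = !s := by cases s <;> cases t <;> simp_all
    exact (commute_faceHom s α β).map (σ e)
  · exact hσ e e' he _ _

omit hσ in
theorem dualElt_edgeFaceHom_mul
    (hS : ∀ h : H, HopfAlgebra.antipode F (HopfAlgebra.antipode F h) = h) (d : E × Bool) :
    dualElt (homConv (edgeFaceHom σ d)) * primalElt (homConv (edgeVertexHom σ d)) =
      primalElt (homConv (edgeVertexHom σ d)) * canonicalElt F H A *
        dualElt (homConv (edgeFaceHom σ d)) :=
  dualElt_mul_primalElt fun α x => by
    have := congrArg (σ d.1) (faceHom_mul_vertexHom hS d.2 (Repr.arbitrary F x) α)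
    simp only [map_mul, map_sum] at this
    exact this

omit hσ in
theorem dualElt_edgeFaceHom_mul_rev
    (hS : ∀ h : H, HopfAlgebra.antipode F (HopfAlgebra.antipode F h) = h) (d : E × Bool) :
    dualElt (homConv (edgeFaceHom σ d)) * canonicalElt F H A *
        primalElt (homConv (edgeVertexHom σ (rev d))) =
      primalElt (homConv (edgeVertexHom σ (rev d))) * dualElt (homConv (edgeFaceHom σ d)) :=
  dualElt_mul_canonicalElt_mul_primalElt fun α x => by
    have := congrArg (σ d.1) (vertexHom_mul_faceHom hS d.2 (Repr.arbitrary F x) α)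
    simp only [map_mul, map_sum] at this
    exact this

theorem commute_dualElt_primalElt {d d' : E × Bool} (hd : d.1 ≠ d'.1) :
    Commute (dualElt (homConv (edgeFaceHom σ d))) (primalElt (homConv (edgeVertexHom σ d'))) :=
  commute_constConv fun _ => (commute_constConv fun _ => hσ _ _ hd.symm _ _).symm

/-- In a regular graph, the vertex and face operators at each site form a representation of the
Drinfeld double, and those at different sites commute. -/
theorem exists_siteHoms [DecidableEq E] [Finite E] {Γ : CiliatedRibbonGraph V E} (hΓ : Γ.IsRegular)
    (hS : ∀ h : H, HopfAlgebra.antipode F (HopfAlgebra.antipode F h) = h) :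
    ∃ (a : V → H →ₐ[F] A) (b : V → DualHopf F H →ₐ[F] A),
      (∀ v, (a v).toLinearMap =
        iteratedConv comul counit ((Γ.ends v).map fun d => (edgeVertexHom σ d).toLinearMap)) ∧
      (∀ v, (b v).toLinearMap = iteratedConv (dualComul F H) (dualCounit F H)
        ((Γ.siteFace v).map fun d => (edgeFaceHom σ d).toLinearMap)) ∧
      (∀ v, IsDrinfeldPair (a v) (b v)) ∧
      ∀ u v, u ≠ v → (∀ g h, Commute (a u g) (a v h)) ∧ (∀ α β, Commute (b u α) (b v β)) ∧
        ∀ h α, Commute (a u h) (b v α) := by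
  have ha := fun v => exists_homConv_eq_prod (edgeVertexHom σ) (Γ.ends v)
    ((Γ.nodup_ends v).imp fun hd => commute_edgeVertexHom hσ hd)
  have hb := fun v => exists_homConv_eq_prod (edgeFaceHom σ) (Γ.siteFace v)
    ((Γ.nodup_siteFace v).imp fun hd => commute_edgeFaceHom hσ hd)
  choose a ha using ha
  choose b hb using hb
  have hL : ∀ v, primalElt (homConv (a v)) =
      ((Γ.ends v).map fun d => primalElt (homConv (edgeVertexHom σ d))).prod := fun v => by
    rw [ha, map_list_prod, List.map_map]; rfl
  have hT : ∀ v, dualElt (homConv (b v)) =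
      ((Γ.siteFace v).map fun d => dualElt (homConv (edgeFaceHom σ d))).prod := fun v => by
    rw [hb, map_list_prod, List.map_map]; rfl
  refine ⟨a, b, fun v => ?_, fun v => ?_, fun v => ?_, fun u v huv => ⟨fun g h => ?_,
    fun α β => ?_, fun h α => ?_⟩⟩
  · have := ha v
    rw [show (Γ.ends v).map (fun d => homConv (edgeVertexHom σ d)) =
      ((Γ.ends v).map fun d => (edgeVertexHom σ d).toLinearMap).map toConv by
        rw [List.map_map]; rfl, ← toConv_iteratedConv] at this
    exact congrArg WithConv.ofConv this
  · have := hb v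
    rw [show (Γ.siteFace v).map (fun d => homConv (edgeFaceHom σ d)) =
      ((Γ.siteFace v).map fun d => (edgeFaceHom σ d).toLinearMap).map toConv by
        rw [List.map_map]; rfl, ← toConv_iteratedConv] at this
    exact congrArg WithConv.ofConv this
  · rw [IsDrinfeldPair, hL, hT]
    exact siteFace_mul_ends _ _ _ (dualElt_edgeFaceHom_mul hS) (dualElt_edgeFaceHom_mul_rev hS)
      (fun d d' hd => commute_dualElt_primalElt hσ hd) hΓ v
  · have h1 : ∀ v' (X : A), (∀ d ∈ Γ.ends v', ∀ c, Commute X (edgeVertexHom σ d c)) →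
        ∀ c, Commute X (a v' c) := fun v' X hX c => by
      have := commute_list_prod_apply (l := (Γ.ends v').map fun d => homConv (edgeVertexHom σ d))
        (X := X) (fun f hf => by
          obtain ⟨d, hd, rfl⟩ := List.mem_map.1 hf
          exact hX d hd) c
      rwa [← ha] at this
    refine h1 v _ (fun d hd c =>
      (h1 u _ (fun d' hd' c' => commute_edgeVertexHom hσ ?_ _ _) g).symm) h
    rintro rfl
    rw [CiliatedRibbonGraph.mem_ends_iff] at hd hd'
    exact huv (hd'.symm.trans hd)
  · have h1 : ∀ v' (X : A), (∀ d ∈ Γ.siteFace v', ∀ c, Commute X (edgeFaceHom σ d c)) →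
        ∀ c, Commute X (b v' c) := fun v' X hX c => by
      have := commute_list_prod_apply (l := (Γ.siteFace v').map fun d => homConv (edgeFaceHom σ d))
        (X := X) (fun f hf => by
          obtain ⟨d, hd, rfl⟩ := List.mem_map.1 hf
          exact hX d hd) c
      rwa [← hb] at this
    refine h1 v _ (fun d hd c =>
      (h1 u _ (fun d' hd' c' => commute_edgeFaceHom hσ ?_ _ _) α).symm) β
    rintro rfl
    exact huv (hΓ.eq_of_mem_siteFace hd' hd)
  · have h1 := siteFace_commute_ends _ _ _ (dualElt_edgeFaceHom_mul (σ := σ) hS)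
      (dualElt_edgeFaceHom_mul_rev hS) (fun d d' hd => commute_dualElt_primalElt hσ hd) hΓ huv
    rw [← hL, ← hT] at h1
    have h2 := commute_of_commute_constConv h1 h
    exact commute_of_commute_constConv (f := homConv (b v)) h2.symm α

end SiteHoms

/-! ### The Heisenberg double acts faithfully and by all endomorphisms -/

section HeisenbergAction

variable {F H : Type*} [Field F] [Ring H] [HopfAlgebra F H] [FiniteDimensional F H]

local notation "S" => HopfAlgebra.antipode F (A := H)

theorem opConv_assoc {C A : Type*} [Ring C] [HopfAlgebra F C] [Ring A] [Algebra F A]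
    (P Q R : WithConv (C →ₗ[F] A)) : opConv (opConv P Q) R = opConv P (opConv Q R) := by
  refine WithConv.ext (LinearMap.ext fun c => ?_)
  let r := Repr.arbitrary F c
  let a₁ := fun j => Repr.arbitrary F (r.left j)
  let a₂ := fun j => Repr.arbitrary F (r.right j)
  let m : A ⊗[F] (A ⊗[F] A) →ₗ[F] A := LinearMap.mul' F A ∘ₗ
    (LinearMap.mul' F A).rTensor A ∘ₗ (TensorProduct.comm F A (A ⊗[F] A)).toLinearMap ∘ₗ
      (TensorProduct.comm F A A).toLinearMap.lTensor A
  have hm : ∀ x y z, m (x ⊗ₜ (y ⊗ₜ z)) = z * y * x := fun _ _ _ => rfl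
  have key := congrArg (m ∘ₗ TensorProduct.map R.ofConv (TensorProduct.map Q.ofConv P.ofConv))
    (Coalgebra.sum_tmul_tmul_eq r a₁ a₂)
  simp only [map_sum, LinearMap.comp_apply, TensorProduct.map_tmul, hm] at key
  rw [opConv_apply r, opConv_apply r]
  simp only [opConv_apply (a₁ _), opConv_apply (a₂ _), Finset.mul_sum, Finset.sum_mul]
  simp only [← mul_assoc]
  exact key.symm

theorem opConv_one {C A : Type*} [Ring C] [HopfAlgebra F C] [Ring A] [Algebra F A]
    (P : WithConv (C →ₗ[F] A)) : opConv P 1 = P := by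
  refine WithConv.ext (LinearMap.ext fun c => ?_)
  let r := Repr.arbitrary F c
  have h1 := congrArg P (sum_counit_smul r)
  rw [opConv_apply r]
  simp only [LinearMap.convOne_apply, Algebra.algebraMap_eq_smul_one, mul_smul_one]
  simpa using h1

theorem heisenbergAction_tmul (y : H) (α : DualHopf F H) :
    heisenbergAction F H (toHeisenberg F H (y ⊗ₜ α)) = Lpos F H y * Tpos F H α := rfl

variable (F H) in
/-- The map from `H ⊗ H*` to the endomorphisms of `H` that sends `y ⊗ α` to `h ↦ α(h) y`. -/
def tensorHom : H ⊗[F] DualHopf F H →ₗ[F] WithConv (H →ₗ[F] H) :=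
  (WithConv.linearEquiv F (H →ₗ[F] H)).symm.toLinearMap ∘ₗ dualTensorHom F H H ∘ₗ
    (TensorProduct.comm F H (Module.Dual F H)).toLinearMap ∘ₗ
      TensorProduct.map LinearMap.id (WithConv.linearEquiv F (H →ₗ[F] F)).toLinearMap

theorem tensorHom_tmul (y : H) (α : DualHopf F H) (h : H) :
    tensorHom F H (y ⊗ₜ α) h = α h • y := rfl

theorem heisenbergAction_eq_opConv (X : H ⊗[F] DualHopf F H) :
    heisenbergAction F H (toHeisenberg F H X) =
      (opConv (tensorHom F H X) (homConv (AlgHom.id F H))).ofConv := by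
  refine LinearMap.ext fun h => ?_
  let r := Repr.arbitrary F h
  change _ = opConv (tensorHom F H X) (homConv (AlgHom.id F H)) h
  rw [opConv_apply r]
  induction X with
  | zero => simp
  | add X Y hX hY =>
    simp only [map_add, LinearMap.add_apply, hX, hY, ofConv_add, add_mul, Finset.sum_add_distrib]
  | tmul y α =>
    rw [heisenbergAction_tmul, Module.End.mul_apply, Tpos_repr r]
    simp only [tensorHom_tmul, map_sum, map_smul, smul_mul_assoc]
    rfl

theorem tensorHom_injective : Function.Injective (tensorHom F H) := by
  have h1 : Function.Injective (dualTensorHom F H H) := (dualTensorHomEquiv F H H).injective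
  have h2 : Function.Injective (TensorProduct.map (LinearMap.id : H →ₗ[F] H)
      (WithConv.linearEquiv F (H →ₗ[F] F)).toLinearMap) :=
    (TensorProduct.congr (LinearEquiv.refl F H) (WithConv.linearEquiv F (H →ₗ[F] F))).injective
  exact (WithConv.linearEquiv F (H →ₗ[F] H)).symm.injective.comp
    (h1.comp ((TensorProduct.comm F H (Module.Dual F H)).injective.comp h2))

variable (hS : ∀ h : H, HopfAlgebra.antipode F (HopfAlgebra.antipode F h) = h)
include hS

theorem heisenbergAction_mul (x y : HeisenbergDouble F H) :
    heisenbergAction F H (x * y) = heisenbergAction F H x * heisenbergAction F H y := by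
  obtain ⟨x, rfl⟩ := (toHeisenberg F H).surjective x
  obtain ⟨y, rfl⟩ := (toHeisenberg F H).surjective y
  rw [toHeisenberg_mul]
  induction x with
  | zero => simp
  | add x x' hx hx' => simp only [map_add, LinearMap.add_apply, hx, hx', add_mul]
  | tmul h α =>
  induction y with
  | zero => simp
  | add y y' hy hy' => simp only [map_add, hy, hy', mul_add]
  | tmul h' α' =>
  let r := Repr.arbitrary F h'
  have key := faceHom_mul_vertexHom hS true r α
  rw [heisenbergMul_repr F H h h' α α' r]
  simp only [map_sum, heisenbergAction_tmul]
  calc _ = ∑ i ∈ r.index, Lpos F H h * (vertexHom F H true (r.left i) *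
        faceHom F H true (rightRegular F H α (r.right i))) * Tpos F H α' :=
        Finset.sum_congr rfl fun i _ => by
          have h1 : Lpos F H (h * r.left i) = Lpos F H h * Lpos F H (r.left i) :=
            map_mul (vertexHom F H true) h (r.left i)
          rw [h1, Tpos_mul]
          simp only [mul_assoc]
          rfl
    _ = _ := by
      rw [← Finset.sum_mul, ← Finset.mul_sum, ← key]
      simp only [mul_assoc]
      rfl

/-- The tensor `y ⊗ α`, as the map `h ↦ α(h) y`, is recovered from the operator
`h ↦ α(h₍₂₎) y h₍₁₎` by convolution with the antipode. -/
theorem heisenbergAction_injective : Function.Injective (heisenbergAction F H) := by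
  have key : ∀ X : H ⊗[F] DualHopf F H,
      opConv (toConv (heisenbergAction F H (toHeisenberg F H X))) (invConv (AlgHom.id F H)) =
        tensorHom F H X := by
    intro X
    rw [heisenbergAction_eq_opConv]
    change opConv (opConv _ _) _ = _
    rw [opConv_assoc, opConv_homConv_invConv hS, opConv_one]
  intro x y hxy
  obtain ⟨x, rfl⟩ := (toHeisenberg F H).surjective x
  obtain ⟨y, rfl⟩ := (toHeisenberg F H).surjective y
  rw [tensorHom_injective ((key x).symm.trans ((congrArg (fun f => opConv (toConv f) _) hxy).trans
    (key y)))]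

/-- The action of the Heisenberg double on `H`, as an isomorphism onto `End(H)`. -/
def heisenbergEquiv : HeisenbergDouble F H ≃ₐ[F] Module.End F H :=
  AlgEquiv.ofBijective
    (AlgHom.ofLinearMap (heisenbergAction F H)
      (by
        rw [← toHeisenberg_one, heisenbergAction_tmul, Tpos_one, mul_one]
        exact map_one (vertexHom F H true))
      (heisenbergAction_mul hS))
    (by
      have hfin' : Module.Finite F (DualHopf F H) :=
        Module.Finite.equiv (WithConv.linearEquiv F (H →ₗ[F] F)).symm
      have hfin : FiniteDimensional F (HeisenbergDouble F H) :=
        Module.Finite.equiv (toHeisenberg F H)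
      have hdim : Module.finrank F (HeisenbergDouble F H) = Module.finrank F (Module.End F H) := by
        rw [← (toHeisenberg F H).finrank_eq, Module.finrank_tensorProduct,
          (WithConv.linearEquiv F (H →ₗ[F] F)).finrank_eq, Module.finrank_linearMap,
          Module.finrank_linearMap, Module.finrank_self, mul_one]
      have hi := heisenbergAction_injective hS
      exact ⟨hi, (LinearMap.injective_iff_surjective_of_finrank_eq_finrank hdim).1 hi⟩)

theorem heisenbergEquiv_apply (x : HeisenbergDouble F H) :
    heisenbergEquiv hS x = heisenbergAction F H x := rfl

end HeisenbergAction

/-! ### The antipode of the dual of the Drinfeld double -/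

section DrinfeldAntipode

variable {F H : Type*} [Field F] [Ring H] [HopfAlgebra F H] [FiniteDimensional F H]

local notation "S" => HopfAlgebra.antipode F (A := H)

theorem antipodeInv_eq (hS : ∀ h : H, S (S h) = h) : antipodeInv F H = S := by
  have h1 : (S : Module.End F H) * S = 1 := LinearMap.ext hS
  exact Ring.inverse_unit (⟨S, S, h1, h1⟩ : (Module.End F H)ˣ)

theorem projDual_tmul (y : H) (γ : DualHopf F H) :
    projDual F H (y ⊗ₜ γ) = counit (R := F) y • (1 ⊗ₜ γ) := by
  change algebraMap F H (counit y) ⊗ₜ γ = _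
  rw [Algebra.algebraMap_eq_smul_one, TensorProduct.smul_tmul']

theorem projPrimal_tmul (y : H) (γ : DualHopf F H) :
    projPrimal F H (y ⊗ₜ γ) = dualCounit F H γ • (y ⊗ₜ 1) := by
  change y ⊗ₜ algebraMap F (DualHopf F H) (dualCounit F H γ) = _
  rw [Algebra.algebraMap_eq_smul_one, TensorProduct.tmul_smul]

theorem sum_dualBasis_smul (h : H) : ∑ i, dualBasis F H i h • stdBasis F H i = h :=
  (stdBasis F H).sum_repr h

theorem sum_counit_smul_dualBasis :
    ∑ i, counit (R := F) (stdBasis F H i) • dualBasis F H i = 1 := by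
  refine dual_ext fun k => ?_
  rw [ofConv_sum, LinearMap.sum_apply]
  have h1 := congrArg (counit (R := F)) (sum_dualBasis_smul (F := F) k)
  rw [map_sum] at h1
  refine Eq.trans (Finset.sum_congr rfl fun i _ => ?_) h1
  rw [map_smul]
  exact mul_comm _ _

theorem sum_counit_smul_stdBasis :
    ∑ i, dualCounit F H (dualBasis F H i) • stdBasis F H i = 1 := sum_dualBasis_smul 1

variable (hS : ∀ h : H, HopfAlgebra.antipode F (HopfAlgebra.antipode F h) = h)
include hS

theorem drinfeldAntipode_tmul (y : H) (γ : DualHopf F H) :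
    drinfeldAntipode F H (y ⊗ₜ γ) = ∑ i, ∑ j, (stdBasis F H i * (S y * stdBasis F H j)) ⊗ₜ
      (dualAntipode F H (dualBasis F H j) * (dualAntipode F H γ * dualBasis F H i)) := by
  rw [drinfeldAntipode, antipodeInv_eq hS]
  simp only [LinearMap.sum_apply]
  rfl

/-- The projection of `D(H)*` to `H*` intertwines the antipodes. -/
theorem projDual_drinfeldAntipode (x : H ⊗[F] DualHopf F H) :
    projDual F H (drinfeldAntipode F H x) =
      TensorProduct.map LinearMap.id (dualAntipode F H) (projDual F H x) := by
  induction x with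
  | zero => simp
  | add x y hx hy => simp only [map_add, hx, hy]
  | tmul y γ =>
  have h2 : ∑ j, counit (R := F) (stdBasis F H j) • dualAntipode F H (dualBasis F H j) = 1 := by
    have h1 := congrArg (dualAntipode F H) (sum_counit_smul_dualBasis (F := F) (H := H))
    simp only [map_sum, map_smul] at h1
    rw [h1]
    exact HopfAlgebra.antipode_one (R := F) (A := DualHopf F H)
  rw [drinfeldAntipode_tmul hS, projDual_tmul, map_smul, TensorProduct.map_tmul]
  simp only [map_sum, projDual_tmul, Bialgebra.counit_mul, HopfAlgebra.counit_antipode]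
  calc _ = counit (R := F) y • ((1 : H) ⊗ₜ[F] ((∑ j, counit (R := F) (stdBasis F H j) •
        dualAntipode F H (dualBasis F H j)) * (dualAntipode F H γ *
          ∑ i, counit (R := F) (stdBasis F H i) • dualBasis F H i))) := by
        rw [Finset.sum_mul]
        simp only [Finset.mul_sum, TensorProduct.tmul_sum, Finset.smul_sum]
        rw [Finset.sum_comm]
        refine Finset.sum_congr rfl fun j _ => Finset.sum_congr rfl fun i _ => ?_
        simp only [smul_mul_assoc, mul_smul_comm, TensorProduct.tmul_smul, smul_smul]
        congr 1
        ring
    _ = _ := by rw [h2, sum_counit_smul_dualBasis, one_mul, mul_one]; rfl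

/-- The projection of `D(H)*` to `H` intertwines the antipodes. -/
theorem projPrimal_drinfeldAntipode (x : H ⊗[F] DualHopf F H) :
    projPrimal F H (drinfeldAntipode F H x) =
      TensorProduct.map (S) LinearMap.id (projPrimal F H x) := by
  induction x with
  | zero => simp
  | add x y hx hy => simp only [map_add, hx, hy]
  | tmul y γ =>
  have hm : ∀ α β : DualHopf F H, dualCounit F H (α * β) = dualCounit F H α * dualCounit F H β :=
    Bialgebra.counit_mul (R := F) (A := DualHopf F H)
  have ha : ∀ α : DualHopf F H, dualCounit F H (dualAntipode F H α) = dualCounit F H α :=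
    HopfAlgebra.counit_antipode (R := F) (A := DualHopf F H)
  rw [drinfeldAntipode_tmul hS, projPrimal_tmul, map_smul, TensorProduct.map_tmul]
  simp only [map_sum, projPrimal_tmul, hm, ha]
  calc _ = dualCounit F H γ • (((∑ i, dualCounit F H (dualBasis F H i) • stdBasis F H i) *
        (S y * ∑ j, dualCounit F H (dualBasis F H j) • stdBasis F H j)) ⊗ₜ[F]
          (1 : DualHopf F H)) := by
        rw [Finset.sum_mul]
        simp only [Finset.mul_sum, TensorProduct.sum_tmul, Finset.smul_sum]
        refine Finset.sum_congr rfl fun i _ => Finset.sum_congr rfl fun j _ => ?_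
        simp only [smul_mul_assoc, mul_smul_comm, ← TensorProduct.smul_tmul', smul_smul]
        congr 1
        ring
    _ = _ := by rw [sum_counit_smul_stdBasis, one_mul, mul_one]; rfl

theorem tensorHom_drinfeldAntipode (y : H) (γ : DualHopf F H) :
    tensorHom F H (drinfeldAntipode F H (y ⊗ₜ γ)) =
      opConv (toConv (Tneg F H (dualAntipode F H γ)))
        (toConv (LinearMap.mulLeft F (S y) ∘ₗ S)) := by
  refine WithConv.ext (LinearMap.ext fun h => ?_)
  let r := Repr.arbitrary F h
  let a₂ := fun j => Repr.arbitrary F (r.right j)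
  change tensorHom F H _ h = opConv _ _ h
  rw [opConv_apply r, drinfeldAntipode_tmul hS]
  simp only [map_sum, ofConv_sum, LinearMap.sum_apply, tensorHom_tmul, r.convMul_apply,
    (a₂ _).convMul_apply, Tneg_repr (a₂ _), Finset.sum_smul, Finset.mul_sum, Finset.sum_mul]
  have h1 : ∀ k m : H, ∑ i, ∑ j, (dualBasis F H j (S m) * dualBasis F H i k) •
      (stdBasis F H i * (S y * stdBasis F H j)) = k * (S y * S m) := by
    intro k m
    conv_rhs => rw [← sum_dualBasis_smul (F := F) (S m), ← sum_dualBasis_smul (F := F) k]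
    rw [Finset.sum_mul]
    simp only [Finset.mul_sum]
    refine Finset.sum_congr rfl fun i _ => Finset.sum_congr rfl fun j _ => ?_
    rw [mul_smul_comm, mul_smul_comm, smul_mul_assoc, smul_smul]
  simp only [Finset.sum_comm (s := (Finset.univ : Finset (Fin (Module.finrank F H))))
    (t := r.index)]
  refine Finset.sum_congr rfl fun p _ => ?_
  simp only [Finset.sum_comm (s := (Finset.univ : Finset (Fin (Module.finrank F H))))
    (t := (a₂ p).index)]
  refine Finset.sum_congr rfl fun q _ => ?_
  rw [smul_mul_assoc]
  refine Eq.trans ?_ (congrArg (dualAntipode F H γ ((a₂ p).left q) • ·) (h1 _ _))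
  simp only [Finset.smul_sum, smul_smul]
  refine Finset.sum_congr rfl fun i _ => Finset.sum_congr rfl fun j _ => ?_
  rw [mul_left_comm]
  rfl

theorem heisenbergAction_drinfeldAntipode_one_tmul (γ : DualHopf F H) :
    heisenbergAction F H (toHeisenberg F H (drinfeldAntipode F H (1 ⊗ₜ γ))) =
      faceHom F H false γ := by
  have h1 : toConv (LinearMap.mulLeft F (S 1) ∘ₗ S) = invConv (AlgHom.id F H) := by
    rw [HopfAlgebra.antipode_one, LinearMap.mulLeft_one]; rfl
  rw [heisenbergAction_eq_opConv, tensorHom_drinfeldAntipode hS, opConv_assoc, h1,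
    opConv_invConv_homConv hS, opConv_one]
  rfl

theorem heisenbergAction_drinfeldAntipode_tmul_one (y : H) :
    heisenbergAction F H (toHeisenberg F H (drinfeldAntipode F H (y ⊗ₜ 1))) =
      vertexHom F H false y := by
  have h1 : opConv (toConv (LinearMap.mulLeft F (S y) ∘ₗ S)) (homConv (AlgHom.id F H)) =
      toConv ((counit (R := F) (A := H)).smulRight (S y)) := by
    refine WithConv.ext (LinearMap.ext fun h => ?_)
    let r := Repr.arbitrary F h
    change opConv _ _ h = counit (R := F) h • S y
    rw [opConv_apply r]
    have h2 := congrArg (S y * ·) (sum_antipode_right_mul_left hS r)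
    simp only [Finset.mul_sum, mul_smul_comm, mul_one, ← mul_assoc] at h2
    exact h2
  rw [heisenbergAction_eq_opConv, tensorHom_drinfeldAntipode hS, opConv_assoc, h1]
  refine LinearMap.ext fun h => ?_
  let r := Repr.arbitrary F h
  have h3 := congrArg (· * S y) (sum_counit_smul r)
  change opConv _ _ h = h * S y
  rw [opConv_apply r, show dualAntipode F H 1 = 1 from
    HopfAlgebra.antipode_one (R := F) (A := DualHopf F H), Tneg_one]
  simpa [Finset.sum_mul] using h3

end DrinfeldAntipode

/-! ### Transport of convolution products -/

section Transport

variable {F : Type*} [Field F]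

/-- Convolution products can be computed after applying a map of coalgebras. -/
theorem iteratedConv_comp {C D A : Type*} [AddCommGroup C] [Module F C] [AddCommGroup D]
    [Module F D] [Ring A] [Algebra F A] {Δ : C →ₗ[F] C ⊗[F] C} {ε : C →ₗ[F] F}
    {Δ' : D →ₗ[F] D ⊗[F] D} {ε' : D →ₗ[F] F} (π : D →ₗ[F] C)
    (hΔ : TensorProduct.map π π ∘ₗ Δ' = Δ ∘ₗ π) (hε : ε ∘ₗ π = ε') (l : List (C →ₗ[F] A)) :
    iteratedConv Δ' ε' (l.map (· ∘ₗ π)) = iteratedConv Δ ε l ∘ₗ π := by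
  induction l with
  | nil => rw [List.map_nil, iteratedConv, iteratedConv, ← hε, LinearMap.comp_assoc]
  | cons f l ih =>
    rw [List.map_cons, iteratedConv, iteratedConv, ih, TensorProduct.map_comp]
    simp only [LinearMap.comp_assoc, hΔ]

theorem algHom_comp_iteratedConv {C A B : Type*} [AddCommGroup C] [Module F C] [Ring A]
    [Algebra F A] [Ring B] [Algebra F B] {Δ : C →ₗ[F] C ⊗[F] C} {ε : C →ₗ[F] F} (g : A →ₐ[F] B)
    (l : List (C →ₗ[F] A)) :
    g.toLinearMap ∘ₗ iteratedConv Δ ε l = iteratedConv Δ ε (l.map (g.toLinearMap ∘ₗ ·)) := by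
  induction l with
  | nil => exact LinearMap.ext fun c => g.commutes _
  | cons f l ih =>
    have h1 : g.toLinearMap ∘ₗ LinearMap.mul' F A =
        LinearMap.mul' F B ∘ₗ TensorProduct.map g.toLinearMap g.toLinearMap :=
      TensorProduct.ext' fun x y => map_mul g x y
    rw [List.map_cons, iteratedConv, iteratedConv, ← ih, TensorProduct.map_comp,
      ← LinearMap.comp_assoc, h1]
    simp only [LinearMap.comp_assoc]

end Transport

/-! ### Holonomies -/

section Holonomies

variable {F H E : Type*} [Field F] [Ring H] [HopfAlgebra F H] [DecidableEq E]

local notation "S" => HopfAlgebra.antipode F (A := H)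

theorem toHeisenbergTensor_tprod (x : E → DrinfeldDual F H) :
    toHeisenbergTensor F H (PiTensorProduct.tprod F x) =
      PiTensorProduct.tprod F fun e => toHeisenberg F H ((toDrinfeldDual F H).symm (x e)) :=
  PiTensorProduct.map_tprod _ _

theorem toHeisenberg_toDrinfeldDual_symm_one :
    toHeisenberg F H ((toDrinfeldDual F H).symm 1) = 1 := by
  rw [← toHeisenberg_one]
  congr 1

variable (F H) in
/-- The span of the pure tensors with entry `1` at the edge `e`. -/
def trivialAt (e : E) : Submodule F (DrinfeldDualTensor F H E) :=
  Submodule.span F {y | ∃ z : E → DrinfeldDual F H, z e = 1 ∧ PiTensorProduct.tprod F z = y}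

theorem one_mem_trivialAt (e : E) : (1 : DrinfeldDualTensor F H E) ∈ trivialAt F H e :=
  Submodule.subset_span ⟨1, rfl, rfl⟩

theorem atEdge_apply (e : E) (x : H ⊗[F] DualHopf F H) :
    atEdge F H e x = PiTensorProduct.tprod F (Pi.mulSingle e (toDrinfeldDual F H x)) := rfl

theorem atEdge_mul_mem_trivialAt {e e' : E} (h : e' ≠ e) (x : H ⊗[F] DualHopf F H)
    {y : DrinfeldDualTensor F H E} (hy : y ∈ trivialAt F H e) :
    atEdge F H e' x * y ∈ trivialAt F H e := by
  induction hy using Submodule.span_induction with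
  | zero => rw [mul_zero]; exact zero_mem _
  | add y z _ _ hy hz => rw [mul_add]; exact add_mem hy hz
  | smul c y _ hy => rw [mul_smul_comm]; exact Submodule.smul_mem _ c hy
  | mem y hy =>
    obtain ⟨z, hz, rfl⟩ := hy
    rw [atEdge_apply, PiTensorProduct.tprod_mul_tprod]
    refine Submodule.subset_span ⟨_, ?_, rfl⟩
    rw [Pi.mul_apply, hz, Pi.mulSingle_eq_of_ne h.symm, mul_one]

/-- The algebra structures of the Heisenberg double and of the dual of the Drinfeld double agree on
products of elements at distinct edges. -/
theorem toHeisenbergTensor_atEdge_mul (e : E) (x : H ⊗[F] DualHopf F H)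
    {y : DrinfeldDualTensor F H E} (hy : y ∈ trivialAt F H e) :
    toHeisenbergTensor F H (atEdge F H e x * y) =
      PiTensorProduct.singleAlgHom (R := F) (A := fun _ : E => HeisenbergDouble F H) e
        (toHeisenberg F H x) * toHeisenbergTensor F H y := by
  induction hy using Submodule.span_induction with
  | zero => simp
  | add y z _ _ hy hz => rw [mul_add, map_add, hy, hz, map_add, mul_add]
  | smul c y _ hy => rw [mul_smul_comm, map_smul, hy, map_smul, mul_smul_comm]
  | mem y hy =>
    obtain ⟨z, hz, rfl⟩ := hy
    rw [atEdge_apply, PiTensorProduct.tprod_mul_tprod, toHeisenbergTensor_tprod,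
      toHeisenbergTensor_tprod, PiTensorProduct.singleAlgHom_apply,
      PiTensorProduct.tprod_mul_tprod]
    congr 1
    funext e'
    by_cases h : e' = e
    · subst h
      simp only [Pi.mul_apply, Pi.mulSingle_eq_same, MonoidHom.mulSingle_apply, hz, mul_one,
        LinearEquiv.symm_apply_apply, toHeisenberg_toDrinfeldDual_symm_one]
    · simp only [Pi.mul_apply, Pi.mulSingle_eq_of_ne h, MonoidHom.mulSingle_apply, one_mul]

/-- The convolution product of maps supported at distinct edges can be computed in the Heisenberg
doubles. -/
theorem toHeisenbergTensor_comp_iteratedConv {C ι : Type*} [AddCommGroup C] [Module F C]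
    {Δ : C →ₗ[F] C ⊗[F] C} {ε : C →ₗ[F] F} (f : ι → C →ₗ[F] H ⊗[F] DualHopf F H) (p : ι → E)
    (l : List ι) (hl : (l.map p).Nodup) :
    toHeisenbergTensor F H ∘ₗ iteratedConv Δ ε (l.map fun i => atEdge F H (p i) ∘ₗ f i) =
      iteratedConv Δ ε (l.map fun i => (PiTensorProduct.singleAlgHom (R := F)
        (A := fun _ : E => HeisenbergDouble F H) (p i)).toLinearMap ∘ₗ
          (toHeisenberg F H).toLinearMap ∘ₗ f i) ∧
    ∀ e, e ∉ l.map p → ∀ c,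
      iteratedConv Δ ε (l.map fun i => atEdge F H (p i) ∘ₗ f i) c ∈ trivialAt F H e := by
  induction l with
  | nil =>
    refine ⟨LinearMap.ext fun c => ?_, fun e _ c => ?_⟩
    · change toHeisenbergTensor F H (algebraMap F _ (ε c)) = algebraMap F _ (ε c)
      rw [Algebra.algebraMap_eq_smul_one, Algebra.algebraMap_eq_smul_one, map_smul]
      exact congrArg (ε c • ·) ((toHeisenbergTensor_tprod _).trans
        (congrArg (PiTensorProduct.tprod F) (funext fun e =>
          toHeisenberg_toDrinfeldDual_symm_one)))
    · change algebraMap F _ (ε c) ∈ _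
      rw [Algebra.algebraMap_eq_smul_one]
      exact Submodule.smul_mem _ _ (one_mem_trivialAt e)
  | cons i l ih =>
    rw [List.map_cons, List.nodup_cons] at hl
    obtain ⟨ih1, ih2⟩ := ih hl.2
    simp only [List.map_cons, iteratedConv, ← ih1]
    refine ⟨LinearMap.ext fun c => ?_, fun e he c => ?_⟩
    · simp only [LinearMap.comp_apply]
      generalize Δ c = t
      induction t with
      | zero => simp
      | add s t hs ht => simp only [map_add, hs, ht]
      | tmul x y => exact toHeisenbergTensor_atEdge_mul _ _ (ih2 _ hl.1 _)
    · simp only [LinearMap.comp_apply]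
      generalize Δ c = t
      rw [List.mem_cons, not_or] at he
      induction t with
      | zero => simp
      | add s t hs ht => simp only [map_add]; exact add_mem hs ht
      | tmul x y => exact atEdge_mul_mem_trivialAt (Ne.symm he.1) _ (ih2 _ he.2 _)

variable [FiniteDimensional F H]

variable (F H) in
/-- The map of coalgebras `y ⊗ γ ↦ ε(y) γ` from `D(H)*` to `H*`. -/
def toDual : H ⊗[F] DualHopf F H →ₗ[F] DualHopf F H :=
  (TensorProduct.lid F _).toLinearMap ∘ₗ TensorProduct.map counit LinearMap.id

variable (F H) in
/-- The map of coalgebras `y ⊗ γ ↦ ε(γ) y` from `D(H)*` to `H`. -/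
def toPrimal : H ⊗[F] DualHopf F H →ₗ[F] H :=
  (TensorProduct.rid F _).toLinearMap ∘ₗ TensorProduct.map LinearMap.id (dualCounit F H)

theorem toDual_tmul (y : H) (γ : DualHopf F H) :
    toDual F H (y ⊗ₜ γ) = counit (R := F) y • γ := rfl

theorem toPrimal_tmul (y : H) (γ : DualHopf F H) :
    toPrimal F H (y ⊗ₜ γ) = dualCounit F H γ • y := rfl

theorem toDual_comul :
    TensorProduct.map (toDual F H) (toDual F H) ∘ₗ drinfeldComul F H =
      dualComul F H ∘ₗ toDual F H := by
  have h1 : TensorProduct.map (toDual F H) (toDual F H) ∘ₗ (∑ i, ∑ j, TensorProduct.map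
      (TensorProduct.map LinearMap.id
        (LinearMap.mulLeft F (dualBasis F H i) ∘ₗ LinearMap.mulRight F (dualBasis F H j)))
      (TensorProduct.map
        (LinearMap.mulLeft F (S (stdBasis F H j)) ∘ₗ
          LinearMap.mulRight F (stdBasis F H i)) LinearMap.id)) =
      TensorProduct.map (toDual F H) (toDual F H) := by
    refine TensorProduct.ext_fourfold' fun y γ z δ => ?_
    simp only [LinearMap.comp_apply, LinearMap.sum_apply, map_sum, TensorProduct.map_tmul,
      toDual_tmul, LinearMap.id_apply, LinearMap.mulLeft_apply, LinearMap.mulRight_apply,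
      Bialgebra.counit_mul, HopfAlgebra.counit_antipode]
    calc _ = (counit (R := F) y • ((∑ i, counit (R := F) (stdBasis F H i) • dualBasis F H i) *
          (γ * ∑ j, counit (R := F) (stdBasis F H j) • dualBasis F H j))) ⊗ₜ[F]
            (counit (R := F) z • δ) := by
          rw [Finset.sum_mul]
          simp only [Finset.mul_sum, TensorProduct.sum_tmul, Finset.smul_sum]
          refine Finset.sum_congr rfl fun i _ => Finset.sum_congr rfl fun j _ => ?_
          simp only [smul_mul_assoc, mul_smul_comm, TensorProduct.tmul_smul,
            ← TensorProduct.smul_tmul', smul_smul]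
          congr 1
          ring
      _ = _ := by rw [sum_counit_smul_dualBasis, one_mul, mul_one]
  have h2 : ∀ (u : H ⊗[F] H) (w : DualHopf F H ⊗[F] DualHopf F H),
      TensorProduct.map (toDual F H) (toDual F H)
        (TensorProduct.tensorTensorTensorComm F H H (DualHopf F H) (DualHopf F H) (u ⊗ₜ w)) =
          LinearMap.mul' F F (TensorProduct.map counit counit u) • w := by
    intro u w
    induction u with
    | zero => simp
    | add u u' hu hu' => simp only [TensorProduct.add_tmul, map_add, hu, hu', add_smul]
    | tmul y z =>
    induction w with
    | zero => simp
    | add u u' hu hu' => simp only [TensorProduct.tmul_add, map_add, hu, hu', smul_add]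
    | tmul γ δ => exact TensorProduct.smul_tmul_smul _ _ _ _
  rw [drinfeldComul, ← LinearMap.comp_assoc, h1]
  refine TensorProduct.ext' fun y γ => ?_
  have h3 : LinearMap.mul' F F (TensorProduct.map counit counit (comul (R := F) y)) =
      counit (R := F) y := by
    let r := Repr.arbitrary F y
    have := congrArg (counit (R := F)) (sum_counit_smul r)
    rw [← r.eq]
    simp only [map_sum, map_smul, smul_eq_mul] at this ⊢
    exact this
  simp only [LinearMap.comp_apply, TensorProduct.map_tmul, LinearEquiv.coe_coe, h2, h3,
    toDual_tmul, map_smul]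

theorem toPrimal_comul :
    TensorProduct.map (toPrimal F H) (toPrimal F H) ∘ₗ drinfeldComul F H =
      comul ∘ₗ toPrimal F H := by
  have hm : ∀ α β : DualHopf F H, dualCounit F H (α * β) = dualCounit F H α * dualCounit F H β :=
    Bialgebra.counit_mul (R := F) (A := DualHopf F H)
  have h1 : TensorProduct.map (toPrimal F H) (toPrimal F H) ∘ₗ (∑ i, ∑ j, TensorProduct.map
      (TensorProduct.map LinearMap.id
        (LinearMap.mulLeft F (dualBasis F H i) ∘ₗ LinearMap.mulRight F (dualBasis F H j)))
      (TensorProduct.map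
        (LinearMap.mulLeft F (S (stdBasis F H j)) ∘ₗ
          LinearMap.mulRight F (stdBasis F H i)) LinearMap.id)) =
      TensorProduct.map (toPrimal F H) (toPrimal F H) := by
    refine TensorProduct.ext_fourfold' fun y γ z δ => ?_
    simp only [LinearMap.comp_apply, LinearMap.sum_apply, map_sum, TensorProduct.map_tmul,
      toPrimal_tmul, LinearMap.id_apply, LinearMap.mulLeft_apply, LinearMap.mulRight_apply, hm]
    calc _ = (dualCounit F H γ • y) ⊗ₜ[F] (dualCounit F H δ •
          (S (∑ j, dualCounit F H (dualBasis F H j) • stdBasis F H j) *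
            (z * ∑ i, dualCounit F H (dualBasis F H i) • stdBasis F H i))) := by
          rw [map_sum, Finset.sum_mul]
          simp only [Finset.mul_sum, TensorProduct.tmul_sum, Finset.smul_sum, map_smul]
          rw [Finset.sum_comm]
          refine Finset.sum_congr rfl fun i _ => Finset.sum_congr rfl fun j _ => ?_
          simp only [smul_mul_assoc, mul_smul_comm, TensorProduct.tmul_smul,
            ← TensorProduct.smul_tmul', smul_smul]
          congr 1
          ring
      _ = _ := by rw [sum_counit_smul_stdBasis, HopfAlgebra.antipode_one, one_mul, mul_one]
  have h2 : ∀ (u : H ⊗[F] H) (w : DualHopf F H ⊗[F] DualHopf F H),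
      TensorProduct.map (toPrimal F H) (toPrimal F H)
        (TensorProduct.tensorTensorTensorComm F H H (DualHopf F H) (DualHopf F H) (u ⊗ₜ w)) =
          LinearMap.mul' F F (TensorProduct.map (dualCounit F H) (dualCounit F H) w) • u := by
    intro u w
    induction u with
    | zero => simp
    | add u u' hu hu' => simp only [TensorProduct.add_tmul, map_add, hu, hu', smul_add]
    | tmul y z =>
    induction w with
    | zero => simp
    | add u u' hu hu' => simp only [TensorProduct.tmul_add, map_add, hu, hu', add_smul]
    | tmul γ δ => exact TensorProduct.smul_tmul_smul _ _ _ _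
  rw [drinfeldComul, ← LinearMap.comp_assoc, h1]
  refine TensorProduct.ext' fun y γ => ?_
  have h3 : LinearMap.mul' F F
      (TensorProduct.map (dualCounit F H) (dualCounit F H) (dualComul F H γ)) =
        dualCounit F H γ := by
    let r := Repr.arbitrary F γ
    have := congrArg (counit (R := F)) (sum_counit_smul r)
    rw [← comul_dual, ← r.eq]
    simp only [map_sum, map_smul, smul_eq_mul] at this ⊢
    exact this
  simp only [LinearMap.comp_apply, TensorProduct.map_tmul, LinearEquiv.coe_coe, h2, h3,
    toPrimal_tmul, map_smul]

end Holonomies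

/-! ### The representation on the extended space -/

section Representation

variable {F H E : Type*} [Field F] [Ring H] [HopfAlgebra F H] [DecidableEq E]
  [FiniteDimensional F H] (hS : ∀ h : H, HopfAlgebra.antipode F (HopfAlgebra.antipode F h) = h)

theorem rho_tprod_tprod (X : E → HeisenbergDouble F H) (k : E → H) :
    rho F H E (PiTensorProduct.tprod F X) (PiTensorProduct.tprod F k) =
      PiTensorProduct.tprod F fun e => heisenbergAction F H (X e) (k e) := by
  rw [rho, LinearMap.comp_apply, PiTensorProduct.map_tprod,
    PiTensorProduct.piTensorHomMap_tprod_tprod]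

variable (E) in
/-- The linear map `ρ`, as an algebra homomorphism. -/
def rhoAlgHom : HeisenbergTensor F H E →ₐ[F] Module.End F (ExtendedSpace F H E) :=
  AlgHom.ofLinearMap (rho F H E)
    (by
      refine PiTensorProduct.ext (MultilinearMap.ext fun k => ?_)
      refine (rho_tprod_tprod 1 k).trans ?_
      congr 1
      funext e
      exact LinearMap.congr_fun (map_one (heisenbergEquiv hS)) (k e))
    (fun x y => by
      refine PiTensorProduct.ext (MultilinearMap.ext fun k => ?_)
      change rho F H E (x * y) (PiTensorProduct.tprod F k) =
        rho F H E x (rho F H E y (PiTensorProduct.tprod F k))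
      induction x using PiTensorProduct.induction_on with
      | add x x' hx hx' => rw [add_mul, map_add, map_add, LinearMap.add_apply, hx, hx']; rfl
      | smul_tprod c x =>
      induction y using PiTensorProduct.induction_on with
      | add y y' hy hy' =>
        rw [mul_add, map_add, map_add, LinearMap.add_apply, hy, hy', LinearMap.add_apply, map_add]
      | smul_tprod d y =>
      rw [PiTensorProduct.smul_tprod_mul_smul_tprod, map_smul, map_smul, map_smul,
        LinearMap.smul_apply, LinearMap.smul_apply, LinearMap.smul_apply, map_smul,
        rho_tprod_tprod, rho_tprod_tprod, rho_tprod_tprod, smul_smul]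
      congr 2
      funext e
      exact LinearMap.congr_fun (heisenbergAction_mul hS (x e) (y e)) (k e))

theorem rhoAlgHom_apply (x : HeisenbergTensor F H E) : rhoAlgHom E hS x = rho F H E x := rfl

/-- The embedding of `End(H) ≅ 𝓗(H)` into `𝓗(H)^{⊗E}` at the edge `e`. -/
def edgeHom (e : E) : Module.End F H →ₐ[F] HeisenbergTensor F H E :=
  (PiTensorProduct.singleAlgHom (R := F) (A := fun _ : E => HeisenbergDouble F H) e).comp
    (heisenbergEquiv hS).symm.toAlgHom

theorem commute_edgeHom {e e' : E} (h : e ≠ e') (x y : Module.End F H) :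
    Commute (edgeHom hS e x) (edgeHom hS e' y) :=
  Commute.tprod (Pi.mulSingle_commute h _ _)

theorem rho_edgeHom (e : E) (T : Module.End F H) :
    rho F H E (edgeHom hS e T) = onEdge F H e T := by
  refine PiTensorProduct.ext (MultilinearMap.ext fun k => ?_)
  change rho F H E (PiTensorProduct.tprod F (Pi.mulSingle e ((heisenbergEquiv hS).symm T)))
      (PiTensorProduct.tprod F k) =
    PiTensorProduct.map (Function.update (fun _ => LinearMap.id) e T) (PiTensorProduct.tprod F k)
  rw [rho_tprod_tprod, PiTensorProduct.map_tprod]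
  congr 1
  funext e'
  by_cases h : e' = e
  · subst h
    rw [Pi.mulSingle_eq_same, Function.update_self]
    exact LinearMap.congr_fun ((heisenbergEquiv hS).apply_symm_apply T) (k e')
  · rw [Pi.mulSingle_eq_of_ne h, Function.update_of_ne h]
    exact LinearMap.congr_fun (map_one (heisenbergEquiv hS)) (k e')

end Representation

/-! ### Holonomies of vertex and face loops -/

section LoopHolonomies

variable {F H V E : Type*} [Field F] [Ring H] [HopfAlgebra F H] [FiniteDimensional F H]
  [DecidableEq E] (hS : ∀ h : H, HopfAlgebra.antipode F (HopfAlgebra.antipode F h) = h)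

variable (F H) in
/-- The map `S_D^τ` with `τ = (1 - ε)/2`. -/
def signAntipode (s : Bool) : H ⊗[F] DualHopf F H →ₗ[F] H ⊗[F] DualHopf F H :=
  if s then LinearMap.id else drinfeldAntipode F H

theorem projDual_eq : projDual F H = TensorProduct.mk F H (DualHopf F H) 1 ∘ₗ toDual F H :=
  TensorProduct.ext' fun y γ => by
    rw [projDual_tmul, LinearMap.comp_apply, toDual_tmul, map_smul, TensorProduct.mk_apply]

theorem projPrimal_eq :
    projPrimal F H = (TensorProduct.mk F H (DualHopf F H)).flip 1 ∘ₗ toPrimal F H :=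
  TensorProduct.ext' fun y γ => by
    rw [projPrimal_tmul, LinearMap.comp_apply, toPrimal_tmul, map_smul, LinearMap.flip_apply,
      TensorProduct.mk_apply]

include hS

theorem projDual_comp_sq :
    projDual F H ∘ₗ drinfeldAntipode F H ∘ₗ drinfeldAntipode F H = projDual F H := by
  refine LinearMap.ext fun x => ?_
  have h1 : dualAntipode F H ∘ₗ dualAntipode F H = LinearMap.id :=
    LinearMap.ext fun α => dual_ext fun k => congrArg α (hS k)
  simp only [LinearMap.comp_apply, projDual_drinfeldAntipode hS]
  rw [← LinearMap.comp_apply, ← TensorProduct.map_comp, h1, LinearMap.id_comp, TensorProduct.map_id,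
    LinearMap.id_apply]

theorem projPrimal_comp_sq :
    projPrimal F H ∘ₗ drinfeldAntipode F H ∘ₗ drinfeldAntipode F H = projPrimal F H := by
  refine LinearMap.ext fun x => ?_
  have h1 : HopfAlgebra.antipode F (A := H) ∘ₗ HopfAlgebra.antipode F = LinearMap.id :=
    LinearMap.ext hS
  simp only [LinearMap.comp_apply, projPrimal_drinfeldAntipode hS]
  rw [← LinearMap.comp_apply, ← TensorProduct.map_comp, h1, LinearMap.id_comp, TensorProduct.map_id,
    LinearMap.id_apply]

theorem holLetter_thickR (d : E × Bool) :
    holLetter F H (thickR d) = (atEdge F H d.1 ∘ₗ signAntipode F H d.2 ∘ₗ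
      TensorProduct.mk F H (DualHopf F H) 1) ∘ₗ toDual F H := by
  obtain ⟨e, s⟩ := d
  rw [LinearMap.comp_assoc, LinearMap.comp_assoc, ← projDual_eq]
  cases s
  · change (atEdge F H e ∘ₗ drinfeldAntipode F H ∘ₗ projDual F H ∘ₗ drinfeldAntipode F H) ∘ₗ
      drinfeldAntipode F H = atEdge F H e ∘ₗ drinfeldAntipode F H ∘ₗ projDual F H
    simp only [LinearMap.comp_assoc, projDual_comp_sq hS]
  · rfl

theorem holLetter_thickRBar (d : E × Bool) :
    holLetter F H (thickRBar d) = (atEdge F H d.1 ∘ₗ signAntipode F H d.2 ∘ₗ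
      (TensorProduct.mk F H (DualHopf F H)).flip 1) ∘ₗ toPrimal F H := by
  obtain ⟨e, s⟩ := d
  rw [LinearMap.comp_assoc, LinearMap.comp_assoc, ← projPrimal_eq]
  cases s
  · change (atEdge F H e ∘ₗ drinfeldAntipode F H ∘ₗ projPrimal F H ∘ₗ drinfeldAntipode F H) ∘ₗ
      drinfeldAntipode F H = atEdge F H e ∘ₗ drinfeldAntipode F H ∘ₗ projPrimal F H
    simp only [LinearMap.comp_assoc, projPrimal_comp_sq hS]
  · rfl

theorem toHeisenberg_signAntipode_dual (s : Bool) (γ : DualHopf F H) :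
    toHeisenberg F H (signAntipode F H s (1 ⊗ₜ γ)) =
      (heisenbergEquiv hS).symm (faceHom F H s γ) := by
  rw [AlgEquiv.eq_symm_apply, heisenbergEquiv_apply]
  cases s
  · exact heisenbergAction_drinfeldAntipode_one_tmul hS γ
  · refine (heisenbergAction_tmul 1 γ).trans ?_
    rw [show Lpos F H 1 = 1 from map_one (vertexHom F H true), one_mul, faceHom_true]

theorem toHeisenberg_signAntipode_primal (s : Bool) (y : H) :
    toHeisenberg F H (signAntipode F H s (y ⊗ₜ 1)) =
      (heisenbergEquiv hS).symm (vertexHom F H s y) := by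
  rw [AlgEquiv.eq_symm_apply, heisenbergEquiv_apply]
  cases s
  · exact heisenbergAction_drinfeldAntipode_tmul_one hS y
  · refine (heisenbergAction_tmul y 1).trans ?_
    rw [Tpos_one, mul_one]
    rfl

/-- The holonomy of the face loop is the face operator, transported to the Heisenberg doubles. -/
theorem holDual_faceLoop (f : List (E × Bool)) (hf : (f.map Prod.fst).Nodup) :
    holDual F H (faceLoop f) = iteratedConv (dualComul F H) (dualCounit F H)
      (f.map fun d => (edgeFaceHom (edgeHom hS) d).toLinearMap) := by
  have h1 : toDual F H ∘ₗ TensorProduct.mk F H (DualHopf F H) 1 = LinearMap.id :=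
    LinearMap.ext fun γ => by
      rw [LinearMap.comp_apply, TensorProduct.mk_apply, toDual_tmul, Bialgebra.counit_one,
        one_smul, LinearMap.id_apply]
  have h2 : (faceLoop f).map (holLetter F H) = (f.map fun d => atEdge F H d.1 ∘ₗ
      signAntipode F H d.2 ∘ₗ TensorProduct.mk F H (DualHopf F H) 1).map (· ∘ₗ toDual F H) := by
    rw [faceLoop, List.map_map, List.map_map]
    exact List.map_congr_left fun d _ => holLetter_thickR hS d
  have h3 : dualCounit F H ∘ₗ toDual F H = drinfeldCounit F H :=
    TensorProduct.ext' fun y γ => rfl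
  rw [holDual, hol, holDrinfeld, h2, iteratedConv_comp _ toDual_comul h3, LinearMap.comp_assoc,
    LinearMap.comp_assoc, h1, LinearMap.comp_id,
    (toHeisenbergTensor_comp_iteratedConv _ Prod.fst f hf).1]
  congr 1
  refine List.map_congr_left fun d _ => LinearMap.ext fun γ => ?_
  exact congrArg
    (PiTensorProduct.singleAlgHom (R := F) (A := fun _ : E => HeisenbergDouble F H) d.1)
    (toHeisenberg_signAntipode_dual hS d.2 γ)

/-- The holonomy of the vertex loop is the vertex operator, transported to the Heisenberg
doubles. -/
theorem holPrimal_map_thickRBar (f : List (E × Bool)) (hf : (f.map Prod.fst).Nodup) :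
    holPrimal F H (f.map thickRBar) = iteratedConv comul counit
      (f.map fun d => (edgeVertexHom (edgeHom hS) d).toLinearMap) := by
  have h1 : toPrimal F H ∘ₗ (TensorProduct.mk F H (DualHopf F H)).flip 1 = LinearMap.id :=
    LinearMap.ext fun y => by
      rw [LinearMap.comp_apply, LinearMap.flip_apply, TensorProduct.mk_apply, toPrimal_tmul,
        show dualCounit F H 1 = 1 from Bialgebra.counit_one (R := F) (A := DualHopf F H),
        one_smul, LinearMap.id_apply]
  have h2 : (f.map thickRBar).map (holLetter F H) = (f.map fun d => atEdge F H d.1 ∘ₗ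
      signAntipode F H d.2 ∘ₗ (TensorProduct.mk F H (DualHopf F H)).flip 1).map
        (· ∘ₗ toPrimal F H) := by
    rw [List.map_map, List.map_map]
    exact List.map_congr_left fun d _ => holLetter_thickRBar hS d
  have h3 : (counit ∘ₗ toPrimal F H) = drinfeldCounit F H :=
    TensorProduct.ext' fun y γ => by
      rw [LinearMap.comp_apply, toPrimal_tmul, map_smul]
      exact mul_comm _ _
  rw [holPrimal, hol, holDrinfeld, h2, iteratedConv_comp _ toPrimal_comul h3, LinearMap.comp_assoc,
    LinearMap.comp_assoc, h1, LinearMap.comp_id,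
    (toHeisenbergTensor_comp_iteratedConv _ Prod.fst f hf).1]
  congr 1
  refine List.map_congr_left fun d _ => LinearMap.ext fun y => ?_
  exact congrArg
    (PiTensorProduct.singleAlgHom (R := F) (A := fun _ : E => HeisenbergDouble F H) d.1)
    (toHeisenberg_signAntipode_primal hS d.2 y)

theorem rhoAlgHom_comp_edgeVertexHom (d : E × Bool) :
    (rhoAlgHom E hS).toLinearMap ∘ₗ (edgeVertexHom (edgeHom hS) d).toLinearMap =
      vertexTerm F H d := by
  obtain ⟨e, s⟩ := d
  cases s <;> exact LinearMap.ext fun h => rho_edgeHom hS e _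

theorem rhoAlgHom_comp_edgeFaceHom (d : E × Bool) :
    (rhoAlgHom E hS).toLinearMap ∘ₗ (edgeFaceHom (edgeHom hS) d).toLinearMap =
      faceTerm F H d := by
  obtain ⟨e, s⟩ := d
  cases s <;> exact LinearMap.ext fun h => rho_edgeHom hS e _

theorem rhoAlgHom_comp_vertex (f : List (E × Bool)) :
    (rhoAlgHom E hS).toLinearMap ∘ₗ iteratedConv comul counit
      (f.map fun d => (edgeVertexHom (edgeHom hS) d).toLinearMap) =
        iteratedConv comul counit (f.map (vertexTerm F H)) := by
  rw [algHom_comp_iteratedConv, List.map_map]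
  congr 1
  exact List.map_congr_left fun d _ => rhoAlgHom_comp_edgeVertexHom hS d

theorem rhoAlgHom_comp_face (f : List (E × Bool)) :
    (rhoAlgHom E hS).toLinearMap ∘ₗ iteratedConv (dualComul F H) (dualCounit F H)
      (f.map fun d => (edgeFaceHom (edgeHom hS) d).toLinearMap) = faceOp F H f := by
  rw [algHom_comp_iteratedConv, List.map_map, faceOp]
  congr 1
  exact List.map_congr_left fun d _ => rhoAlgHom_comp_edgeFaceHom hS d

theorem commute_faceTerm {d d' : E × Bool} (hd : d ≠ d') (α β : DualHopf F H) :
    Commute (faceTerm F H d α) (faceTerm F H d' β) := by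
  rw [← rhoAlgHom_comp_edgeFaceHom hS, ← rhoAlgHom_comp_edgeFaceHom hS]
  exact (commute_edgeFaceHom (fun _ _ h => commute_edgeHom hS h) hd α β).map (rhoAlgHom E hS)

end LoopHolonomies

/-! ### Commutants of site algebras -/

section Commutant

variable {F H V A : Type*} [Field F] [CharZero F] [Ring H] [HopfAlgebra F H]
  [FiniteDimensional F H] [Ring A] [Algebra F A] {ℓ : H} {η : DualHopf F H}

/-- The elements that commute with the images of `a` and `b`. -/
def siteCommutant (a : H →ₐ[F] A) (b : DualHopf F H →ₐ[F] A) : Subalgebra F A :=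
  Subalgebra.centralizer F (Set.range a ∪ Set.range b)

theorem mem_siteCommutant {a : H →ₐ[F] A} {b : DualHopf F H →ₐ[F] A} {X : A} :
    X ∈ siteCommutant a b ↔ (∀ h, Commute X (a h)) ∧ ∀ α, Commute X (b α) := by
  rw [siteCommutant, Subalgebra.mem_centralizer_iff]
  constructor
  · exact fun h => ⟨fun x => (h _ (Or.inl ⟨x, rfl⟩)).symm, fun x => (h _ (Or.inr ⟨x, rfl⟩)).symm⟩
  · rintro ⟨h1, h2⟩ _ (⟨x, rfl⟩ | ⟨x, rfl⟩)
    · exact (h1 x).eq.symm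
    · exact (h2 x).eq.symm

variable {a : V → H →ₐ[F] A} {b : V → DualHopf F H →ₐ[F] A}
  (hℓ : IsHaarIntegral (F := F) counit ℓ) (hη : IsHaarIntegral (dualCounit F H) η)
  (hD : ∀ v, IsDrinfeldPair (a v) (b v))
  (hc : ∀ u v, u ≠ v → (∀ g h, Commute (a u g) (a v h)) ∧ (∀ α β, Commute (b u α) (b v β)) ∧
    ∀ h α, Commute (a u h) (b v α))
include hℓ hη hD hc

/-- Averaging over the gauge transformations at all sites projects onto the common commutant. -/
theorem range_prod_adjointAction (L : List V) (hL : ∀ v, v ∈ L) :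
    LinearMap.range (L.map fun v => adjointAction (a v) (b v) η ℓ).prod =
      Subalgebra.toSubmodule (⨅ v, siteCommutant (a v) (b v)) := by
  have hS := antipode_antipode hℓ hη
  have h1 : ∀ (L : List V) (X : A), ∀ v ∈ L,
      (L.map fun v => adjointAction (a v) (b v) η ℓ).prod X ∈ siteCommutant (a v) (b v) := by
    intro L X
    induction L with
    | nil => simp
    | cons u L ih =>
      intro v hv
      rw [List.map_cons, List.prod_cons, Module.End.mul_apply]
      by_cases huv : u = v
      · subst huv
        exact mem_siteCommutant.2 ((hD u).commute_adjointAction hℓ hη _)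
      · refine adjointAction_mem _ (fun h => ?_) (fun α => ?_) _ _
          (ih v ((List.mem_cons.1 hv).resolve_left (Ne.symm huv)))
        · exact mem_siteCommutant.2 ⟨(hc u v huv).1 h, (hc u v huv).2.2 h⟩
        · exact mem_siteCommutant.2 ⟨fun h => ((hc v u (Ne.symm huv)).2.2 h α).symm,
            (hc u v huv).2.1 α⟩
  refine le_antisymm ?_ ?_
  · rintro _ ⟨X, rfl⟩
    rw [Subalgebra.mem_toSubmodule, Algebra.mem_iInf]
    exact fun v => h1 L X v (hL v)
  · intro X hX
    rw [Subalgebra.mem_toSubmodule, Algebra.mem_iInf] at hX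
    have h2 : ∀ v, adjointAction (a v) (b v) η ℓ X = X := fun v => by
      rw [(adjointAction_eq_iff hS X).2 (mem_siteCommutant.1 (hX v)), hη.2, hℓ.2, one_mul,
        one_smul]
    refine ⟨X, ?_⟩
    clear hL h1
    induction L with
    | nil => rfl
    | cons v L ih => rw [List.map_cons, List.prod_cons, Module.End.mul_apply, ih, h2]

theorem haar_mul_mem_iInf (v : V) : a v ℓ * b v η ∈ ⨅ w, siteCommutant (a w) (b w) := by
  rw [Algebra.mem_iInf]
  intro w
  by_cases hvw : v = w
  · subst hvw
    exact mem_siteCommutant.2 ((hD v).commute_haar_mul hℓ hη)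
  · exact mul_mem (mem_siteCommutant.2 ⟨(hc v w hvw).1 ℓ, (hc v w hvw).2.2 ℓ⟩)
      (mem_siteCommutant.2 ⟨fun h => ((hc w v (Ne.symm hvw)).2.2 h η).symm, (hc v w hvw).2.1 η⟩)

omit hℓ hη hD hc in
theorem commute_haar_mul_of_mem {X : A} (hX : X ∈ ⨅ w, siteCommutant (a w) (b w)) (v : V) :
    Commute (a v ℓ * b v η) X := by
  rw [Algebra.mem_iInf] at hX
  have := mem_siteCommutant.1 (hX v)
  exact ((this.1 ℓ).mul_right (this.2 η)).symm

omit hℓ hη hD in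
theorem prod_haar_mul_prod_haar {L : List V} (hL : L.Nodup) :
    (L.map fun v => a v ℓ).prod * (L.map fun v => b v η).prod =
      (L.map fun v => a v ℓ * b v η).prod := by
  induction L with
  | nil => simp
  | cons v L ih =>
    rw [List.nodup_cons] at hL
    have h1 : Commute (L.map fun v => a v ℓ).prod (b v η) :=
      Commute.list_prod_left _ _ fun x hx => by
        obtain ⟨u, hu, rfl⟩ := List.mem_map.1 hx
        exact (hc u v (fun h => hL.1 (h ▸ hu))).2.2 ℓ η
    simp only [List.map_cons, List.prod_cons]
    rw [← ih hL.2, mul_assoc, ← mul_assoc _ (b v η), h1.eq]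
    simp only [mul_assoc]

end Commutant

/-! ### Products of commuting elements -/

theorem isIdempotentElem_list_prod {R ι : Type*} [Monoid R] {g : ι → R}
    (hc : ∀ i j, Commute (g i) (g j)) (hi : ∀ i, IsIdempotentElem (g i)) (L : List ι) : IsIdempotentElem (L.map g).prod := by
  induction L with
  | nil => exact IsIdempotentElem.one
  | cons i L ih =>
    rw [List.map_cons, List.prod_cons]
    refine (hi i).mul_of_commute (Commute.list_prod_right _ _ fun x hx => ?_) ih
    obtain ⟨j, -, rfl⟩ := List.mem_map.1 hx
    exact hc i j

theorem list_prod_eq_of_perm {R ι : Type*} [Monoid R] {g : ι → R}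
    (hc : ∀ i j, Commute (g i) (g j)) {L L' : List ι} (h : L.Perm L') : (L.map g).prod = (L'.map g).prod :=
  (h.map g).prod_eq' (List.pairwise_map.2 (List.pairwise_of_forall hc))

theorem list_prod_mulRight_apply {F A ι : Type*} [Field F] [Ring A] [Algebra F A] (g : ι → A)
    (L : List ι) (X : A) :
    (L.map fun i => LinearMap.mulRight F (g i)).prod X = X * (L.reverse.map g).prod := by
  induction L generalizing X with
  | nil => simp
  | cons i L ih =>
    rw [List.map_cons, List.prod_cons, Module.End.mul_apply, ih, LinearMap.mulRight_apply]
    simp [mul_assoc]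

/-! ### The Hamiltonian -/

section Hamiltonian

variable {F H V E : Type*} [Field F] [CharZero F] [Ring H] [HopfAlgebra F H]
  [FiniteDimensional F H] [DecidableEq E] {ℓ : H} {η : DualHopf F H}

/-- The products of the vertex and face operators are the image of the product of the elements
`a_v(ℓ) b_v(η)`. Faces correspond to the vertices that are not isolated, since each face contains
exactly one cilium, and the cyclic invariance of `B_f^η` allows to choose ciliated faces that start
at the cilia. -/
theorem hamiltonian_eq_rhoAlgHom [Finite E] {Γ : CiliatedRibbonGraph V E} (hΓ : Γ.IsRegular)
    (hℓ : IsHaarIntegral (F := F) counit ℓ) (hη : IsHaarIntegral (dualCounit F H) η)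
    (hS : ∀ h : H, HopfAlgebra.antipode F (HopfAlgebra.antipode F h) = h)
    {a : V → H →ₐ[F] HeisenbergTensor F H E} {b : V → DualHopf F H →ₐ[F] HeisenbergTensor F H E}
    (ha : ∀ v, (a v).toLinearMap = iteratedConv comul counit
      ((Γ.ends v).map fun d => (edgeVertexHom (edgeHom hS) d).toLinearMap))
    (hb : ∀ v, (b v).toLinearMap = iteratedConv (dualComul F H) (dualCounit F H)
      ((Γ.siteFace v).map fun d => (edgeFaceHom (edgeHom hS) d).toLinearMap))
    (hc : ∀ u v, u ≠ v → (∀ g h, Commute (a u g) (a v h)) ∧ (∀ α β, Commute (b u α) (b v β)) ∧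
      ∀ h α, Commute (a u h) (b v α))
    {L : List V} {M : List Γ.Face} {rep : Γ.Face → List (E × Bool)} (hLn : L.Nodup)
    (hL : ∀ v, v ∈ L) (hMn : M.Nodup) (hM : ∀ f, f ∈ M)
    (hrep : ∀ f, (rep f : Cycle (E × Bool)) = f.1) :
    (L.map fun v => Γ.vertexOp (F := F) v ℓ).prod * (M.map fun f => faceOp F H (rep f) η).prod =
      rhoAlgHom E hS (L.map fun v => a v ℓ * b v η).prod := by
  have hA : ∀ v h, rhoAlgHom E hS (a v h) = Γ.vertexOp (F := F) v h := fun v h => by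
    have := rhoAlgHom_comp_vertex (F := F) (H := H) hS (Γ.ends v)
    rw [← ha] at this
    exact LinearMap.congr_fun this h
  have hB : ∀ v α, rhoAlgHom E hS (b v α) = faceOp F H (Γ.siteFace v) α := fun v α => by
    have := rhoAlgHom_comp_face (F := F) (H := H) hS (Γ.siteFace v)
    rw [← hb] at this
    exact LinearMap.congr_fun this α
  choose site hsite hface using hΓ.exists_siteFace
  have hinj : Function.Injective site := fun f g h =>
    Subtype.ext (by rw [← hface f, ← hface g, h])
  have hsurj : ∀ v, Γ.ends v ≠ [] → ∃ f, site f = v := by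
    intro v hv
    refine ⟨⟨_, Γ.isCiliatedFace_siteFace v hv⟩, ?_⟩
    obtain ⟨d, l, hd⟩ := List.exists_cons_of_ne_nil hv
    have h1 := Γ.rev_mem_siteFace (v := v) (d := d) (by rw [hd]; rfl)
    refine hΓ.eq_of_mem_siteFace (a := rev d) ?_ h1
    rw [← Cycle.mem_coe_iff, hface]
    exact h1
  -- `B_f^η` only depends on the face
  have hrot : ∀ f, faceOp F H (rep f) η = rhoAlgHom E hS (b (site f) η) := by
    intro f
    have hr : (rep f).IsRotated (Γ.siteFace (site f)) := by
      rw [← Cycle.coe_eq_coe, hrep, hface]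
    have hnd : (rep f).Nodup := by
      have := f.2.2.1
      rw [← hrep f] at this
      exact this
    rw [hB]
    exact iteratedConv_apply_of_isRotated (comm_comul_dual_haar hℓ hη)
      (List.pairwise_map.2 (hnd.imp fun hd => commute_faceTerm hS hd)) (hr.map _)
  -- an isolated vertex carries the trivial face
  have hisol : ∀ v, Γ.ends v = [] → b v η = 1 := by
    intro v hv
    have h1 := LinearMap.congr_fun (hb v) η
    rw [Γ.siteFace_of_ends_eq_nil hv] at h1
    refine h1.trans ?_
    change algebraMap F _ (dualCounit F H η) = 1
    rw [hη.2, map_one]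
  have hbc : (L.map fun v => b v η).prod = (M.map fun f => b (site f) η).prod := by
    have hperm : L.Perm (M.map site ++ L.filter fun v => (Γ.ends v).isEmpty) := by
      refine (List.perm_ext_iff_of_nodup hLn ?_).2 fun v => ?_
      · refine List.nodup_append'.2 ⟨hMn.map hinj, hLn.filter _, ?_⟩
        intro v hv hv'
        obtain ⟨f, -, rfl⟩ := List.mem_map.1 hv
        exact hsite f (List.isEmpty_iff.1 (List.mem_filter.1 hv').2)
      · refine ⟨fun _ => ?_, fun _ => hL v⟩
        rw [List.mem_append]
        by_cases hv : Γ.ends v = []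
        · exact Or.inr (List.mem_filter.2 ⟨hL v, List.isEmpty_iff.2 hv⟩)
        · obtain ⟨f, rfl⟩ := hsurj v hv
          exact Or.inl (List.mem_map_of_mem (hM f))
    have hcomm : ∀ u v, Commute (b u η) (b v η) := fun u v => by
      by_cases huv : u = v
      · rw [huv]
      · exact (hc u v huv).2.1 η η
    rw [list_prod_eq_of_perm hcomm hperm, List.map_append, List.prod_append, List.map_map]
    rw [List.prod_eq_one (l := (L.filter fun v => (Γ.ends v).isEmpty).map fun v => b v η), mul_one]
    · rfl
    · intro x hx
      obtain ⟨v, hv, rfl⟩ := List.mem_map.1 hx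
      exact hisol v (List.isEmpty_iff.1 (List.mem_filter.1 hv).2)
  rw [← prod_haar_mul_prod_haar hc hLn, hbc, map_mul, map_list_prod, map_list_prod, List.map_map,
    List.map_map]
  congr 2
  · exact List.map_congr_left fun v _ => (hA v ℓ).symm
  · exact List.map_congr_left fun f _ => hrot f

end Hamiltonian

/-- Elements that commute with an idempotent `e` act on the image of `e`. -/
theorem exists_restrict_range {F A W : Type*} [Field F] [Ring A] [Algebra F A] [AddCommGroup W]
    [Module F W] (r : A →ₐ[F] Module.End F W) (K : Subalgebra F A) {e : A}
    (he : IsIdempotentElem e) (hK : ∀ X ∈ K, Commute e X) :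
    ∃ R : K →ₐ[F] Module.End F (LinearMap.range (r e)),
      (∀ (X : K) (x : LinearMap.range (r e)),
        (R X x : W) = r X x ∧ (R X x : W) = r e (r X x)) ∧
      ∀ X Y : K, (Y : A) = X * e → R X = R Y := by
  have h1 : ∀ x ∈ LinearMap.range (r e), r e x = x := by
    rintro _ ⟨x, rfl⟩
    rw [← Module.End.mul_apply, ← map_mul, he.eq]
  have h2 : ∀ X : K, ∀ x : W, r e (r X x) = r X (r e x) := fun X x => by
    rw [← Module.End.mul_apply, ← Module.End.mul_apply, ← map_mul, ← map_mul, (hK X X.2).eq]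
  have h3 : ∀ X : K, ∀ x ∈ LinearMap.range (r e), r X x ∈ LinearMap.range (r e) :=
    fun X x hx => ⟨r X x, by rw [h2, h1 x hx]⟩
  refine ⟨AlgHom.ofLinearMap
    { toFun := fun X => (r X).restrict (h3 X)
      map_add' := fun X Y => LinearMap.ext fun x => Subtype.ext (by simp)
      map_smul' := fun c X => LinearMap.ext fun x => Subtype.ext (by simp) }
    (LinearMap.ext fun x => Subtype.ext (by simp))
    (fun X Y => LinearMap.ext fun x => Subtype.ext (by simp)), fun X x => ⟨rfl, ?_⟩,
    fun X Y hXY => LinearMap.ext fun x => Subtype.ext ?_⟩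
  · change r X x = r e (r X x)
    rw [h2, h1 x x.2]
  · change r X x = r Y x
    rw [hXY, map_mul, Module.End.mul_apply, h1 x x.2]

end

end Kitaev

theorem proposition6p4 {F H V E : Type*} [Field F] [CharZero F]
    [Ring H] [HopfAlgebra F H] [FiniteDimensional F H] [IsSemisimpleRing H]
    [Fintype V] [Fintype E] [DecidableEq E]
    (Γ : Kitaev.CiliatedRibbonGraph V E) (hΓ : Γ.IsRegular)
    (ℓ : H) (hℓ : Kitaev.IsHaarIntegral (F := F) Coalgebra.counit ℓ)
    (η : Kitaev.DualHopf F H) (hη : Kitaev.IsHaarIntegral (Kitaev.dualCounit F H) η) :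
    ∃ Ainv : Subalgebra F (Kitaev.HeisenbergTensor F H E),
      -- the gauge-invariant subalgebra: the image of `Q_inv`, which consists of the invariants
      Subalgebra.toSubmodule Ainv = LinearMap.range (Γ.invProj ℓ η) ∧
      (∀ X, X ∈ Ainv ↔ ∀ (v : V) (δ : Kitaev.DualHopf F H) (z : H),
        Γ.gaugeAction v δ z X = (Kitaev.dualCounit F H δ * Coalgebra.counit (R := F) z) • X) ∧
      -- the elements `G_v` are commuting idempotents in the centre of the gauge-invariant subalgebra
      (∀ v, Γ.siteElement ℓ η v ∈ Ainv ∧ IsIdempotentElem (Γ.siteElement ℓ η v) ∧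
        ∀ X ∈ Ainv, Commute (Γ.siteElement ℓ η v) X) ∧
      (∀ v w, Commute (Γ.siteElement ℓ η v) (Γ.siteElement ℓ η w)) ∧
      -- the maps `Q_v` are commuting projectors
      (∀ v, IsIdempotentElem (Γ.siteProj ℓ η v)) ∧
      (∀ v w, Commute (Γ.siteProj ℓ η v) (Γ.siteProj ℓ η w)) ∧
      (∀ v X, Γ.siteProj ℓ η v (Γ.gaugeAction v η ℓ X) =
        Γ.siteElement ℓ η v * X * Γ.siteElement ℓ η v) ∧
      -- `Q_flat` is right multiplication by the product of the `G_v` (in any order), a projector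
      (∀ L : List V, L.Nodup → (∀ v, v ∈ L) → ∀ X,
        Γ.flatProj ℓ η X = X * (L.map (Γ.siteElement ℓ η)).prod) ∧
      IsIdempotentElem (Γ.flatProj ℓ η) ∧
      -- on the gauge-invariant subalgebra it is multiplicative, and it projects on a subalgebra
      -- with unit `Q_flat(1)`
      (∀ X ∈ Ainv, ∀ Y ∈ Ainv,
        Γ.flatProj ℓ η (X * Y) = Γ.flatProj ℓ η X * Γ.flatProj ℓ η Y) ∧
      (∃ Aflat : NonUnitalSubalgebra F (Kitaev.HeisenbergTensor F H E),
        (Aflat : Set (Kitaev.HeisenbergTensor F H E)) =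
          Γ.flatProj ℓ η '' (Ainv : Set (Kitaev.HeisenbergTensor F H E)) ∧
        (∀ Y ∈ Aflat, Y ∈ Ainv ∧ Γ.flatProj ℓ η Y = Y ∧
          Γ.flatProj ℓ η 1 * Y = Y ∧ Y * Γ.flatProj ℓ η 1 = Y)) ∧
      -- the Hamiltonian: it does not depend on the order of the factors or on the ciliated faces
      -- that represent the faces, is a projector, and equals `ρ(Q_flat(1))`
      (∀ (L : List V) (M : List Γ.Face) (rep : Γ.Face → List (E × Bool)),
        L.Nodup → (∀ v, v ∈ L) → M.Nodup → (∀ f, f ∈ M) →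
        (∀ f, (rep f : Cycle (E × Bool)) = f.1) →
        Γ.hamiltonian ℓ η = (L.map fun v => Γ.vertexOp (F := F) v ℓ).prod *
          (M.map fun f => Kitaev.faceOp F H (rep f) η).prod) ∧
      IsIdempotentElem (Γ.hamiltonian ℓ η) ∧
      Γ.hamiltonian ℓ η = Kitaev.rho F H E (Γ.flatProj ℓ η 1) ∧
      -- the induced representation on the protected space
      (∃ ρpr : Ainv →ₐ[F] Module.End F (Γ.protectedSpace ℓ η),
        (∀ (X : Ainv) (x : Γ.protectedSpace ℓ η),
          (ρpr X x : Kitaev.ExtendedSpace F H E) = Kitaev.rho F H E X x ∧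
          (ρpr X x : Kitaev.ExtendedSpace F H E) =
            Γ.hamiltonian ℓ η (Kitaev.rho F H E X x)) ∧
        (∀ X Y : Ainv, (Y : Kitaev.HeisenbergTensor F H E) = Γ.flatProj ℓ η X →
          ρpr X = ρpr Y)) := by
  have hS := Kitaev.antipode_antipode hℓ hη
  obtain ⟨a, b, ha, hb, hD, hc⟩ :=
    Kitaev.exists_siteHoms (σ := Kitaev.edgeHom (E := E) hS)
      (fun _ _ h => Kitaev.commute_edgeHom hS h) hΓ hS
  have hA : ∀ v, Kitaev.holPrimal F H (Γ.vertexLoop v) = (a v).toLinearMap := fun v =>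
    (Kitaev.holPrimal_map_thickRBar hS _ (hΓ.nodup_fst_ends v)).trans (ha v).symm
  have hB : ∀ v, Kitaev.holDual F H (Kitaev.faceLoop (Γ.siteFace v)) = (b v).toLinearMap :=
    fun v => (Kitaev.holDual_faceLoop hS _ (hΓ.nodup_fst_siteFace v)).trans (hb v).symm
  have hgauge : ∀ v δ z, Γ.gaugeAction v δ z = Kitaev.adjointAction (a v) (b v) δ z := by
    intro v δ z
    rw [Kitaev.CiliatedRibbonGraph.gaugeAction, hA, hB]
    rfl
  have hG : Γ.siteElement ℓ η = fun v => a v ℓ * b v η := by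
    funext v
    exact congrArg₂ (· * ·) (LinearMap.congr_fun (hA v) ℓ) (LinearMap.congr_fun (hB v) η)
  have hGi : ∀ v, IsIdempotentElem (Γ.siteElement ℓ η v) := fun v => by
    rw [hG]
    exact (hD v).isIdempotentElem hℓ hη
  let K := ⨅ v, Kitaev.siteCommutant (a v) (b v)
  have hGK : ∀ v, Γ.siteElement ℓ η v ∈ K := fun v => by
    rw [hG]
    exact Kitaev.haar_mul_mem_iInf hℓ hη hD hc v
  have hGc : ∀ v, ∀ X ∈ K, Commute (Γ.siteElement ℓ η v) X := fun v X hX => by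
    rw [hG]
    exact Kitaev.commute_haar_mul_of_mem hX v
  have hGG : ∀ v w, Commute (Γ.siteElement ℓ η v) (Γ.siteElement ℓ η w) :=
    fun v w => hGc v _ (hGK w)
  let V' := (Finset.univ : Finset V).toList
  have hVn : V'.Nodup := Finset.nodup_toList _
  have hV : ∀ v, v ∈ V' := fun v => Finset.mem_toList.2 (Finset.mem_univ v)
  have hflat : ∀ L : List V, L.Nodup → (∀ v, v ∈ L) → ∀ X,
      Γ.flatProj ℓ η X = X * (L.map (Γ.siteElement ℓ η)).prod := by
    intro L hLn hL X
    refine (Kitaev.list_prod_mulRight_apply _ V' X).trans ?_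
    rw [Kitaev.list_prod_eq_of_perm hGG
      ((List.perm_ext_iff_of_nodup (List.nodup_reverse.2 hVn) hLn).2 fun v =>
        ⟨fun _ => hL v, fun _ => List.mem_reverse.2 (hV v)⟩)]
  let e := (V'.map (Γ.siteElement ℓ η)).prod
  have hfe : ∀ X, Γ.flatProj ℓ η X = X * e := hflat V' hVn hV
  have hf1 : Γ.flatProj ℓ η 1 = e := by rw [hfe, one_mul]
  have hei : IsIdempotentElem e := Kitaev.isIdempotentElem_list_prod hGG hGi V'
  have heK : e ∈ K := Subalgebra.list_prod_mem K fun x hx => by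
    obtain ⟨v, -, rfl⟩ := List.mem_map.1 hx
    exact hGK v
  have hec : ∀ X ∈ K, Commute e X := fun X hX => Commute.list_prod_left _ _ fun x hx => by
    obtain ⟨v, -, rfl⟩ := List.mem_map.1 hx
    exact hGc v X hX
  have hmul : ∀ X ∈ K, ∀ Y ∈ K,
      Γ.flatProj ℓ η (X * Y) = Γ.flatProj ℓ η X * Γ.flatProj ℓ η Y := by
    intro X _ Y hY
    rw [hfe, hfe, hfe, mul_assoc X e, ← mul_assoc e Y, (hec Y hY).eq, mul_assoc Y e, hei.eq,
      mul_assoc]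
  have hidem : ∀ X, Γ.flatProj ℓ η (Γ.flatProj ℓ η X) = Γ.flatProj ℓ η X := fun X => by
    rw [hfe, hfe, mul_assoc, hei.eq]
  have hH : ∀ (L : List V) (M : List Γ.Face) (rep : Γ.Face → List (E × Bool)),
      L.Nodup → (∀ v, v ∈ L) → M.Nodup → (∀ f, f ∈ M) →
      (∀ f, (rep f : Cycle (E × Bool)) = f.1) →
      (L.map fun v => Γ.vertexOp (F := F) v ℓ).prod *
        (M.map fun f => Kitaev.faceOp F H (rep f) η).prod = Kitaev.rhoAlgHom E hS e := by
    intro L M rep hLn hL hMn hM hrep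
    rw [Kitaev.hamiltonian_eq_rhoAlgHom hΓ hℓ hη hS ha hb hc hLn hL hMn hM hrep, ← hf1,
      hflat L hLn hL, one_mul, hG]
  have hHK : Γ.hamiltonian ℓ η = Kitaev.rhoAlgHom E hS e :=
    hH V' _ (fun f => Quot.out f.1) hVn hV (Finset.nodup_toList _)
      (fun f => Finset.mem_toList.2 (Finset.mem_univ f)) (fun f => Quot.out_eq f.1)
  refine ⟨K, ?_, fun X => ?_, fun v => ⟨hGK v, hGi v, hGc v⟩, hGG, fun v => ?_, fun v w => ?_,
    fun v X => ?_, hflat, LinearMap.ext hidem, hmul, ?_, ?_, ?_, ?_, ?_⟩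
  · rw [← Kitaev.range_prod_adjointAction hℓ hη hD hc V' hV]
    congr 2
    exact List.map_congr_left fun v _ => (hgauge v η ℓ).symm
  · rw [Algebra.mem_iInf]
    refine forall_congr' fun v => ?_
    simp only [hgauge, Kitaev.adjointAction_eq_iff hS, Kitaev.mem_siteCommutant]
  · refine LinearMap.ext fun X => ?_
    change X * _ * _ = X * _
    rw [mul_assoc, (hGi v).eq]
  · refine LinearMap.ext fun X => ?_
    change X * _ * _ = X * _ * _
    rw [mul_assoc, mul_assoc, (hGG v w).eq]
  · rw [hgauge]
    change _ * Γ.siteElement ℓ η v = _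
    rw [hG]
    exact (hD v).adjointAction_mul hℓ hη X
  · refine ⟨
      { carrier := Γ.flatProj ℓ η '' (K : Set (Kitaev.HeisenbergTensor F H E))
        add_mem' := ?_
        zero_mem' := ⟨0, zero_mem K, map_zero _⟩
        mul_mem' := ?_
        smul_mem' := ?_ }, rfl, ?_⟩
    · rintro _ _ ⟨X, hX, rfl⟩ ⟨Y, hY, rfl⟩
      exact ⟨X + Y, add_mem hX hY, map_add _ _ _⟩
    · rintro _ _ ⟨X, hX, rfl⟩ ⟨Y, hY, rfl⟩
      exact ⟨X * Y, mul_mem hX hY, hmul X hX Y hY⟩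
    · rintro c _ ⟨X, hX, rfl⟩
      exact ⟨c • X, K.smul_mem hX c, map_smul _ _ _⟩
    · rintro _ ⟨X, hX, rfl⟩
      refine ⟨?_, hidem X, ?_, ?_⟩
      · rw [hfe]
        exact mul_mem hX heK
      · rw [hf1, hfe, ← mul_assoc, (hec X hX).eq, mul_assoc, hei.eq]
      · rw [hf1, hfe, mul_assoc, hei.eq]
  · intro L M rep hLn hL hMn hM hrep
    rw [hHK, hH L M rep hLn hL hMn hM hrep]
  · rw [hHK]
    exact hei.map (Kitaev.rhoAlgHom E hS)
  · rw [hHK, hf1, Kitaev.rhoAlgHom_apply]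
  · rw [Kitaev.CiliatedRibbonGraph.protectedSpace, hHK]
    obtain ⟨R, hR1, hR2⟩ := Kitaev.exists_restrict_range (Kitaev.rhoAlgHom E hS) K hei hec
    exact ⟨R, hR1, fun X Y hXY => hR2 X Y (hXY.trans (hfe X))⟩
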